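/- Let $k\ge 2$ be an integer and let $B$ be the UHF algebra of type $k^\infty$, i.e. a unital $C^*$-algebra that is the closure of an increasing union of unital $*$-subalgebras $B_n\cong M_{k^n}(\mathbb C)$. Let $\tau$ be the unique tracial state of $B$. For bounded sequences $(x_n),(y_n)$ in $B$ write $(x_n)_n=(y_n)_n$ if $\|x_n-y_n\|\to 0$, i.e. if they agree in $B^\infty=\ell^\infty(\mathbb N,B)/c_0(B)$, and write $(x_n)_n\in B_\infty=B^\infty\cap B'$ if $\|x_nb-bx_n\|\to0$ for every $b\in B$ (central sequence). Let $\beta$ be an automorphism of $B$ with the Rohlin property: for every $N\in\mathbb N$ there are finitely many integers $h_1,\dots,h_m\ge N$ such that for every finite $F\subset B$ and $\varepsilon>0$ there are projections $e_{i,j}\in B$ ($1\le i\le m$, $0\le j<h_i$) with $\sum_{i,j}e_{i,j}=1$, $\|\beta(e_{i,j})-e_{i,j+1}\|<\varepsilon$ (where $e_{i,h_i}=e_{i,0}$) and $\|xe_{i,j}-e_{i,j}x\|<\varepsilon$ for all $x\in F$ and all $i,j$. For a unitary $u\in B$ connected to $1$ by a piecewise continuously differentiable path $\xi:[0,1]\to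 U(B)$, $\xi(0)=1$, $\xi(1)=u$, let $$\Delta_\tau(u)=\frac1{2\pi\sqrt{-1}}\int_0^1\tau(\dot\xi(t)\xi(t)^*)\,dt+\tau(K_0(B))\in\mathbb R/\tau(K_0(B))$$ be the de la Harpe–Skandalis determinant, where $\tau(K_0(B))\subset\mathbb R$ is the subgroup generated by the values of the unnormalized trace $\mathrm{Tr}\otimes\tau$ on the projections of $M_r(B)$, $r\in\mathbb N$. Let $u_n\in B$, $n\in\mathbb N$, be unitaries with $(u_n)_n\in B_\infty$ and $\Delta_\tau(u_n)=0$ for every $n\in\mathbb N$. Then there are unitaries $v_n\in B$, $n\in\mathbb N$, such that $(v_n)_n\in B_\infty$, $$(v_n\beta(v_n)^*)_n=(u_n)_n,$$ and, for every $n\in\mathbb N$, the spectrum of $v_n\beta(v_n)^*u_n^*$ does not contain $-1$ and $\tau\bigl(\log(v_n\beta(v_n)^*u_n^*)\bigr)=0$, where $\log$ is the principal branch on the complement of the closed negative real half-line. -/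

import Mathlib

open scoped ComplexOrder

namespace RohlinUHF

/-- `B` is a UHF algebra of type (rank) `k^∞`: it is the closure of the union of an increasing
sequence of unital `*`-subalgebras, the `n`-th of which is isomorphic to the algebra of
`k^n × k^n` complex matrices. -/
def IsUHFPow (k : ℕ) (B : Type*) [CStarAlgebra B] : Prop :=
  ∃ φ : ∀ n : ℕ, Matrix (Fin (k ^ n)) (Fin (k ^ n)) ℂ →⋆ₐ[ℂ] B,
    (∀ n, Function.Injective (φ n)) ∧
    (∀ n, Set.range (φ n) ⊆ Set.range (φ (n + 1))) ∧
    Dense (⋃ n, Set.range (φ n))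

/-- Tracial states of a unital C*-algebra: positive unital linear functionals with the trace
property. -/
structure IsTracialState {B : Type*} [CStarAlgebra B] (τ : B →ₗ[ℂ] ℂ) : Prop where
  nonneg : ∀ a, 0 ≤ τ (star a * a)
  map_one : τ 1 = 1
  map_mul_comm : ∀ a b, τ (a * b) = τ (b * a)

/-- The Rohlin property of an automorphism `α` of a unital C*-algebra: for every `k` there are
`h 0, …, h (m - 1) ≥ k` such that, for every finite subset `F` and every `ε > 0`, there is a partition
of unity by projections `e i j`, `i < m`, `j < h i`, which almost commute with `F` and which `α`
almost permutes cyclically within each of the `m` towers.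
(Projections with sum `1` are mutually orthogonal.) -/
def HasRohlinProperty {B : Type*} [CStarAlgebra B] (α : B ≃⋆ₐ[ℂ] B) : Prop :=
  ∀ k : ℕ, ∃ (m : ℕ) (h : Fin m → ℕ), (∀ i, k ≤ h i) ∧
    ∀ (F : Finset B) (ε : ℝ), 0 < ε → ∃ e : Fin m → ℕ → B,
      (∀ i, ∀ j < h i, IsStarProjection (e i j)) ∧
      ∑ i, ∑ j ∈ Finset.range (h i), e i j = 1 ∧
      (∀ i, ∀ j < h i, ‖α (e i j) - e i ((j + 1) % h i)‖ < ε) ∧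
      (∀ i, ∀ j < h i, ∀ x ∈ F, ‖x * e i j - e i j * x‖ < ε)

/-- `x` and `y` define the same element of `B^∞ = ℓ^∞(ℕ, B) / c₀(B)`. -/
def SeqEq {B : Type*} [CStarAlgebra B] (x y : ℕ → B) : Prop :=
  Filter.Tendsto (fun n => ‖x n - y n‖) Filter.atTop (nhds 0)

/-- `(x n)` is a bounded sequence whose class in `B^∞ = ℓ^∞(ℕ, B) / c₀(B)` commutes with every
constant sequence, that is, it belongs to the central sequence algebra `B_∞ = B^∞ ∩ B'`. -/
def IsCentralSequence {B : Type*} [CStarAlgebra B] (x : ℕ → B) : Prop :=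
  (∃ C : ℝ, ∀ n, ‖x n‖ ≤ C) ∧ ∀ b : B, SeqEq (fun n => x n * b) (fun n => b * x n)

/-- The subgroup `τ(K₀(B))` of `ℝ`, generated by the (unnormalized) traces of the projections in the
matrix algebras over `B`. These traces are real, so taking the real part loses nothing. -/
def traceK0 {B : Type*} [CStarAlgebra B] (τ : B →ₗ[ℂ] ℂ) : AddSubgroup ℝ :=
  AddSubgroup.closure
    {r : ℝ | ∃ (n : ℕ) (p : Matrix (Fin n) (Fin n) B),
      IsStarProjection p ∧ r = (∑ i, τ (p i i)).re}

/-- `ξ` restricts to a piecewise continuously differentiable path `[0,1] → U(B)`. -/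
def IsUnitaryPath {B : Type*} [CStarAlgebra B] (ξ : ℝ → B) : Prop :=
  (∀ t ∈ Set.Icc (0 : ℝ) 1, ξ t ∈ unitary B) ∧
  ∃ (N : ℕ) (s : ℕ → ℝ), s 0 = 0 ∧ s N = 1 ∧
    ∀ i < N, s i < s (i + 1) ∧ ContDiffOn ℝ 1 ξ (Set.Icc (s i) (s (i + 1)))

/-- The number `(2πi)⁻¹ ∫₀¹ τ(ξ'(t) ξ(t)*) dt` of a path of unitaries. It is real, as `ξ' ξ*` is
skew-adjoint, so taking the real part loses nothing. -/
noncomputable def pathDet {B : Type*} [CStarAlgebra B] (τ : B →ₗ[ℂ] ℂ) (ξ : ℝ → B) : ℝ :=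
  ((2 * Real.pi * Complex.I)⁻¹ * ∫ t in (0 : ℝ)..1, τ (deriv ξ t * star (ξ t))).re

/-- `HasDeterminant τ u d`: the unitary `u` is joined to `1` by a piecewise continuously
differentiable path of unitaries (so `u ∈ U₀(B)`), and `d` is the de la Harpe–Skandalis determinant
`Δ_τ(u) ∈ ℝ / τ(K₀(B))`, the class of the number `pathDet τ ξ` of such a path `ξ`. -/
def HasDeterminant {B : Type*} [CStarAlgebra B] (τ : B →ₗ[ℂ] ℂ) (u : unitary B)
    (d : ℝ ⧸ traceK0 τ) : Prop :=
  ∃ ξ : ℝ → B, IsUnitaryPath ξ ∧ ξ 0 = 1 ∧ ξ 1 = u ∧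
    d = QuotientAddGroup.mk (pathDet τ ξ)

/-- The domain of the standard logarithm on normal elements: the spectrum avoids the closed negative
real half-line. -/
def InLogDomain {B : Type*} [CStarAlgebra B] (a : B) : Prop :=
  IsStarNormal a ∧ spectrum ℂ a ⊆ Complex.slitPlane

/-- `log a` through the continuous functional calculus, with the principal branch of `log`. -/
noncomputable def clog {B : Type*} [CStarAlgebra B] (a : B) : B :=
  cfc Complex.log a

end RohlinUHF

/-! The argument has two stages, followed by a diagonal choice of indices.

Approximate solution (`exists_approx_cobounding`). On a Rohlin tower of height `h` let `U_j = u β(u)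
⋯ β^(j-1)(u)`, and let `z` be a path of unitaries from `1` to approximately `β^(-h)(U_h*)`. With
`x_j = U_j β^j(z(j/h))` on level `j`, the elements `u β(x_j)` and `x_(j+1)` differ by one step of
the path, and the top level closes up because `U_h β^h(z(1))` is close to `1`. Compressing the `x_j`
by the Rohlin projections and summing gives, almost, a unitary `v` with `v β(v)*` close to `u`. If
`u` almost commutes with enough elements, `β^(-h)(U_h*)` is close to a unitary in a matrix algebra
that commutes with a prescribed one. Such a unitary has finite spectrum, so it is joined to `1`
inside the same commutant with Lipschitz constant `π`. Hence tall towers make the steps small and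
`v` is almost central.

Correction of the trace (`exists_traceless_cobounding`). Let `g = v β(v)* u*`, which is close to
`1`. Since the trace is `β`-invariant, `v` and `β(v)` have the same determinant, and that of `u`
vanishes, so `τ(log g) = 2πi r` with `r ∈ ℤ[1/k]`, and `r` is small (`trLog_defect`). Take an almost
central projection `p` of trace `r` under one level of a tower (for `r ≥ 0`; adjoints handle `r <
0`), so that `p, β(p), …, β^n(p)` are almost orthogonal. For `y = exp(i ∑ 2π(j+1)/n β^j(p))`, summed
over `j < n`, the product `y β(y)*` is nearly `exp(i (2π/n) ∑ β^j(p))`: the coefficient at `β^n(p)`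
is `2π` and exponentiates to `1`. Thus `y β(y)*` is near `1` and its logarithm has trace exactly
`2πi r` (`exists_unitary_of_almost_orthogonal`). Using `-r` and replacing `v` by `v y` cancels the
defect.

Exact traces are tracked by `trLog`, a power series that is additive near `1`, and by `Reach`, which
adds its values along chains of small steps. Integrality comes from matrix determinants: `det W =
exp(k^l · trLog W)` near `1`, so the total along a closed chain lies in `2πi ℤ[1/k]`
(`Reach.of_one`). -/

open scoped ComplexOrder

namespace RohlinUHF

set_option linter.unusedSectionVars false

variable {k : ℕ} {B : Type*} [CStarAlgebra B] [Nontrivial B]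

/-! ### The trace of the logarithm near `1` -/

section TraceLog

/-- The trace of the logarithm, as a power series around `1`. -/
noncomputable def trLog (T : B →L[ℂ] ℂ) (a : B) : ℂ :=
  -∑' n : ℕ, ((n : ℂ) + 1)⁻¹ * T ((1 - a) ^ (n + 1))

/-- Under the trace the `n + 1` terms in the derivative of `(1 - x)^(n+1)` coincide and cancel the
coefficient `1/(n+1)`. What remains is the geometric series of `x⁻¹`. -/
theorem hasFDerivAt_trLog {T : B →L[ℂ] ℂ} (hT : ∀ a b, T (a * b) = T (b * a)) {x : B}
    (hx : ‖x - 1‖ < 1) :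
    HasFDerivAt (trLog T) (T ∘L ContinuousLinearMap.mul ℂ B (Ring.inverse x)) x := by
  obtain ⟨r, hr, hr1⟩ := exists_between hx
  have hr0 : 0 ≤ r := (norm_nonneg _).trans hr.le
  let f' : ℕ → B → B →L[ℂ] ℂ := fun n x => -(T ∘L ContinuousLinearMap.mul ℂ B ((1 - x) ^ n))
  have hf : ∀ (n : ℕ) (x : B), HasFDerivAt (fun x : B => ((n : ℂ) + 1)⁻¹ * T ((1 - x) ^ (n + 1))) (f' n x) x := by
    intro n x
    have h1 : HasFDerivAt (fun x : B => (1 - x) ^ (n + 1)) _ x :=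
      HasFDerivAt.pow' ((hasFDerivAt_id (𝕜 := ℂ) x).const_sub 1) (n + 1)
    have h2 := ((T.hasFDerivAt.comp x h1).const_mul ((n : ℂ) + 1)⁻¹)
    refine h2.congr_fderiv ?_
    ext y
    have h3 : ∀ i ∈ Finset.range (n + 1), -T ((1 - x) ^ (n - i) * y * (1 - x) ^ i) =
        -T ((1 - x) ^ n * y) := by
      intro i hi
      rw [hT, ← mul_assoc, ← pow_add, Nat.add_sub_cancel' (by simpa [Nat.lt_succ_iff] using hi)]
    have h4 : ((n : ℂ) + 1) ≠ 0 := by exact_mod_cast Nat.succ_ne_zero n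
    simp only [f', map_sum, ContinuousLinearMap.comp_apply, sum_apply, smul_eq_mul,
      smul_apply, neg_apply, MulOpposite.smul_eq_mul_unop,
      MulOpposite.unop_op, ContinuousLinearMap.mul_apply', ContinuousLinearMap.id_apply,
      Nat.pred_eq_sub_one, add_tsub_cancel_right, id_eq, map_neg, neg_mul, mul_neg]
    rw [Finset.sum_congr rfl fun i hi => h3 i hi]
    simp [h4]
  have hball : ∀ y ∈ Metric.ball (1 : B) r, ‖1 - y‖ < r := by
    intro y hy
    rwa [Metric.mem_ball, dist_comm, dist_eq_norm] at hy
  have key := hasFDerivAt_tsum_of_isPreconnected (𝕜 := ℂ) (u := fun n : ℕ => ‖T‖ * r ^ n)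
    (s := Metric.ball (1 : B) r) (x₀ := 1) (x := x)
    ((summable_geometric_of_lt_one hr0 hr1).mul_left _) Metric.isOpen_ball
    (Metric.isPreconnected_ball) (fun n x _ => hf n x) (fun n y hy => by
      rw [norm_neg]
      refine (ContinuousLinearMap.opNorm_comp_le _ _).trans ?_
      refine mul_le_mul_of_nonneg_left ?_ (norm_nonneg T)
      refine (ContinuousLinearMap.opNorm_mul_apply_le ℂ B _).trans ((norm_pow_le _ _).trans ?_)
      exact pow_le_pow_left₀ (norm_nonneg _) (hball y hy).le _) (Metric.mem_ball_self ((norm_nonneg _).trans_lt hr))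
    (by simp) (by rwa [Metric.mem_ball, dist_eq_norm])
  have h5 : ‖1 - x‖ < 1 := by rwa [norm_sub_rev]
  have := key.neg
  refine this.congr_fderiv ?_
  have hs := hasSum_geom_series_inverse (1 - x) h5
  rw [sub_sub_cancel] at hs
  have hs' := (((ContinuousLinearMap.compL ℂ B B ℂ T) ∘L ContinuousLinearMap.mul ℂ B).hasSum hs).neg
  have : HasSum (fun n => f' n x) (-(T ∘L ContinuousLinearMap.mul ℂ B (Ring.inverse x))) := by
    simpa [f'] using hs'
  rw [this.tsum_eq, neg_neg]

@[simp] theorem trLog_one (T : B →L[ℂ] ℂ) : trLog T 1 = 0 := by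
  simp [trLog]

theorem trLog_comp {T : B →L[ℂ] ℂ} {ξ : ℝ → B} {ξ' : B} {t : ℝ} {s : Set ℝ}
    (hT : ∀ a b, T (a * b) = T (b * a))
    (hξ : HasDerivWithinAt ξ ξ' s t) (h1 : ‖ξ t - 1‖ < 1) :
    HasDerivWithinAt (fun t => trLog T (ξ t)) (T (Ring.inverse (ξ t) * ξ')) s t := by
  have := ((hasFDerivAt_trLog hT h1).restrictScalars ℝ).comp_hasDerivWithinAt t hξ
  exact this

theorem isUnit_of_norm_sub_one_lt {a : B} (ha : ‖a - 1‖ < 1) : IsUnit a := by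
  have := (Units.oneSub (1 - a) (by rwa [norm_sub_rev])).isUnit
  simpa using this

theorem eq_of_hasDerivWithinAt_eq {f g : ℝ → ℂ} {f' : ℝ → ℂ}
    (hf : ∀ t ∈ Set.Icc (0 : ℝ) 1, HasDerivWithinAt f (f' t) (Set.Icc 0 1) t)
    (hg : ∀ t ∈ Set.Icc (0 : ℝ) 1, HasDerivWithinAt g (f' t) (Set.Icc 0 1) t) :
    f 1 - f 0 = g 1 - g 0 := by
  have h := norm_image_sub_le_of_norm_deriv_le_segment_01' (f := fun t => f t - g t)
    (f' := fun _ => 0) (C := 0) (fun t ht => ((hf t ht).sub (hg t ht)).congr_deriv (sub_self _)) (by simp)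
  have h2 := norm_le_zero_iff.1 h
  linear_combination h2

theorem hasDerivWithinAt_lineMap_one (b : B) (s : Set ℝ) (t : ℝ) :
    HasDerivWithinAt (fun t : ℝ => 1 + t • (b - 1)) (b - 1) s t := by
  simpa using (((hasDerivAt_id t).smul_const (b - 1)).const_add 1).hasDerivWithinAt (s := s)

theorem norm_lineMap_one_le (b : B) {t : ℝ} (ht : t ∈ Set.Icc (0 : ℝ) 1) :
    ‖1 + t • (b - 1) - 1‖ ≤ ‖b - 1‖ := by
  rw [add_sub_cancel_left, norm_smul, Real.norm_of_nonneg ht.1]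
  exact mul_le_of_le_one_left (norm_nonneg _) ht.2

theorem norm_mul_sub_one_le (a b : B) :
    ‖a * b - 1‖ ≤ ‖a - 1‖ + ‖b - 1‖ + ‖a - 1‖ * ‖b - 1‖ := by
  have : a * b - 1 = (a - 1) + (b - 1) + (a - 1) * (b - 1) := by noncomm_ring
  rw [this]
  exact (norm_add_le _ _).trans (add_le_add (norm_add_le _ _) (norm_mul_le _ _))

/-- Along the segment `b_t` from `1` to `b`, both `trLog (a b_t)` and `trLog b_t` have derivative `T
(b_t⁻¹ (b - 1))`. The bound `2/5` keeps `a b_t` in the unit ball around `1`, since `2/5 + 2/5 + 4/25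
< 1`. -/
theorem trLog_mul {T : B →L[ℂ] ℂ} (hT : ∀ a b, T (a * b) = T (b * a)) {a b : B}
    (ha : ‖a - 1‖ ≤ 2 / 5) (hb : ‖b - 1‖ ≤ 2 / 5) : trLog T (a * b) = trLog T a + trLog T b := by
  have hbt : ∀ t ∈ Set.Icc (0 : ℝ) 1, ‖1 + t • (b - 1) - 1‖ ≤ 2 / 5 := fun t ht =>
    (norm_lineMap_one_le b ht).trans hb
  have key := eq_of_hasDerivWithinAt_eq
    (f := fun t : ℝ => trLog T (a * (1 + t • (b - 1)))) (g := fun t : ℝ => trLog T (1 + t • (b - 1)))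
    (f' := fun t => T (Ring.inverse (1 + t • (b - 1)) * (b - 1)))
    (fun t ht => ?_) (fun t ht => ?_)
  · simp only [one_smul, add_sub_cancel, zero_smul, add_zero, mul_one, trLog_one, sub_zero] at key
    linear_combination key
  · have h1 : ‖a * (1 + t • (b - 1)) - 1‖ < 1 := by
      refine (norm_mul_sub_one_le _ _).trans_lt ?_
      have := hbt t ht
      nlinarith [norm_nonneg (a - 1), norm_nonneg (1 + t • (b - 1) - 1)]
    have h2 := trLog_comp hT ((hasDerivWithinAt_lineMap_one b (Set.Icc 0 1) t).const_mul a) h1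
    refine h2.congr_deriv ?_
    have hu : IsUnit a := isUnit_of_norm_sub_one_lt (by linarith)
    obtain ⟨d, hd⟩ : IsUnit (1 + t • (b - 1)) :=
      isUnit_of_norm_sub_one_lt ((hbt t ht).trans_lt (by norm_num))
    obtain ⟨c, rfl⟩ := hu
    rw [← hd, ← Units.val_mul, Ring.inverse_unit, Ring.inverse_unit, mul_inv_rev, Units.val_mul,
      mul_assoc, Units.inv_mul_cancel_left]
  · exact trLog_comp hT (hasDerivWithinAt_lineMap_one b (Set.Icc 0 1) t)
      ((hbt t ht).trans_lt (by norm_num))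

theorem trLog_units_conj (T : B →L[ℂ] ℂ) (hT : ∀ a b, T (a * b) = T (b * a)) (c : Bˣ) (a : B) :
    trLog T (c * a * ↑c⁻¹) = trLog T a := by
  have : ∀ n : ℕ, T ((1 - c * a * ↑c⁻¹) ^ n) = T ((1 - a) ^ n) := by
    intro n
    have h : 1 - c * a * ↑c⁻¹ = c * (1 - a) * ↑c⁻¹ := by simp [mul_sub, sub_mul]
    rw [h, Units.conj_pow, hT, Units.inv_mul_cancel_left]
  simp [trLog, this]

/-- Closeness to `1` is required along the whole segment `exp (t h)`, not only at its end: this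
excludes other branches of the logarithm. -/
theorem trLog_exp {T : B →L[ℂ] ℂ} (hT : ∀ a b, T (a * b) = T (b * a)) {h : B}
    (hh : ∀ t ∈ Set.Icc (0 : ℝ) 1, ‖NormedSpace.exp (t • h) - 1‖ < 1) :
    trLog T (NormedSpace.exp h) = T h := by
  have key := eq_of_hasDerivWithinAt_eq
    (f := fun t : ℝ => trLog T (NormedSpace.exp (t • h))) (g := fun t : ℝ => (t : ℂ) * T h)
    (f' := fun t => T h)
    (fun t ht => ?_) (fun t ht => ?_)
  · simpa using key
  · have h1 := (hasDerivAt_exp_smul_const (𝕂 := ℝ) h t).hasDerivWithinAt (s := Set.Icc 0 1)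
    refine (trLog_comp hT h1 (hh t ht)).congr_deriv ?_
    rw [← mul_assoc, Ring.inverse_mul_cancel _ (isUnit_of_norm_sub_one_lt (hh t ht)), one_mul]
  · have h2 := ((hasDerivAt_id t).ofReal_comp).mul_const (T h)
    simpa using h2.hasDerivWithinAt (s := Set.Icc 0 1)

theorem norm_trLog_le {T : B →L[ℂ] ℂ} {a : B} (ha : ‖a - 1‖ ≤ 1 / 2) :
    ‖trLog T a‖ ≤ 2 * ‖T‖ * ‖a - 1‖ := by
  rw [trLog, norm_neg]
  have h0 : ‖1 - a‖ = ‖a - 1‖ := norm_sub_rev _ _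
  have hs : HasSum (fun n : ℕ => ‖T‖ * ‖a - 1‖ * (1 / 2 : ℝ) ^ n) (‖T‖ * ‖a - 1‖ * 2) :=
    hasSum_geometric_two.mul_left _
  refine (tsum_of_norm_bounded hs fun n => ?_).trans (le_of_eq (by ring))
  have hn : ‖((n : ℂ) + 1)⁻¹‖ ≤ 1 := by
    rw [norm_inv]
    refine inv_le_one_of_one_le₀ ?_
    have : ‖(n : ℂ) + 1‖ = n + 1 := by
      exact_mod_cast Complex.norm_natCast (n + 1)
    rw [this]; linarith [n.cast_nonneg (α := ℝ)]
  rw [norm_mul]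
  calc _ ≤ 1 * (‖T‖ * ‖(1 - a) ^ (n + 1)‖) := by gcongr; exact T.le_opNorm _
    _ ≤ 1 * (‖T‖ * ‖1 - a‖ ^ (n + 1)) := by gcongr; exact norm_pow_le _ _
    _ ≤ _ := by
      rw [h0, pow_succ, one_mul, mul_assoc, mul_comm (‖a - 1‖ ^ n)]
      gcongr

end TraceLog

/-! ### Perturbation of unitaries and projections inside closed subalgebras -/

section Functional

theorem cfc_real_mem {S : StarSubalgebra ℂ B} (hS : IsClosed (S : Set B)) {a : B} (ha : a ∈ S)
    (f : ℝ → ℝ) : cfc f a ∈ S :=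
  have : IsClosed (S : Set B) := hS
  cfc_mem (𝕜 := ℝ) (𝕜' := ℂ) f ha

theorem cfc_complex_mem {S : StarSubalgebra ℂ B} (hS : IsClosed (S : Set B)) {a : B} (ha : a ∈ S)
    (f : ℂ → ℂ) : cfc f a ∈ S :=
  have : IsClosed (S : Set B) := hS
  cfc_mem (𝕜 := ℂ) (𝕜' := ℂ) f ha

theorem abs_sub_one_le_of_mem_spectrum {b : B} (hb : IsSelfAdjoint b) {x : ℝ}
    (hx : x ∈ spectrum ℝ b) : |x - 1| ≤ ‖b - 1‖ := by
  have h1 : cfc (fun x : ℝ => x - 1) b = b - 1 := by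
    rw [cfc_sub (fun x => x) (fun _ => 1) b, cfc_id' ℝ b, cfc_const_one ℝ b]
  have := norm_apply_le_norm_cfc (fun x : ℝ => x - 1) b hx
  rwa [h1, Real.norm_eq_abs] at this

/-- The unitary polar part of an invertible element stays in any closed `*`-subalgebra. -/
theorem exists_unitary_mem_near_of_isUnit {S : StarSubalgebra ℂ B} (hS : IsClosed (S : Set B)) {x : B}
    (hx : x ∈ S) (hxunit : IsUnit x) {δ : ℝ} (hδ : δ ≤ 17 / 64) (hb1 : ‖star x * x - 1‖ ≤ δ) :
    ∃ w ∈ unitary B, w ∈ S ∧ ‖w - x‖ ≤ ‖x‖ * δ := by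
  have hδ0 : 0 ≤ δ := (norm_nonneg _).trans hb1
  set b := star x * x with hbdef
  have hbsa : IsSelfAdjoint b := IsSelfAdjoint.star_mul_self x
  have hsp : ∀ y ∈ spectrum ℝ b, |y - 1| ≤ 17 / 64 := fun y hy =>
    (abs_sub_one_le_of_mem_spectrum hbsa hy).trans (by linarith)
  have hpos : ∀ y ∈ spectrum ℝ b, 1 / 2 ≤ y := fun y hy => by
    have := abs_le.1 (hsp y hy); linarith
  let f : ℝ → ℝ := fun y => (√y)⁻¹
  have hf : ContinuousOn f (spectrum ℝ b) := by
    refine ContinuousOn.inv₀ Real.continuous_sqrt.continuousOn fun y hy => ?_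
    exact (Real.sqrt_pos.2 (by linarith [hpos y hy])).ne'
  set c := cfc f b with hc
  have hcsa : IsSelfAdjoint c := cfc_predicate f b
  have hcbc : c * b * c = 1 := by
    have : cfc (fun y => f y * y * f y) b = c * b * c := by
      rw [cfc_mul (fun y => f y * y) f b, cfc_mul f (fun y => y) b, cfc_id' ℝ b]
    rw [← this, ← cfc_const_one ℝ b]
    refine cfc_congr fun y hy => ?_
    have hy0 := hpos y hy
    have := Real.mul_self_sqrt (show 0 ≤ y by linarith)
    have h0 := (Real.sqrt_pos.2 (show 0 < y by linarith)).ne'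
    simp only [f]
    field_simp
    nlinarith
  have hc1 : ‖c - 1‖ ≤ δ := by
    have : cfc (fun y => f y - 1) b = c - 1 := by
      rw [cfc_sub f (fun _ => 1) b, cfc_const_one ℝ b]
    rw [← this]
    refine norm_cfc_le hδ0 fun y hy => ?_
    refine le_trans ?_ ((abs_sub_one_le_of_mem_spectrum hbsa hy).trans hb1)
    have hy0 := hpos y hy
    have h2 := Real.mul_self_sqrt (show 0 ≤ y by linarith)
    have h0 : 1 / 2 ≤ √y := Real.le_sqrt_of_sq_le (by linarith)
    have h3 : f y - 1 = (1 - y) * ((√y)⁻¹ * (1 + √y)⁻¹) := by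
      simp only [f]
      field_simp
      nlinarith
    rw [h3, Real.norm_eq_abs, abs_mul, abs_sub_comm]
    refine mul_le_of_le_one_right (abs_nonneg _) ?_
    rw [abs_of_nonneg (by positivity), ← mul_inv]
    refine inv_le_one_of_one_le₀ ?_
    nlinarith
  have hw1 : star (x * c) * (x * c) = 1 := by
    rw [star_mul, hcsa.star_eq, ← hcbc, hbdef]; simp only [mul_assoc]
  have hcunit : IsUnit c := isUnit_of_norm_sub_one_lt (by linarith)
  have hwunit : IsUnit (x * c) := hxunit.mul hcunit
  refine ⟨x * c, ⟨hw1, ?_⟩, mul_mem hx (cfc_real_mem hS (mul_mem (star_mem hx) hx) f), ?_⟩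
  · obtain ⟨v, hv⟩ := hwunit
    rw [← hv] at hw1 ⊢
    calc (v : B) * star (v : B) = v * (star (v : B) * v) * ↑v⁻¹ := by
          rw [mul_assoc, mul_assoc, Units.mul_inv, mul_one]
      _ = 1 := by rw [hw1, mul_one, Units.mul_inv]
  · have : x * c - x = x * (c - 1) := by rw [mul_sub, mul_one]
    rw [this]
    exact norm_mul_le_of_le le_rfl hc1

/-- The unitary polar part of an element close to a unitary stays in any closed `*`-subalgebra. -/
theorem exists_unitary_mem_near {S : StarSubalgebra ℂ B} (hS : IsClosed (S : Set B)) {x : B}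
    (hx : x ∈ S) {u : B} (hu : u ∈ unitary B) {δ : ℝ} (hδ : δ ≤ 1 / 8) (hxu : ‖x - u‖ ≤ δ) :
    ∃ w ∈ unitary B, w ∈ S ∧ ‖w - u‖ ≤ 4 * δ := by
  have hδ0 : 0 ≤ δ := (norm_nonneg _).trans hxu
  have hu1 : ‖u‖ = 1 := CStarRing.norm_of_mem_unitary hu
  have hx1 : ‖x‖ ≤ 1 + δ := by
    calc ‖x‖ = ‖u + (x - u)‖ := by rw [add_sub_cancel]
      _ ≤ _ := (norm_add_le _ _).trans (by rw [hu1]; linarith)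
  -- The sum of the two terms is at most `(‖x‖ + 1) δ ≤ (2 + δ) δ`, and `δ ≤ 1/8`. This also
  -- accounts for the threshold `17/64 = 17/8 · 1/8` of the polar lemma.
  have hb1 : ‖star x * x - 1‖ ≤ 17 / 8 * δ := by
    have h : star x * x - 1 = star x * (x - u) + star (x - u) * u := by
      rw [star_sub, mul_sub, sub_mul, Unitary.star_mul_self_of_mem hu]; abel
    rw [h]
    refine (norm_add_le _ _).trans ?_
    have h1 := norm_mul_le (star x) (x - u)
    have h2 := norm_mul_le (star (x - u)) u
    rw [norm_star] at h1 h2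
    rw [hu1] at h2
    nlinarith [norm_nonneg (x - u), norm_nonneg x]
  have hxunit : IsUnit x := by
    have h1 : IsUnit (x * star u) := by
      refine isUnit_of_norm_sub_one_lt ?_
      have : x * star u - 1 = (x - u) * star u := by rw [sub_mul, Unitary.mul_star_self_of_mem hu]
      rw [this]
      refine (norm_mul_le _ _).trans_lt ?_
      rw [norm_star, hu1]; linarith
    have h2 : IsUnit u := (Unitary.toUnits ⟨u, hu⟩).isUnit
    have := h1.mul h2
    rwa [mul_assoc, Unitary.star_mul_self_of_mem hu, mul_one] at this
  obtain ⟨w, hw, hwS, hwx⟩ := exists_unitary_mem_near_of_isUnit hS hx hxunit (by linarith) hb1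
  refine ⟨w, hw, hwS, ?_⟩
  calc ‖w - u‖ = ‖(w - x) + (x - u)‖ := by rw [sub_add_sub_cancel]
    _ ≤ ‖x‖ * (17 / 8 * δ) + δ := (norm_add_le _ _).trans (add_le_add hwx hxu)
    _ ≤ 4 * δ := by nlinarith

/-- The self-adjoint part `b` satisfies `‖b² - b‖ ≤ 4δ < 1/4`, so `1/2` is not in its spectrum and
the indicator of `(1/2, ∞)` is continuous there. This cut-off moves `b` by at most `8δ`. -/
theorem exists_projection_mem_near {S : StarSubalgebra ℂ B} (hS : IsClosed (S : Set B)) {a : B}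
    (ha : a ∈ S) {p : B} (hp : IsStarProjection p) {δ : ℝ} (hδ : δ ≤ 1 / 32) (hap : ‖a - p‖ ≤ δ) :
    ∃ q ∈ S, IsStarProjection q ∧ ‖q - p‖ ≤ 9 * δ := by
  have hδ0 : 0 ≤ δ := (norm_nonneg _).trans hap
  set b : B := (2 : ℂ)⁻¹ • (a + star a) with hbdef
  have hbS : b ∈ S := SMulMemClass.smul_mem _ (add_mem ha (star_mem ha))
  have hbsa : IsSelfAdjoint b := by
    rw [hbdef, isSelfAdjoint_iff, star_smul, star_add, star_star, add_comm]; simp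
  have hbp : ‖b - p‖ ≤ δ := by
    have h1 : b - p = (2 : ℂ)⁻¹ • ((a - p) + star (a - p)) := by
      rw [hbdef, star_sub, hp.isSelfAdjoint.star_eq, ← sub_eq_zero]
      module
    rw [h1, norm_smul]
    have := norm_add_le (a - p) (star (a - p))
    rw [norm_star] at this
    have h2 : ‖(2 : ℂ)⁻¹‖ = 1 / 2 := by norm_num
    rw [h2]; linarith
  have hp1 : ‖p‖ ≤ 1 := hp.norm_le
  have hb2 : ‖b * b - b‖ ≤ 4 * δ := by
    have h1 : b * b - b = b * (b - p) + (b - p) * p - (b - p) := by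
      have := hp.isIdempotentElem.eq
      rw [mul_sub, sub_mul, this]; abel
    have hb1 : ‖b‖ ≤ 1 + δ := by
      calc ‖b‖ = ‖p + (b - p)‖ := by rw [add_sub_cancel]
        _ ≤ _ := (norm_add_le _ _).trans (by linarith)
    rw [h1]
    refine (norm_sub_le _ _).trans ?_
    have h2 := norm_add_le (b * (b - p)) ((b - p) * p)
    have h3 := norm_mul_le b (b - p)
    have h4 := norm_mul_le (b - p) p
    nlinarith [norm_nonneg b, norm_nonneg (b - p), norm_nonneg p]
  have hsp : ∀ y ∈ spectrum ℝ b, |y * y - y| ≤ 4 * δ := fun y hy => by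
    have h1 : cfc (fun x : ℝ => x * x - x) b = b * b - b := by
      rw [cfc_sub (fun x => x * x) (fun x => x) b, cfc_mul (fun x => x) (fun x => x) b, cfc_id' ℝ b]
    have := norm_apply_le_norm_cfc (fun x : ℝ => x * x - x) b hy
    rw [h1, Real.norm_eq_abs] at this
    exact this.trans hb2
  have hne : ∀ y ∈ spectrum ℝ b, y ≠ 1 / 2 := by
    rintro y hy rfl
    have := hsp _ hy
    norm_num [abs_of_neg] at this
    linarith
  let f : ℝ → ℝ := fun y => if 1 / 2 < y then 1 else 0
  have hf : ContinuousOn f (spectrum ℝ b) := by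
    refine ContinuousOn.mono (s := {y : ℝ | y ≠ 1 / 2}) ?_ hne
    intro y hy
    refine ContinuousAt.continuousWithinAt ?_
    rcases lt_or_gt_of_ne hy with h | h
    · refine continuousAt_const.congr (f := fun _ => (0 : ℝ)) ?_
      filter_upwards [eventually_lt_nhds h] with z hz
      exact (if_neg (not_lt.2 hz.le)).symm
    · refine continuousAt_const.congr (f := fun _ => (1 : ℝ)) ?_
      filter_upwards [eventually_gt_nhds h] with z hz
      exact (if_pos hz).symm
  refine ⟨cfc f b, cfc_real_mem hS hbS f, ⟨?_, cfc_predicate f b⟩, ?_⟩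
  · rw [IsIdempotentElem, ← cfc_mul f f b]
    refine cfc_congr fun y _ => ?_
    simp only [f]; split_ifs <;> simp
  · have h1 : ‖cfc f b - b‖ ≤ 8 * δ := by
      have : cfc (fun y => f y - y) b = cfc f b - b := by
        rw [cfc_sub f (fun y => y) b, cfc_id' ℝ b]
      rw [← this]
      refine norm_cfc_le (by linarith) fun y hy => ?_
      have h2 := hsp y hy
      rw [Real.norm_eq_abs]
      have h3 : |y * y - y| = |y| * |y - 1| := by rw [← abs_mul]; ring_nf
      simp only [f]
      split_ifs with h
      · rw [abs_sub_comm]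
        have : 1 / 2 ≤ |y| := h.le.trans (le_abs_self y)
        nlinarith [abs_nonneg (y - 1)]
      · rw [zero_sub, abs_neg]
        have : 1 / 2 ≤ |y - 1| := by rw [abs_sub_comm]; exact le_trans (by linarith) (le_abs_self _)
        nlinarith [abs_nonneg y]
    calc _ = ‖(cfc f b - b) + (b - p)‖ := by rw [sub_add_sub_cancel]
      _ ≤ _ := (norm_add_le _ _).trans (by linarith)

/-- The element `z = pq + (1-p)(1-q)` intertwines `p` and `q` and is within `2‖p - q‖ < 1` of `1`,
so the projections are similar. Only traciality of `T` enters, so the lemma also serves the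
unnormalized trace on matrices over `B`. -/
theorem map_eq_of_projection_near {T : B → ℂ} (hT : ∀ a b, T (a * b) = T (b * a)) {p q : B}
    (hp : IsStarProjection p) (hq : IsStarProjection q) (hpq : ‖p - q‖ < 1 / 2) : T p = T q := by
  set z := p * q + (1 - p) * (1 - q) with hz
  have hpp := hp.isIdempotentElem.eq
  have hqq := hq.isIdempotentElem.eq
  have h1 : p * z = z * q := by
    rw [hz]
    calc _ = p * p * q + (p - p * p) * (1 - q) := by noncomm_ring
      _ = p * (q * q) + (1 - p) * (q - q * q) := by rw [hpp, hqq]; noncomm_ring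
      _ = _ := by noncomm_ring
  have hp1 : ‖p‖ ≤ 1 := hp.norm_le
  have hp2 : ‖1 - p‖ ≤ 1 := hp.one_sub.norm_le
  have h2 : z - 1 = p * (q - p) + (1 - p) * (p - q) := by
    have : z - 1 - (p * (q - p) + (1 - p) * (p - q)) = (p * p - p) + (p * p - p) := by
      rw [hz]; noncomm_ring
    rw [hpp, sub_self, add_zero] at this
    exact sub_eq_zero.1 this
  have h3 : IsUnit z := by
    refine isUnit_of_norm_sub_one_lt ?_
    rw [h2]
    refine (norm_add_le _ _).trans_lt ?_
    have h4 := norm_mul_le p (q - p)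
    have h5 := norm_mul_le (1 - p) (p - q)
    rw [norm_sub_rev q p] at h4
    nlinarith [norm_nonneg (p - q)]
  obtain ⟨c, hc⟩ := h3
  rw [← hc] at h1
  calc T p = T (p * c * ↑c⁻¹) := by rw [Units.mul_inv_cancel_right]
    _ = T q := by rw [h1, hT, Units.inv_mul_cancel_left]

section Orthogonal

variable {ι : Type*} [Fintype ι] [DecidableEq ι] {e : ι → B}

/-- Compressing `∑ e l = 1` by `e i` writes `e i` as a sum of the positive elements `(e l e i)* (e l
e i)`. The term `l = i` is already `e i`, so the others vanish. -/
theorem mul_eq_zero_of_sum_eq_one (he : ∀ i, IsStarProjection (e i)) (hs : ∑ i, e i = 1) {i j : ι}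
    (hij : i ≠ j) : e j * e i = 0 := by
  let _ := CStarAlgebra.spectralOrder B
  have := CStarAlgebra.spectralOrderedRing B
  have h1 : ∑ l ∈ Finset.univ.erase i, star (e l * e i) * (e l * e i) = 0 := by
    have h2 : ∑ l, star (e l * e i) * (e l * e i) = e i := by
      have : ∀ l, star (e l * e i) * (e l * e i) = e i * e l * e i := fun l => by
        rw [star_mul, (he l).isSelfAdjoint.star_eq, (he i).isSelfAdjoint.star_eq, mul_assoc,
          ← mul_assoc (e l) (e l), (he l).isIdempotentElem.eq, mul_assoc]
      simp_rw [this]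
      rw [← Finset.sum_mul, ← Finset.mul_sum, hs, mul_one, (he i).isIdempotentElem.eq]
    rw [← Finset.add_sum_erase _ _ (Finset.mem_univ i)] at h2
    rw [(he i).isIdempotentElem.eq, (he i).isSelfAdjoint.star_eq, (he i).isIdempotentElem.eq] at h2
    simpa using h2
  rw [Finset.sum_eq_zero_iff_of_nonneg fun l _ => star_mul_self_nonneg _] at h1
  exact CStarRing.star_mul_self_eq_zero_iff _ |>.1 (h1 j (by simp [hij.symm]))

/-- A block-diagonal element has the norm of its largest block. The bound does not grow with the
number of blocks, which is essential because the number of tower levels is not under control. -/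
theorem norm_sum_conj_le (he : ∀ i, IsStarProjection (e i)) (hs : ∑ i, e i = 1) (a : ι → B)
    {c : ℝ} (hc : 0 ≤ c) (ha : ∀ i, ‖a i‖ ≤ c) : ‖∑ i, e i * a i * e i‖ ≤ c := by
  let _ := CStarAlgebra.spectralOrder B
  have := CStarAlgebra.spectralOrderedRing B
  set X := ∑ i, e i * a i * e i with hX
  have h0 : ∀ i, e i * X = e i * a i * e i := by
    intro i
    rw [hX, Finset.mul_sum, Finset.sum_eq_single i]
    · rw [← mul_assoc, ← mul_assoc, (he i).isIdempotentElem.eq]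
    · intro j _ hj
      rw [← mul_assoc, ← mul_assoc, mul_eq_zero_of_sum_eq_one he hs hj, zero_mul, zero_mul]
    · simp
  have h1 : star X * X = ∑ i, e i * (star (e i * a i) * (e i * a i)) * e i := by
    calc star X * X = ∑ i, star X * (e i * e i) * X := by
          simp_rw [(he _).isIdempotentElem.eq]
          rw [← Finset.sum_mul, ← Finset.mul_sum, hs, mul_one]
      _ = ∑ i, star (e i * X) * (e i * X) := by
          refine Finset.sum_congr rfl fun i _ => ?_
          rw [star_mul, (he i).isSelfAdjoint.star_eq]; simp only [mul_assoc]
      _ = _ := by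
          refine Finset.sum_congr rfl fun i _ => ?_
          rw [h0, star_mul (e i * a i), (he i).isSelfAdjoint.star_eq]; simp only [mul_assoc]
  have h2 : star X * X ≤ algebraMap ℝ B (c ^ 2) := by
    have h3 : algebraMap ℝ B (c ^ 2) = ∑ i, e i * algebraMap ℝ B (c ^ 2) * e i := by
      have : ∀ i, e i * algebraMap ℝ B (c ^ 2) * e i = algebraMap ℝ B (c ^ 2) * e i := fun i => by
        rw [← Algebra.commutes, mul_assoc, (he i).isIdempotentElem.eq]
      simp_rw [this]
      rw [← Finset.mul_sum, hs, mul_one]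
    rw [h1, h3]
    refine Finset.sum_le_sum fun i _ => ?_
    have h4 : star (e i * a i) * (e i * a i) ≤ algebraMap ℝ B (c ^ 2) := by
      refine CStarAlgebra.star_mul_le_algebraMap_norm_sq.trans ?_
      have h5 : ‖e i * a i‖ ≤ c := (norm_mul_le _ _).trans
        ((mul_le_of_le_one_left (norm_nonneg _) (he i).norm_le).trans (ha i))
      have := pow_le_pow_left₀ (norm_nonneg _) h5 2
      exact algebraMap_mono B this
    have := star_left_conjugate_le_conjugate h4 (e i)
    rwa [(he i).isSelfAdjoint.star_eq] at this
  have h3 := (CStarAlgebra.norm_le_iff_le_algebraMap _ (by positivity)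
    (star_mul_self_nonneg X)).2 h2
  rw [CStarRing.norm_star_mul_self] at h3
  nlinarith [norm_nonneg X]

end Orthogonal

/-- The path is `exp (i t arg w)`. On a finite spectrum the jump of `arg` does no harm, and `|arg| ≤
π` gives a Lipschitz constant independent of `w` and of the size of the matrix algebra. -/
theorem exists_unitary_path {S : StarSubalgebra ℂ B} (hS : IsClosed (S : Set B)) {w : B}
    (hwu : w ∈ unitary B) (hw : w ∈ S) (hfin : (spectrum ℂ w).Finite) :
    ∃ z : ℝ → B, (∀ t, z t ∈ unitary B) ∧ (∀ t, z t ∈ S) ∧ z 0 = 1 ∧ z 1 = w ∧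
      ∀ s t, ‖z s - z t‖ ≤ Real.pi * |s - t| := by
  have hn : IsStarNormal w := ⟨by
    rw [commute_iff_eq, Unitary.star_mul_self_of_mem hwu, Unitary.mul_star_self_of_mem hwu]⟩
  let f : ℝ → ℂ → ℂ := fun t z => Complex.exp ((t * z.arg : ℝ) * Complex.I)
  have hf : ∀ t, ContinuousOn (f t) (spectrum ℂ w) := fun t => hfin.continuousOn _
  have hf' : ∀ t, ContinuousOn (fun z => star (f t z)) (spectrum ℂ w) := fun t => hfin.continuousOn _
  have hstar : ∀ t z, star (f t z) * f t z = 1 := fun t z => by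
    have := Complex.norm_exp_ofReal_mul_I (t * z.arg)
    rw [← starRingEnd_apply, ← Complex.normSq_eq_conj_mul_self, Complex.normSq_eq_norm_sq]
    simp only [f]; rw [this]; simp
  refine ⟨fun t => cfc (f t) w, fun t => ⟨?_, ?_⟩, fun t => cfc_complex_mem hS hw _, ?_, ?_,
    fun s t => ?_⟩
  · rw [← cfc_star, ← cfc_mul _ _ w (hf' t) (hf t), ← cfc_const_one ℂ w]
    exact cfc_congr fun z _ => hstar t z
  · rw [← cfc_star, ← cfc_mul _ _ w (hf t) (hf' t), ← cfc_const_one ℂ w]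
    exact cfc_congr fun z _ => (mul_comm _ _).trans (hstar t z)
  · rw [← cfc_const_one ℂ w]
    exact cfc_congr fun z _ => by simp [f]
  · conv_rhs => rw [← cfc_id' ℂ w]
    refine cfc_congr fun z hz => ?_
    have h1 := spectrum.norm_eq_one_of_unitary hwu hz
    have h2 := Complex.norm_mul_exp_arg_mul_I z
    rw [h1] at h2
    simpa [f] using h2
  · simp only
    rw [← cfc_sub _ _ w (hf s) (hf t)]
    refine norm_cfc_le (by positivity) fun z _ => ?_
    have h1 : f s z - f t z = f t z * (Complex.exp (Complex.I * ((s - t) * z.arg : ℝ)) - 1) := by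
      simp only [f]
      rw [mul_sub, ← Complex.exp_add, mul_one]
      congr 2
      push_cast; ring
    rw [h1, norm_mul, show ‖f t z‖ = 1 from Complex.norm_exp_ofReal_mul_I _, one_mul]
    refine (Real.norm_exp_I_mul_ofReal_sub_one_le).trans ?_
    rw [Real.norm_eq_abs, abs_mul, mul_comm]
    gcongr
    exact Complex.abs_arg_le_pi z

end Functional

/-! ### One-parameter unitary groups and products of almost commuting exponentials -/

section Exponential

/-- The unitary `exp (i t a)`. -/
noncomputable def expI (a : B) (t : ℝ) : B := NormedSpace.exp (t • (Complex.I • a))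

theorem expI_mem {a : B} (ha : IsSelfAdjoint a) (t : ℝ) : expI a t ∈ unitary B := by
  let _ : NormedAlgebra ℚ B := .restrictScalars ℚ ℂ B
  refine NormedSpace.exp_mem_unitary_of_mem_skewAdjoint ?_
  rw [skewAdjoint.mem_iff, star_smul, star_smul, ha.star_eq]
  simp

@[simp] theorem expI_zero (a : B) : expI a 0 = 1 := by simp [expI, NormedSpace.exp_zero]

theorem hasDerivAt_expI (a : B) (t : ℝ) :
    HasDerivAt (expI a) (Complex.I • a * expI a t) t :=
  hasDerivAt_exp_smul_const' (𝕂 := ℝ) (Complex.I • a) t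

theorem norm_mul_unitary {u : B} (hu : u ∈ unitary B) (a : B) : ‖a * u‖ = ‖a‖ :=
  CStarRing.norm_mul_mem_unitary a hu

theorem norm_unitary_mul {u : B} (hu : u ∈ unitary B) (a : B) : ‖u * a‖ = ‖a‖ :=
  CStarRing.norm_mem_unitary_mul a hu

theorem norm_I_smul (a : B) : ‖Complex.I • a‖ = ‖a‖ := by simp [norm_smul]

theorem norm_expI_sub_one_le {a : B} (ha : IsSelfAdjoint a) {t : ℝ} (ht : t ∈ Set.Icc (0 : ℝ) 1) :
    ‖expI a t - 1‖ ≤ ‖a‖ := by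
  have h := norm_image_sub_le_of_norm_deriv_le_segment' (f := expI a) (a := 0) (b := 1) (C := ‖a‖)
    (fun t _ => (hasDerivAt_expI a t).hasDerivWithinAt)
    (fun t _ => by rw [norm_mul_unitary (expI_mem ha t), norm_I_smul]) t ht
  rw [expI_zero, sub_zero] at h
  exact h.trans (mul_le_of_le_one_right (norm_nonneg _) ht.2)

theorem star_expI {a : B} (ha : IsSelfAdjoint a) (t : ℝ) : star (expI a t) = expI a (-t) := by
  rw [expI, expI, NormedSpace.star_exp, star_smul, star_smul, ha.star_eq]
  simp

theorem expI_commute (a : B) (t : ℝ) : expI a t * a = a * expI a t :=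
  (((Commute.refl a).smul_left _).smul_left _).exp_left

/-- The derivative of `exp(ita) f exp(-ita)` is a unitary conjugate of `i (a f - f a)`; integrate
over `[0, t]`. -/
theorem norm_expI_commutator_le {a : B} (ha : IsSelfAdjoint a) (f : B) :
    ∀ t ∈ Set.Icc (0 : ℝ) 1, ‖expI a t * f - f * expI a t‖ ≤ ‖a * f - f * a‖ := by
  intro t ht
  have hd : ∀ t, HasDerivAt (fun t => expI a t * f * expI a (-t))
      (expI a t * (Complex.I • (a * f - f * a)) * expI a (-t)) t := by
    intro t
    have h2 := (hasDerivAt_expI a (-t)).scomp t (hasDerivAt_neg t)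
    refine (((hasDerivAt_expI a t).mul_const f).mul h2).congr_deriv ?_
    have h3 := expI_commute a t
    simp only [Function.comp_apply, smul_mul_assoc, mul_smul_comm, neg_smul, one_smul, mul_neg,
      mul_sub, sub_mul, smul_sub]
    rw [← mul_assoc (expI a t) a f, h3, ← sub_eq_add_neg]
    simp only [mul_assoc]
  have h := norm_image_sub_le_of_norm_deriv_le_segment' (a := 0) (b := 1) (C := ‖a * f - f * a‖)
    (fun t _ => (hd t).hasDerivWithinAt)
    (fun t _ => by
      rw [norm_mul_unitary (expI_mem ha _), norm_unitary_mul (expI_mem ha _), norm_I_smul]) t ht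
  simp only [expI_zero, one_mul, neg_zero, mul_one, sub_zero] at h
  rw [← norm_mul_unitary (expI_mem ha (-t)), sub_mul, mul_assoc f, ← star_expI ha,
    Unitary.mul_star_self_of_mem (expI_mem ha t), mul_one, star_expI ha]
  exact h.trans (mul_le_of_le_one_right (norm_nonneg _) ht.2)

theorem norm_mul_commutator_le {u v : B} (hu : u ∈ unitary B) (hv : v ∈ unitary B) (f : B) :
    ‖u * v * f - f * (u * v)‖ ≤ ‖u * f - f * u‖ + ‖v * f - f * v‖ := by
  have : u * v * f - f * (u * v) = u * (v * f - f * v) + (u * f - f * u) * v := by noncomm_ring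
  rw [this]
  refine (norm_add_le _ _).trans ?_
  rw [norm_mul_unitary hv, norm_unitary_mul hu, add_comm]

theorem expI_eq_one_of_projection {q : B} (hq : IsStarProjection q) :
    expI ((2 * Real.pi : ℝ) • q) 1 = 1 := by
  have hd : ∀ t : ℝ, HasDerivAt (fun t : ℝ => expI q (-t) *
      (1 - q + Complex.exp (Complex.I * t) • q)) 0 t := by
    intro t
    have h1 := (hasDerivAt_expI q (-t)).scomp t (hasDerivAt_neg t)
    have h2 : HasDerivAt (fun t : ℝ => Complex.exp (Complex.I * t))
        (Complex.exp (Complex.I * t) * Complex.I) t := by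
      have := (((hasDerivAt_id t).ofReal_comp).const_mul Complex.I).cexp
      simpa using this
    refine (h1.mul ((h2.smul_const q).const_add (1 - q))).congr_deriv ?_
    have h3 := hq.isIdempotentElem.eq
    have h4 := expI_commute q (-t)
    simp only [Function.comp_apply, smul_mul_assoc, mul_smul_comm, neg_smul, one_smul,
      mul_sub, mul_one, mul_add, neg_mul]
    rw [← h4, mul_assoc (expI q (-t)) q q, h3, mul_comm (Complex.exp _) Complex.I]
    simp [smul_smul, mul_comm]
  have hc : ∀ t : ℝ, expI q (-t) * (1 - q + Complex.exp (Complex.I * t) • q) = 1 := by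
    intro t
    have := is_const_of_deriv_eq_zero (fun t => (hd t).differentiableAt) (fun t => (hd t).deriv) t 0
    simpa using this
  have h5 := hc (2 * Real.pi)
  have h6 : Complex.exp (Complex.I * ((2 * Real.pi : ℝ) : ℂ)) = 1 := by
    rw [mul_comm]; push_cast; exact Complex.exp_two_pi_mul_I
  rw [h6, one_smul, sub_add_cancel, mul_one] at h5
  have h7 := star_expI (a := q) hq.isSelfAdjoint (2 * Real.pi)
  rw [h5] at h7
  have h8 : expI q (2 * Real.pi) = 1 := by rw [← star_star (expI q _), h7, star_one]
  rw [← h8, expI, expI, one_smul, smul_comm]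

/-- A product of four one-parameter groups whose generators almost commute and sum to zero. -/
theorem trLog_expI_mul_expI {T : B →L[ℂ] ℂ} (hT : ∀ a b, T (a * b) = T (b * a)) {a : Fin 4 → B}
    (ha : ∀ i, IsSelfAdjoint (a i)) (hs : ∑ i, a i = 0) {η : ℝ} (hη : 6 * η < 1)
    (hcomm : ∀ i j, ‖a i * a j - a j * a i‖ ≤ η) :
    ‖expI (a 0) 1 * expI (a 1) 1 * expI (a 2) 1 * expI (a 3) 1 - 1‖ ≤ 6 * η ∧
      trLog T (expI (a 0) 1 * expI (a 1) 1 * expI (a 2) 1 * expI (a 3) 1) = 0 := by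
  have hη0 : 0 ≤ η := (norm_nonneg _).trans (hcomm 0 0)
  set e : Fin 4 → ℝ → B := fun i t => expI (a i) t with he
  have hu : ∀ i t, e i t ∈ unitary B := fun i t => expI_mem (ha i) t
  have hc : ∀ i j, ∀ t ∈ Set.Icc (0 : ℝ) 1, ‖e i t * a j - a j * e i t‖ ≤ η := fun i j t ht =>
    (norm_expI_commutator_le (ha i) (a j) t ht).trans (hcomm i j)
  have hd : ∀ i t, HasDerivAt (e i) (Complex.I • a i * e i t) t := fun i t => hasDerivAt_expI _ _
  set G : ℝ → B := fun t => e 0 t * e 1 t * e 2 t * e 3 t with hG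
  have hGu : ∀ t, G t ∈ unitary B := fun t =>
    mul_mem (mul_mem (mul_mem (hu 0 t) (hu 1 t)) (hu 2 t)) (hu 3 t)
  -- Substituting `a 0 = -(a 1 + a 2 + a 3)` turns the derivative of `G` into `i R`, which consists
  -- of commutators only. Expanding them gives six elementary commutators, hence the factor `6`.
  let R : ℝ → B := fun t => (e 0 t * a 1 - a 1 * e 0 t) * (e 1 t * e 2 t * e 3 t) +
    (e 0 t * e 1 t * a 2 - a 2 * (e 0 t * e 1 t)) * (e 2 t * e 3 t) +
    (e 0 t * e 1 t * e 2 t * a 3 - a 3 * (e 0 t * e 1 t * e 2 t)) * e 3 t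
  have hdG' : ∀ t, HasDerivAt G (Complex.I • (a 0 * e 0 t * e 1 t * e 2 t * e 3 t +
      e 0 t * a 1 * e 1 t * e 2 t * e 3 t + e 0 t * e 1 t * a 2 * e 2 t * e 3 t +
      e 0 t * e 1 t * e 2 t * a 3 * e 3 t)) t := by
    intro t
    refine ((((hd 0 t).mul (hd 1 t)).mul (hd 2 t)).mul (hd 3 t)).congr_deriv ?_
    simp only [Pi.mul_apply, smul_mul_assoc, mul_smul_comm, smul_add, add_mul, mul_assoc]
  have hdG : ∀ t, HasDerivAt G (Complex.I • R t) t := by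
    intro t
    refine (hdG' t).congr_deriv ?_
    congr 1
    have : a 0 = -(a 1 + a 2 + a 3) := by
      rw [Fin.sum_univ_four] at hs
      rw [eq_neg_iff_add_eq_zero, ← hs]; abel
    simp only [R]
    rw [this]; noncomm_ring
  have hR : ∀ t ∈ Set.Icc (0 : ℝ) 1, ‖R t‖ ≤ 6 * η := by
    intro t ht
    have h1 := norm_mul_commutator_le (hu 0 t) (hu 1 t) (a 2)
    have h2 := norm_mul_commutator_le (mul_mem (hu 0 t) (hu 1 t)) (hu 2 t) (a 3)
    have h3 := norm_mul_commutator_le (hu 0 t) (hu 1 t) (a 3)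
    refine (norm_add₃_le).trans ?_
    rw [norm_mul_unitary (mul_mem (mul_mem (hu 1 t) (hu 2 t)) (hu 3 t)),
      norm_mul_unitary (mul_mem (hu 2 t) (hu 3 t)), norm_mul_unitary (hu 3 t)]
    linarith [hc 0 1 t ht, hc 0 2 t ht, hc 1 2 t ht, hc 0 3 t ht, hc 1 3 t ht, hc 2 3 t ht]
  have hG0 : G 0 = 1 := by simp [hG, he]
  have hnear : ∀ t ∈ Set.Icc (0 : ℝ) 1, ‖G t - 1‖ ≤ 6 * η := by
    intro t ht
    have h := norm_image_sub_le_of_norm_deriv_le_segment' (f := G) (a := 0) (b := 1) (C := 6 * η)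
      (fun t _ => (hdG t).hasDerivWithinAt)
      (fun t ht => by rw [norm_I_smul]; exact hR t ⟨ht.1, ht.2.le⟩) t ht
    rw [hG0, sub_zero] at h
    exact h.trans (mul_le_of_le_one_right (by positivity) ht.2)
  refine ⟨hnear 1 (by simp), ?_⟩
  have key := eq_of_hasDerivWithinAt_eq (f := fun t => trLog T (G t)) (g := fun _ => 0)
    (f' := fun _ => 0) (fun t ht => ?_) (fun t _ => hasDerivWithinAt_const _ _ _)
  · simpa [hG0] using key
  · refine (trLog_comp hT (hdG' t).hasDerivWithinAt ((hnear t ht).trans_lt hη)).congr_deriv ?_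
    obtain ⟨x, hx⟩ : ∃ x : ∀ _ : Fin 4, Bˣ, ∀ i, (x i : B) = e i t :=
      ⟨fun i => Unitary.toUnits ⟨e i t, hu i t⟩, fun i => rfl⟩
    have hGx : G t = ((x 0 * x 1 * x 2 * x 3 : Bˣ) : B) := by simp [hG, hx]
    rw [hGx, Ring.inverse_unit, ← hx 0, ← hx 1, ← hx 2, ← hx 3, mul_smul_comm, map_smul, mul_add,
      mul_add, mul_add, map_add, map_add, map_add]
    -- Under the trace every `a i` in `G⁻¹ G'` is conjugated back to itself, so the derivative of
    -- `trLog G` is `i T (∑ a i) = 0` exactly, although the `a i` commute only approximately.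
    have hconj : ∀ (g h k : Bˣ) (b : B), g = h * k → T (↑g⁻¹ * (h * b * k)) = T b := by
      rintro g h k b rfl
      rw [mul_inv_rev, Units.val_mul, mul_assoc, mul_assoc (h : B), Units.inv_mul_cancel_left, hT,
        mul_assoc, Units.mul_inv, mul_one]
    have e0 := hconj (x 0 * x 1 * x 2 * x 3) 1 (x 0 * x 1 * x 2 * x 3) (a 0) (by group)
    have e1 := hconj (x 0 * x 1 * x 2 * x 3) (x 0) (x 1 * x 2 * x 3) (a 1) (by group)
    have e2 := hconj (x 0 * x 1 * x 2 * x 3) (x 0 * x 1) (x 2 * x 3) (a 2) (by group)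
    have e3 := hconj (x 0 * x 1 * x 2 * x 3) (x 0 * x 1 * x 2) (x 3) (a 3) (by group)
    simp only [Units.val_mul, Units.val_one, one_mul, ← mul_assoc] at e0 e1 e2 e3 ⊢
    rw [e0, e1, e2, e3, ← map_add, ← map_add, ← map_add, ← Fin.sum_univ_four, hs]
    simp

theorem trLog_expI {T : B →L[ℂ] ℂ} (hT : ∀ a b, T (a * b) = T (b * a)) {a : B}
    (ha : IsSelfAdjoint a) (h1 : ‖a‖ < 1) : trLog T (expI a 1) = Complex.I * T a := by
  rw [expI, one_smul, trLog_exp hT, map_smul, smul_eq_mul]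
  exact fun t ht => (norm_expI_sub_one_le ha ht).trans_lt h1

end Exponential

/-- A sequence of matrix subalgebras exhibiting `B` as a UHF algebra of type `k^∞`. -/
structure UHFSystem (k : ℕ) (B : Type*) [CStarAlgebra B] where
  φ : ∀ n : ℕ, Matrix (Fin (k ^ n)) (Fin (k ^ n)) ℂ →⋆ₐ[ℂ] B
  two_le : 2 ≤ k
  inj : ∀ n, Function.Injective (φ n)
  mono_succ : ∀ n, Set.range (φ n) ⊆ Set.range (φ (n + 1))
  dense : Dense (⋃ n, Set.range (φ n))

/-- The real numbers `z / k ^ l` with integral `z`. -/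
def kAdic (k : ℕ) : AddSubgroup ℝ where
  carrier := {r | ∃ (l : ℕ) (z : ℤ), r * (k : ℝ) ^ l = z}
  zero_mem' := ⟨0, 0, by simp⟩
  add_mem' := by
    rintro a b ⟨l, z, h⟩ ⟨l', z', h'⟩
    refine ⟨l + l', z * k ^ l' + z' * k ^ l, ?_⟩
    push_cast
    rw [← h, ← h']; ring
  neg_mem' := by
    rintro a ⟨l, z, h⟩
    exact ⟨l, -z, by push_cast; rw [← h]; ring⟩

/-! ### Projections in complex matrix algebras -/

section Matrices

theorem trace_idempotent_eq_nat {n : Type*} [Fintype n] [DecidableEq n] {q : Matrix n n ℂ}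
    (hq : q * q = q) : ∃ r : ℕ, q.trace = r := by
  have h : IsIdempotentElem (Matrix.toLin' q) := by
    rw [IsIdempotentElem, Module.End.mul_eq_comp, ← Matrix.toLin'_mul, hq]
  have h2 := (LinearMap.IsIdempotentElem.isProj_range _ h).trace
  rw [Matrix.trace_toLin'_eq] at h2
  exact ⟨_, h2⟩

theorem exists_projection_le {n : Type*} [Fintype n] [DecidableEq n] {e : Matrix n n ℂ}
    (he : IsStarProjection e) {r j : ℕ} (hr : e.trace = r) (hj : j ≤ r) :
    ∃ p : Matrix n n ℂ, IsStarProjection p ∧ p * e = p ∧ p.trace = j := by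
  have hH : e.IsHermitian := he.isSelfAdjoint
  set U := hH.eigenvectorUnitary with hU
  set d : n → ℂ := fun i => (hH.eigenvalues i : ℂ) with hd
  have hUU : star (U : Matrix n n ℂ) * U = 1 := Unitary.star_mul_self_of_mem U.2
  have hUU' : (U : Matrix n n ℂ) * star (U : Matrix n n ℂ) = 1 := Unitary.mul_star_self_of_mem U.2
  have hspec : e = U * Matrix.diagonal d * star (U : Matrix n n ℂ) := by
    have := hH.spectral_theorem
    rw [Unitary.conjStarAlgAut_apply] at this
    exact this
  have hmul : ∀ a b : Matrix n n ℂ, (U * a * star (U : Matrix n n ℂ)) *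
      (U * b * star (U : Matrix n n ℂ)) = U * (a * b) * star (U : Matrix n n ℂ) := by
    intro a b
    calc _ = U * a * (star (U : Matrix n n ℂ) * U) * b * star (U : Matrix n n ℂ) := by
          simp only [mul_assoc]
      _ = _ := by rw [hUU, mul_one]; simp only [mul_assoc]
  have hinj : ∀ a b : Matrix n n ℂ, U * a * star (U : Matrix n n ℂ) =
      U * b * star (U : Matrix n n ℂ) → a = b := by
    intro a b hab
    have := congrArg (fun x => star (U : Matrix n n ℂ) * x * U) hab
    simp only [mul_assoc, hUU, mul_one] at this
    rwa [← mul_assoc, ← mul_assoc, hUU, one_mul, one_mul] at this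
  have htr : ∀ a : Matrix n n ℂ, (U * a * star (U : Matrix n n ℂ)).trace = a.trace := by
    intro a
    rw [Matrix.trace_mul_comm, ← mul_assoc, hUU, one_mul]
  have hd2 : ∀ i, d i * d i = d i := by
    have h1 := he.isIdempotentElem.eq
    rw [hspec, hmul] at h1
    have h2 := hinj _ _ h1
    rw [Matrix.diagonal_mul_diagonal] at h2
    exact fun i => congrFun (Matrix.diagonal_injective h2) i
  have hd01 : ∀ i, d i = 0 ∨ d i = 1 := fun i => by
    have : d i * (d i - 1) = 0 := by rw [mul_sub, hd2, mul_one, sub_self]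
    rcases mul_eq_zero.1 this with h | h
    · exact Or.inl h
    · exact Or.inr (sub_eq_zero.1 h)
  classical
  set s : Finset n := Finset.univ.filter fun i => d i = 1 with hs
  have hcard : s.card = r := by
    have h1 : e.trace = s.card := by
      rw [hspec, htr, Matrix.trace_diagonal, hs, Finset.card_filter]
      push_cast
      refine Finset.sum_congr rfl fun i _ => ?_
      rcases hd01 i with h | h <;> simp [h]
    rw [hr] at h1
    exact_mod_cast h1.symm
  obtain ⟨t, hts, htc⟩ := Finset.exists_subset_card_eq (hcard ▸ hj : j ≤ s.card)
  set c : n → ℂ := fun i => if i ∈ t then 1 else 0 with hc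
  refine ⟨U * Matrix.diagonal c * star (U : Matrix n n ℂ), ⟨?_, ?_⟩, ?_, ?_⟩
  · rw [IsIdempotentElem, hmul, Matrix.diagonal_mul_diagonal]
    congr 3
    ext i; simp [hc]
  · rw [isSelfAdjoint_iff, star_mul, star_mul, star_star, mul_assoc]
    congr 2
    rw [Matrix.star_eq_conjTranspose, Matrix.diagonal_conjTranspose]
    congr 1
    ext i; simp only [hc, Pi.star_apply]; split_ifs <;> simp
  · conv_lhs => rw [hspec]
    rw [hmul, Matrix.diagonal_mul_diagonal]
    congr 3
    ext i
    simp only [hc]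
    split_ifs with h
    · have := hts h
      simp only [hs, Finset.mem_filter] at this
      rw [this.2, one_mul]
    · simp
  · rw [htr, Matrix.trace_diagonal, hc]
    simp [htc]

end Matrices

/-! ### Matrix subalgebras, their commutants and short paths -/

namespace UHFSystem

variable (Φ : UHFSystem k B)

/-- The `n`-th matrix subalgebra. -/
def alg (n : ℕ) : StarSubalgebra ℂ B := (Φ.φ n).range

theorem map_mem_alg (n : ℕ) (M) : Φ.φ n M ∈ Φ.alg n := ⟨M, rfl⟩

theorem alg_mono {m n : ℕ} (h : m ≤ n) {x : B} (hx : x ∈ Φ.alg m) : x ∈ Φ.alg n := by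
  induction n, h using Nat.le_induction with
  | base => exact hx
  | succ n _ ih => exact Φ.mono_succ n ih

theorem isClosed_alg (n : ℕ) : IsClosed (Φ.alg n : Set B) :=
  Submodule.closed_of_finiteDimensional (LinearMap.range (Φ.φ n).toAlgHom.toLinearMap)

theorem exists_near (x : B) {ε : ℝ} (hε : 0 < ε) : ∃ l, ∃ y ∈ Φ.alg l, ‖y - x‖ < ε := by
  obtain ⟨y, hy, hxy⟩ := Metric.dense_iff.1 Φ.dense x ε hε
  obtain ⟨l, hl⟩ := Set.mem_iUnion.1 hxy
  exact ⟨l, y, hl, by rwa [Metric.mem_ball, dist_eq_norm] at hy⟩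

theorem pow_pos (Φ : UHFSystem k B) (n : ℕ) : 0 < k ^ n := Nat.pow_pos (by linarith [Φ.two_le])

theorem exists_unitary_near {u : B} (hu : u ∈ unitary B) {ε : ℝ} (hε : 0 < ε) :
    ∃ l0, ∀ l ≥ l0, ∃ w ∈ unitary B, w ∈ Φ.alg l ∧ ‖w - u‖ < ε := by
  obtain ⟨l, y, hy, hyu⟩ := Φ.exists_near u (show 0 < min (1 / 8) (ε / 5) by positivity)
  obtain ⟨w, hw, hwl, hwu⟩ := exists_unitary_mem_near (Φ.isClosed_alg l) hy hu
    (min_le_left _ (ε / 5)) hyu.le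
  refine ⟨l, fun l' hl' => ⟨w, hw, Φ.alg_mono hl' hwl, hwu.trans_lt ?_⟩⟩
  linarith [min_le_right (1 / 8) (ε / 5)]

/-- Matrix units of the `m`-th matrix subalgebra. -/
def unit (m : ℕ) (i j : Fin (k ^ m)) : B := Φ.φ m (Matrix.single i j 1)

theorem unit_mul_unit (m : ℕ) (i j l : Fin (k ^ m)) :
    Φ.unit m i j * Φ.unit m j l = Φ.unit m i l := by
  simp [unit, ← map_mul]

theorem unit_mul_unit_of_ne (m : ℕ) {i j j' l : Fin (k ^ m)} (h : j ≠ j') :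
    Φ.unit m i j * Φ.unit m j' l = 0 := by
  rw [unit, unit, ← map_mul, Matrix.single_mul_single_of_ne (h := h), map_zero]

theorem star_unit (m : ℕ) (i j : Fin (k ^ m)) : star (Φ.unit m i j) = Φ.unit m j i := by
  rw [unit, unit, ← map_star, Matrix.star_eq_conjTranspose, Matrix.conjTranspose_single, star_one]

theorem sum_unit (m : ℕ) : ∑ i, Φ.unit m i i = 1 := by
  simp only [unit, ← map_sum]
  rw [← map_one (Φ.φ m)]
  congr 1
  ext i j
  by_cases h : i = j
  · subst h
    simp [Matrix.sum_apply, Matrix.single_apply]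
  · rw [Matrix.one_apply_ne h, Matrix.sum_apply]
    refine Finset.sum_eq_zero fun l _ => ?_
    rw [Matrix.single_apply, if_neg]
    rintro ⟨rfl, rfl⟩
    exact h rfl

theorem isStarProjection_unit (m : ℕ) (i : Fin (k ^ m)) : IsStarProjection (Φ.unit m i i) :=
  ⟨Φ.unit_mul_unit m i i i, Φ.star_unit m i i⟩

theorem norm_unit_le (m : ℕ) (i j : Fin (k ^ m)) : ‖Φ.unit m i j‖ ≤ 1 := by
  have h := CStarRing.norm_star_mul_self (x := Φ.unit m i j)
  rw [star_unit, unit_mul_unit] at h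
  have := (Φ.isStarProjection_unit m j).norm_le
  nlinarith [norm_nonneg (Φ.unit m i j)]

theorem map_eq_sum (m : ℕ) (M) : Φ.φ m M = ∑ i, ∑ j, M i j • Φ.unit m i j := by
  conv_lhs => rw [Matrix.matrix_eq_sum_single M]
  simp only [map_sum, unit, ← map_smul, Matrix.smul_single, smul_eq_mul, mul_one]

/-- The commutant of the `m`-th matrix subalgebra. -/
def comm (m : ℕ) : StarSubalgebra ℂ B := StarSubalgebra.centralizer ℂ (Φ.alg m : Set B)

theorem mem_comm {m : ℕ} {x : B} : x ∈ Φ.comm m ↔ ∀ a ∈ Φ.alg m, a * x = x * a := by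
  rw [comm, StarSubalgebra.mem_centralizer_iff]
  exact ⟨fun h a ha => (h a ha).1, fun h a ha => ⟨h a ha, h _ (star_mem ha)⟩⟩

theorem mem_comm_of_unit {m : ℕ} {x : B} (h : ∀ i j, Φ.unit m i j * x = x * Φ.unit m i j) :
    x ∈ Φ.comm m := by
  rw [mem_comm]
  rintro _ ⟨M, rfl⟩
  change Φ.φ m M * x = x * Φ.φ m M
  simp only [map_eq_sum, Finset.sum_mul, Finset.mul_sum, smul_mul_assoc, mul_smul_comm, h]

theorem isClosed_comm (m : ℕ) : IsClosed (Φ.comm m : Set B) := by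
  have : (Φ.comm m : Set B) = ⋂ a ∈ Φ.alg m, {x | a * x = x * a} := by
    ext x
    simp only [SetLike.mem_coe, mem_comm, Set.mem_iInter, Set.mem_ofPred_eq]
  rw [this]
  refine isClosed_biInter fun a _ => isClosed_eq ?_ ?_ <;> fun_prop

/-- The index of the first matrix unit. -/
def zero (m : ℕ) : Fin (k ^ m) := ⟨0, Φ.pow_pos m⟩

/-- The expectation of `B` onto the commutant of the `m`-th matrix subalgebra which spreads the
corner of the first minimal projection. -/
noncomputable def spread (m : ℕ) : B →ₗ[ℂ] B :=
  ∑ i, (LinearMap.mulLeft ℂ (Φ.unit m i (Φ.zero m))) ∘ₗ LinearMap.mulRight ℂ (Φ.unit m (Φ.zero m) i)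

theorem spread_apply (m : ℕ) (x : B) :
    Φ.spread m x = ∑ i, Φ.unit m i (Φ.zero m) * x * Φ.unit m (Φ.zero m) i := by
  simp [spread, mul_assoc]

theorem spread_mem_comm (m : ℕ) (x : B) : Φ.spread m x ∈ Φ.comm m := by
  refine Φ.mem_comm_of_unit fun i j => ?_
  rw [spread_apply, Finset.mul_sum, Finset.sum_mul, Finset.sum_eq_single j, Finset.sum_eq_single i]
  · simp only [← mul_assoc, unit_mul_unit]
    simp only [mul_assoc, unit_mul_unit]
  · intro l _ hl
    rw [mul_assoc, unit_mul_unit_of_ne _ _ hl, mul_zero]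
  · simp
  · intro l _ hl
    rw [← mul_assoc, ← mul_assoc, unit_mul_unit_of_ne _ _ hl.symm, zero_mul, zero_mul]
  · simp

theorem unit_mem_alg {m l : ℕ} (h : m ≤ l) (i j : Fin (k ^ m)) : Φ.unit m i j ∈ Φ.alg l :=
  Φ.alg_mono h (Φ.map_mem_alg _ _)

theorem spread_mem_alg {m l : ℕ} (h : m ≤ l) {x : B} (hx : x ∈ Φ.alg l) :
    Φ.spread m x ∈ Φ.alg l := by
  rw [spread_apply]
  exact sum_mem fun i _ => mul_mem (mul_mem (Φ.unit_mem_alg h _ _) hx) (Φ.unit_mem_alg h _ _)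

theorem norm_spread_le (m : ℕ) (x : B) : ‖Φ.spread m x‖ ≤ (k : ℝ) ^ m * ‖x‖ := by
  rw [spread_apply]
  refine (norm_sum_le_of_le (f := fun i => Φ.unit m i (Φ.zero m) * x * Φ.unit m (Φ.zero m) i)
    Finset.univ (n := fun _ => ‖x‖) fun i _ => ?_).trans (by simp)
  have h1 := norm_mul_le (Φ.unit m i (Φ.zero m) * x) (Φ.unit m (Φ.zero m) i)
  have h2 := norm_mul_le (Φ.unit m i (Φ.zero m)) x
  have h3 := Φ.norm_unit_le m i (Φ.zero m)
  have h4 := Φ.norm_unit_le m (Φ.zero m) i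
  have h5 := norm_nonneg x
  have h6 := norm_nonneg (Φ.unit m i (Φ.zero m) * x)
  nlinarith

theorem norm_spread_sub_le (m : ℕ) (x : B) {δ : ℝ}
    (h : ∀ i, ‖x * Φ.unit m (Φ.zero m) i - Φ.unit m (Φ.zero m) i * x‖ ≤ δ) :
    ‖Φ.spread m x - x‖ ≤ (k : ℝ) ^ m * δ := by
  have h1 : Φ.spread m x - x = ∑ i, Φ.unit m i (Φ.zero m) *
      (x * Φ.unit m (Φ.zero m) i - Φ.unit m (Φ.zero m) i * x) := by
    simp only [mul_sub, ← mul_assoc, unit_mul_unit, Finset.sum_sub_distrib]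
    rw [← Finset.sum_mul, sum_unit, one_mul, spread_apply]
  rw [h1]
  refine (norm_sum_le_of_le (f := fun i => Φ.unit m i (Φ.zero m) *
      (x * Φ.unit m (Φ.zero m) i - Φ.unit m (Φ.zero m) i * x))
    Finset.univ (n := fun _ => δ) fun i _ => ?_).trans (by simp)
  refine (norm_mul_le _ _).trans ?_
  exact (mul_le_of_le_one_left (norm_nonneg _) (Φ.norm_unit_le m _ _)).trans (h i)

/-- Approximate `x` in some `alg l` and apply `spread`, which preserves `alg l` for `l ≥ m` and has
values in the commutant. Both the norm of `spread` and its effect on `x` cost a factor `k^m`, which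
the hypothesis divides out in advance. -/
theorem exists_near_mem_comm (m : ℕ) (x : B) {η : ℝ} (hη : 0 < η)
    (h : ∀ i, ‖x * Φ.unit m (Φ.zero m) i - Φ.unit m (Φ.zero m) i * x‖ ≤ η / 2 / (k : ℝ) ^ m) :
    ∃ l ≥ m, ∃ y ∈ Φ.alg l ⊓ Φ.comm m, ‖y - x‖ ≤ η := by
  have hk : (0 : ℝ) < (k : ℝ) ^ m := by exact_mod_cast Φ.pow_pos m
  obtain ⟨l, y, hy, hyx⟩ := Φ.exists_near x (show 0 < η / 2 / (k : ℝ) ^ m by positivity)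
  refine ⟨max l m, le_max_right _ _, Φ.spread m y, ⟨Φ.spread_mem_alg (le_max_right _ _)
    (Φ.alg_mono (le_max_left _ _) hy), Φ.spread_mem_comm m y⟩, ?_⟩
  have h1 := Φ.norm_spread_le m (y - x)
  have h2 := Φ.norm_spread_sub_le m x h
  have h3 : (k : ℝ) ^ m * (η / 2 / (k : ℝ) ^ m) = η / 2 := by field_simp
  rw [h3] at h2
  have h4 : (k : ℝ) ^ m * ‖y - x‖ ≤ η / 2 := by
    rw [← h3]; gcongr
  calc _ = ‖Φ.spread m (y - x) + (Φ.spread m x - x)‖ := by rw [map_sub, sub_add_sub_cancel]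
    _ ≤ _ := (norm_add_le _ _).trans (by linarith)

theorem isClosed_alg_inf_comm (l m : ℕ) : IsClosed ((Φ.alg l ⊓ Φ.comm m : StarSubalgebra ℂ B) : Set B) :=
  (Φ.isClosed_alg l).inter (Φ.isClosed_comm m)

theorem finite_spectrum {l : ℕ} {x : B} (hx : x ∈ Φ.alg l) : (spectrum ℂ x).Finite := by
  obtain ⟨M, rfl⟩ := hx
  obtain ⟨p, hp, h⟩ := (Algebra.IsIntegral.of_finite ℂ (Matrix (Fin (k ^ l)) (Fin (k ^ l)) ℂ)).isIntegral M
  refine (p.rootSet_finite ℂ).subset fun z hz => ?_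
  change Polynomial.aeval M p = 0 at h
  have h1 := spectrum.subset_polynomial_aeval ((Φ.φ l).toAlgHom M) p ⟨z, hz, rfl⟩
  rw [Polynomial.aeval_algHom_apply, h, map_zero, spectrum.zero_eq] at h1
  rw [Polynomial.mem_rootSet]
  exact ⟨hp.ne_zero, by simpa [Polynomial.aeval_def] using h1⟩

/-- A unitary which almost commutes with the `m`-th matrix subalgebra is almost joined to `1` by a
short path of unitaries in its commutant. -/
theorem exists_path (m : ℕ) {η : ℝ} (hη : 0 < η) : ∃ δ > 0, ∀ u ∈ unitary B,
    (∀ i, ‖u * Φ.unit m (Φ.zero m) i - Φ.unit m (Φ.zero m) i * u‖ ≤ δ) →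
    ∃ z : ℝ → B, (∀ t, z t ∈ unitary B) ∧ (∀ t, z t ∈ Φ.comm m) ∧ z 0 = 1 ∧ ‖z 1 - u‖ ≤ η ∧
      ∀ s t, ‖z s - z t‖ ≤ Real.pi * |s - t| := by
  have hk : (0 : ℝ) < (k : ℝ) ^ m := by exact_mod_cast Φ.pow_pos m
  have hη' : 0 < min (1 / 8) (η / 4) := by positivity
  refine ⟨min (1 / 8) (η / 4) / 2 / (k : ℝ) ^ m, by positivity, fun u hu h => ?_⟩
  obtain ⟨l, -, y, hy, hyu⟩ := Φ.exists_near_mem_comm m u hη' h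
  obtain ⟨w, hw, hwS, hwu⟩ := exists_unitary_mem_near (Φ.isClosed_alg_inf_comm l m) hy hu
    (min_le_left _ _) hyu
  obtain ⟨z, hz, hzS, hz0, hz1, hzl⟩ := exists_unitary_path (Φ.isClosed_alg_inf_comm l m) hw hwS
    (Φ.finite_spectrum hwS.1)
  refine ⟨z, hz, fun t => (hzS t).2, hz0, ?_, hzl⟩
  rw [hz1]
  linarith [min_le_right (1 / 8) (η / 4)]

/-- At level `0` the commutation hypothesis of `exists_path` is therefore empty, and every unitary
is almost joined to `1`. -/
theorem unit_zero_eq_one (i : Fin (k ^ 0)) : Φ.unit 0 (Φ.zero 0) i = 1 := by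
  have h : ∀ a b : Fin (k ^ 0), a = b := fun a b => Fin.ext (by
    have ha := a.2; have hb := b.2
    simp only [pow_zero] at ha hb; omega)
  rw [← Φ.sum_unit 0, Finset.sum_eq_single (Φ.zero 0) (fun j _ hj => (hj (h _ _)).elim)
    (fun hn => (hn (Finset.mem_univ _)).elim),
    h i (Φ.zero 0)]

/-! ### Values of the trace on the matrix subalgebras -/

section Trace

variable {T : B →ₗ[ℂ] ℂ}

theorem trace_map (hT : ∀ a b, T (a * b) = T (b * a)) (h1 : T 1 = 1) (l : ℕ) (M) :
    T (Φ.φ l M) = M.trace / (k : ℂ) ^ l := by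
  have hk : ((k : ℂ) ^ l) ≠ 0 := by exact_mod_cast (Φ.pow_pos l).ne'
  have h2 : ∀ i j, i ≠ j → T (Φ.unit l i j) = 0 := fun i j hij => by
    rw [← Φ.unit_mul_unit l i i j, hT, unit_mul_unit_of_ne _ _ hij.symm, map_zero]
  have h3 : ∀ i j, T (Φ.unit l i i) = T (Φ.unit l j j) := fun i j => by
    rw [← Φ.unit_mul_unit l i j i, hT, unit_mul_unit]
  have h4 : T (Φ.unit l (Φ.zero l) (Φ.zero l)) = 1 / (k : ℂ) ^ l := by
    have := congrArg T (Φ.sum_unit l)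
    rw [map_sum, Finset.sum_congr rfl fun i _ => h3 i (Φ.zero l), h1] at this
    simp only [Finset.sum_const, Finset.card_univ, Fintype.card_fin, nsmul_eq_mul, Nat.cast_pow] at this
    field_simp
    rw [mul_comm]; exact this
  rw [map_eq_sum, map_sum, Matrix.trace, Finset.sum_div]
  refine Finset.sum_congr rfl fun i _ => ?_
  rw [map_sum, Finset.sum_eq_single i]
  · rw [map_smul, h3 i (Φ.zero l), h4, smul_eq_mul, mul_one_div, Matrix.diag_apply]
  · intro j _ hj
    rw [map_smul, h2 i j hj.symm, smul_zero]
  · simp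

theorem trace_unique (Φ : UHFSystem k B) {T' : B →ₗ[ℂ] ℂ} (hT : ∀ a b, T (a * b) = T (b * a)) (h1 : T 1 = 1)
    (hT' : ∀ a b, T' (a * b) = T' (b * a)) (h1' : T' 1 = 1) (hc : Continuous T)
    (hc' : Continuous T') : T = T' := by
  have : (T : B → ℂ) = T' := by
    refine Continuous.ext_on Φ.dense hc hc' fun x hx => ?_
    obtain ⟨l, M, rfl⟩ := Set.mem_iUnion.1 hx
    rw [Φ.trace_map hT h1, Φ.trace_map hT' h1']
  exact DFunLike.coe_injective this

theorem exists_subprojection (hT : ∀ a b, T (a * b) = T (b * a)) (h1 : T 1 = 1) {l : ℕ} {e : B}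
    (he : IsStarProjection e) (hel : e ∈ Φ.alg l) {j : ℕ} (hj : (j : ℝ) / (k : ℝ) ^ l ≤ (T e).re) :
    ∃ p ∈ Φ.alg l, IsStarProjection p ∧ p * e = p ∧ T p = j / (k : ℂ) ^ l := by
  have hk : (0 : ℝ) < (k : ℝ) ^ l := by exact_mod_cast Φ.pow_pos l
  obtain ⟨M, rfl⟩ := hel
  change _ ≤ (T (Φ.φ l M)).re at hj
  have hM : M * M = M := Φ.inj l (by rw [map_mul]; exact he.isIdempotentElem.eq)
  have hM' : star M = M := Φ.inj l (by rw [map_star]; exact he.isSelfAdjoint.star_eq)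
  obtain ⟨r, hr⟩ := trace_idempotent_eq_nat hM
  rw [Φ.trace_map hT h1, hr, show (r : ℂ) / (k : ℂ) ^ l = ((r / (k : ℝ) ^ l : ℝ) : ℂ) by push_cast; rfl,
    Complex.ofReal_re, div_le_div_iff_of_pos_right hk] at hj
  obtain ⟨P, hP, hPM, hPt⟩ := exists_projection_le ⟨hM, hM'⟩ hr (by exact_mod_cast hj : j ≤ r)
  refine ⟨Φ.φ l P, ⟨P, rfl⟩, hP.map _, ?_, by rw [Φ.trace_map hT h1, hPt]⟩
  change Φ.φ l P * Φ.φ l M = _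
  rw [← map_mul, hPM]

end Trace

/-! ### Traces of projections over `B` are `k`-adic -/

section TraceK0

/-- Matrices with entries in the `l`-th matrix subalgebra. -/
noncomputable def matrixAlg [PartialOrder B] [StarOrderedRing B] (n l : ℕ) :
    StarSubalgebra ℂ (CStarMatrix (Fin n) (Fin n) B) where
  carrier := {x | ∀ i j, x i j ∈ Φ.alg l}
  mul_mem' := fun {x y} hx hy i j => by
    rw [CStarMatrix.mul_apply]
    exact sum_mem fun s _ => mul_mem (hx i s) (hy s j)
  add_mem' := fun {x y} hx hy i j => add_mem (hx i j) (hy i j)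
  algebraMap_mem' := fun r i j => by
    rw [CStarMatrix.algebraMap_apply]
    split_ifs
    · exact algebraMap_mem _ r
    · exact zero_mem _
  star_mem' := fun {x} hx i j => by
    rw [CStarMatrix.star_apply]
    exact star_mem (hx j i)

theorem isClosed_matrixAlg [PartialOrder B] [StarOrderedRing B] (n l : ℕ) :
    IsClosed (Φ.matrixAlg n l : Set (CStarMatrix (Fin n) (Fin n) B)) := by
  -- The topology of `CStarMatrix` unfolds to the entrywise one.
  have h : ∀ i j, Continuous fun x : CStarMatrix (Fin n) (Fin n) B => x i j := fun i j =>
    (continuous_apply_apply i j : Continuous fun x : Fin n → Fin n → B => x i j)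
  have : (Φ.matrixAlg n l : Set (CStarMatrix (Fin n) (Fin n) B)) =
      ⋂ i, ⋂ j, {x | x i j ∈ (Φ.alg l : Set B)} := by
    ext x
    simp only [Set.mem_iInter]
    rfl
  rw [this]
  exact isClosed_iInter fun i => isClosed_iInter fun j => (Φ.isClosed_alg l).preimage (h i j)

theorem exists_near_matrixAlg [PartialOrder B] [StarOrderedRing B] {n : ℕ}
    (p : CStarMatrix (Fin n) (Fin n) B) {ε : ℝ} (hε : 0 < ε) :
    ∃ l, ∃ a ∈ Φ.matrixAlg n l, ‖a - p‖ < ε := by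
  have hd : Dense (Set.univ.pi fun _ : Fin n => Set.univ.pi fun _ : Fin n =>
      ⋃ l, Set.range (Φ.φ l)) :=
    dense_pi _ fun _ _ => dense_pi _ fun _ _ => Φ.dense
  let S : Set (CStarMatrix (Fin n) (Fin n) B) := {x | ∀ i j, x i j ∈ ⋃ l, Set.range (Φ.φ l)}
  have hd' : Dense S := Dense.mono (X := Fin n → Fin n → B) (s₂ := S)
    (fun x hx i j => (Set.mem_pi.1 (Set.mem_pi.1 hx i (Set.mem_univ _)) j (Set.mem_univ _))) hd
  obtain ⟨a, ha, hap⟩ := Metric.dense_iff.1 hd' p ε hε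
  have h1 : ∀ i j, ∃ l, a i j ∈ Φ.alg l := fun i j =>
    Set.mem_iUnion.1 (hap i j)
  choose l hl using h1
  refine ⟨Finset.univ.sup fun i => Finset.univ.sup fun j => l i j, a, fun i j =>
    Φ.alg_mono ?_ (hl i j), by rwa [Metric.mem_ball, dist_eq_norm] at ha⟩
  exact (Finset.le_sup (f := fun j => l i j) (Finset.mem_univ j)).trans
    (Finset.le_sup (f := fun i => Finset.univ.sup fun j => l i j) (Finset.mem_univ i))

/-- A projection over `B` is close to one with entries in some `alg l`, with the same trace.
Flattening the blocks gives an idempotent complex matrix, whose trace is its rank; normalization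
divides by `k^l`. -/
theorem trace_matrix_projection (Φ : UHFSystem k B) {T : B →ₗ[ℂ] ℂ} (hT : ∀ a b, T (a * b) = T (b * a)) (h1 : T 1 = 1)
    {n : ℕ} {p : Matrix (Fin n) (Fin n) B} (hp : IsStarProjection p) :
    (∑ i, T (p i i)).re ∈ kAdic k := by
  let _ := CStarAlgebra.spectralOrder B
  have := CStarAlgebra.spectralOrderedRing B
  rcases n.eq_zero_or_pos with rfl | hn
  · simp
  have : Nonempty (Fin n) := ⟨⟨0, hn⟩⟩
  let P : CStarMatrix (Fin n) (Fin n) B := CStarMatrix.ofMatrix p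
  have hP : IsStarProjection P := ⟨hp.isIdempotentElem, hp.isSelfAdjoint⟩
  obtain ⟨l, a, ha, hap⟩ := Φ.exists_near_matrixAlg P (show (0 : ℝ) < 1 / 32 by norm_num)
  obtain ⟨q, hq, hqp, hqP⟩ := exists_projection_mem_near (Φ.isClosed_matrixAlg n l) ha hP le_rfl hap.le
  let Tr : CStarMatrix (Fin n) (Fin n) B → ℂ := fun x => ∑ i, T (x i i)
  have hTr : ∀ x y, Tr (x * y) = Tr (y * x) := by
    intro x y
    simp only [Tr, CStarMatrix.mul_apply, map_sum]
    rw [Finset.sum_comm]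
    exact Finset.sum_congr rfl fun i _ => Finset.sum_congr rfl fun j _ => hT _ _
  have key : Tr q = Tr P := map_eq_of_projection_near hTr hqp hP (hqP.trans_lt (by norm_num))
  choose M hM using hq
  have hM' : ∀ i j, Φ.φ l (M i j) = q i j := hM
  have hMM : ∀ i j, ∑ s, M i s * M s j = M i j := fun i j => by
    apply Φ.inj l
    have h2 := hqp.isIdempotentElem.eq
    have h3 := congrFun (congrFun h2 i) j
    rw [CStarMatrix.mul_apply] at h3
    simp only [map_sum, map_mul, hM', h3]
  let R : Matrix (Fin n × Fin (k ^ l)) (Fin n × Fin (k ^ l)) ℂ := fun x y => M x.1 y.1 x.2 y.2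
  have hR : R * R = R := by
    ext x y
    rw [Matrix.mul_apply, Fintype.sum_prod_type]
    have h2 := congrFun (congrFun (hMM x.1 y.1) x.2) y.2
    rw [Matrix.sum_apply] at h2
    simp only [Matrix.mul_apply] at h2
    exact h2
  obtain ⟨r, hr⟩ := trace_idempotent_eq_nat hR
  have h4 : Tr q = r / (k : ℂ) ^ l := by
    rw [← hr, Matrix.trace, Fintype.sum_prod_type, Finset.sum_div]
    refine Finset.sum_congr rfl fun i _ => ?_
    rw [← hM', Φ.trace_map hT h1]
    rfl
  have h5 : (∑ i, T (p i i)) = ((r / (k : ℝ) ^ l : ℝ) : ℂ) := by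
    rw [show (∑ i, T (p i i)) = Tr P from rfl, ← key, h4]; push_cast; rfl
  rw [h5, Complex.ofReal_re]
  have hk : (0 : ℝ) < (k : ℝ) ^ l := by exact_mod_cast Φ.pow_pos l
  exact ⟨l, r, by field_simp; simp⟩

theorem traceK0_le (Φ : UHFSystem k B) {T : B →ₗ[ℂ] ℂ} (hT : ∀ a b, T (a * b) = T (b * a)) (h1 : T 1 = 1) :
    traceK0 T ≤ kAdic k := by
  rw [traceK0, AddSubgroup.closure_le]
  rintro _ ⟨n, p, hp, rfl⟩
  exact Φ.trace_matrix_projection hT h1 hp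

end TraceK0

/-! ### Determinants as exponentials of the trace of the logarithm -/

section Det

theorem isUnit_of_isUnit_map {l : ℕ} {M : Matrix (Fin (k ^ l)) (Fin (k ^ l)) ℂ}
    (h : IsUnit (Φ.φ l M)) : IsUnit M := by
  rw [Matrix.isUnit_iff_isUnit_det, isUnit_iff_ne_zero]
  intro h0
  obtain ⟨v, hv, hMv⟩ := Matrix.exists_mulVec_eq_zero_iff.2 h0
  have h1 : M * Matrix.vecMulVec v (1 : Fin (k ^ l) → ℂ) = 0 := by
    rw [Matrix.mul_vecMulVec, hMv, Matrix.zero_vecMulVec]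
  have h2 : Φ.φ l M * Φ.φ l (Matrix.vecMulVec v 1) = 0 := by rw [← map_mul, h1, map_zero]
  have h3 := (h.mul_right_eq_zero).1 h2
  have h4 : Matrix.vecMulVec v 1 = (0 : Matrix (Fin (k ^ l)) (Fin (k ^ l)) ℂ) :=
    Φ.inj l (by rw [h3, map_zero])
  refine hv (funext fun i => ?_)
  have := congrFun (congrFun h4 i) i
  simpa [Matrix.vecMulVec_apply] using this

/-- Jacobi's formula: factor out the invertible matrix at time `t`, leaving `det (1 + X · Q⁻¹D)`, a
polynomial whose derivative at `0` is a trace. -/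
theorem hasDerivAt_det {n : Type*} [Fintype n] [DecidableEq n] {A D : Matrix n n ℂ} {t : ℝ}
    (h : IsUnit (A + (t : ℂ) • D)) :
    HasDerivAt (fun s : ℝ => (A + (s : ℂ) • D).det)
      ((A + (t : ℂ) • D).det * ((A + (t : ℂ) • D)⁻¹ * D).trace) t := by
  set Q := A + (t : ℂ) • D with hQ
  have hdet : IsUnit Q.det := (Matrix.isUnit_iff_isUnit_det _).1 h
  set p : Polynomial ℂ := (1 + (Polynomial.X : Polynomial ℂ) • (Q⁻¹ * D).map Polynomial.C).det with hp
  have h1 : ∀ s : ℝ, (A + (s : ℂ) • D).det = Q.det * p.eval ((s : ℂ) - t) := by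
    intro s
    have h2 : A + (s : ℂ) • D = Q * (1 + ((s : ℂ) - t) • (Q⁻¹ * D)) := by
      rw [mul_add, mul_one, mul_smul_comm, ← mul_assoc, Matrix.mul_nonsing_inv _ hdet, one_mul, hQ,
        sub_smul]
      abel
    rw [h2, Matrix.det_mul, hp]
    congr 1
    rw [← Polynomial.coe_evalRingHom, RingHom.map_det]
    congr 1
    ext i j
    by_cases hij : i = j
    · subst hij; simp [-Matrix.map_mul]; ring
    · simp [hij, -Matrix.map_mul]; ring
  simp only [h1]
  refine HasDerivAt.const_mul _ ?_
  have h3 : HasDerivAt (fun s : ℝ => (s : ℂ) - t) 1 t := by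
    simpa using ((hasDerivAt_id t).ofReal_comp).sub_const (t : ℂ)
  have h4 := (p.hasDerivAt ((t : ℂ) - t)).comp t h3
  rw [sub_self, hp, Matrix.derivative_det_one_add_X_smul, mul_one] at h4
  exact h4

/-- On the segment from `1` to `M`, the product of `det` with `exp (-k^l trLog)` has zero
derivative. The factor `k^l` converts the normalized trace into the matrix trace. The
single-valuedness of `det` is the source of integrality. -/
theorem det_eq_exp_trLog {T : B →L[ℂ] ℂ} (hT : ∀ a b, T (a * b) = T (b * a)) (h1 : T 1 = 1)
    {l : ℕ} {M : Matrix (Fin (k ^ l)) (Fin (k ^ l)) ℂ} (hM : ‖Φ.φ l M - 1‖ < 1) :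
    M.det = Complex.exp ((k : ℂ) ^ l * trLog T (Φ.φ l M)) := by
  have hk : ((k : ℂ) ^ l) ≠ 0 := by exact_mod_cast (Φ.pow_pos l).ne'
  set Q : ℝ → Matrix (Fin (k ^ l)) (Fin (k ^ l)) ℂ := fun t => 1 + (t : ℂ) • (M - 1) with hQ
  have hφQ : ∀ t, Φ.φ l (Q t) = 1 + t • (Φ.φ l M - 1) := fun t => by
    simp only [hQ, map_add, map_one, map_smul, map_sub]
    rfl
  have hnear : ∀ t ∈ Set.Icc (0 : ℝ) 1, ‖Φ.φ l (Q t) - 1‖ < 1 := fun t ht => by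
    rw [hφQ]
    exact (norm_lineMap_one_le _ ht).trans_lt hM
  have key := eq_of_hasDerivWithinAt_eq
    (f := fun t => (Q t).det * Complex.exp (-((k : ℂ) ^ l * trLog T (Φ.φ l (Q t)))))
    (g := fun _ => 0) (f' := fun _ => 0) (fun t ht => ?_) (fun t _ => hasDerivWithinAt_const _ _ _)
  · have hQ1 : Q 1 = M := by simp [hQ]
    have hQ0 : Q 0 = 1 := by simp [hQ]
    simp only [hQ1, hQ0, map_one, trLog_one, Matrix.det_one] at key
    rw [Complex.exp_neg] at key
    have h2 := Complex.exp_ne_zero ((k : ℂ) ^ l * trLog T (Φ.φ l M))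
    field_simp at key
    rw [mul_zero, neg_zero, Complex.exp_zero] at key
    linear_combination key
  · have hu : IsUnit (Q t) := Φ.isUnit_of_isUnit_map (isUnit_of_norm_sub_one_lt (hnear t ht))
    have hdet : IsUnit (Q t).det := (Matrix.isUnit_iff_isUnit_det _).1 hu
    have hinv : Ring.inverse (Φ.φ l (Q t)) = Φ.φ l (Q t)⁻¹ := by
      have h2 : Φ.φ l (Q t) * Φ.φ l (Q t)⁻¹ = 1 := by
        rw [← map_mul, Matrix.mul_nonsing_inv _ hdet, map_one]
      have h3 : Φ.φ l (Q t)⁻¹ * Φ.φ l (Q t) = 1 := by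
        rw [← map_mul, Matrix.nonsing_inv_mul _ hdet, map_one]
      exact Ring.inverse_unit ⟨_, _, h2, h3⟩
    have hd1 : HasDerivAt (fun t => (Q t).det) _ t := hasDerivAt_det (A := 1) (D := M - 1) hu
    have hd2 : HasDerivWithinAt (fun t => Φ.φ l (Q t)) (Φ.φ l (M - 1)) (Set.Icc 0 1) t := by
      simp only [hφQ, map_sub, map_one]
      exact hasDerivWithinAt_lineMap_one _ _ _
    have hd3 := trLog_comp hT hd2 (hnear t ht)
    have h4 : T (Ring.inverse (Φ.φ l (Q t)) * Φ.φ l (M - 1)) =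
        ((Q t)⁻¹ * (M - 1)).trace / (k : ℂ) ^ l := by
      rw [hinv, ← map_mul]
      exact Φ.trace_map (T := (T : B →ₗ[ℂ] ℂ)) hT h1 l _
    rw [h4] at hd3
    refine (hd1.hasDerivWithinAt.mul ((hd3.const_mul ((k : ℂ) ^ l)).neg.cexp)).congr_deriv ?_
    simp only [hQ]
    field_simp
    ring

end Det

end UHFSystem

/-! ### Continuity and invariance of the tracial state -/

section TraceFunctional

/-- The properties of a bounded tracial state which are used below. -/
structure IsTraceFunctional (T : B →L[ℂ] ℂ) : Prop where
  comm : ∀ a b, T (a * b) = T (b * a)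
  map_one : T 1 = 1
  map_star : ∀ a, T (star a) = star (T a)

theorem IsTracialState.exists_traceFunctional {τ : B →ₗ[ℂ] ℂ} (hτ : IsTracialState τ) :
    ∃ T : B →L[ℂ] ℂ, IsTraceFunctional T ∧ (T : B →ₗ[ℂ] ℂ) = τ := by
  let _ := CStarAlgebra.spectralOrder B
  have := CStarAlgebra.spectralOrderedRing B
  have hpos : ∀ x : B, 0 ≤ x → 0 ≤ τ x := fun x hx => by
    obtain ⟨b, rfl⟩ := CStarAlgebra.nonneg_iff_eq_star_mul_self.1 hx
    exact hτ.nonneg b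
  obtain ⟨C, hC⟩ := (PositiveLinearMap.mk₀ τ hpos).exists_norm_apply_le
  have hsa : ∀ h : B, IsSelfAdjoint h → star (τ h) = τ h := fun h hh => by
    have h1 := (Complex.nonneg_iff.1 (hτ.nonneg (h + 1))).2
    have h2 := (Complex.nonneg_iff.1 (hτ.nonneg h)).2
    rw [star_add, star_one, hh.star_eq, add_mul, mul_add, mul_one, one_mul, map_add, map_add, map_add,
      hτ.map_one] at h1
    rw [hh.star_eq] at h2
    simp only [Complex.add_im, Complex.one_im] at h1
    refine Complex.ext (by simp) ?_
    rw [← starRingEnd_apply, Complex.conj_im]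
    linarith
  refine ⟨τ.mkContinuous C hC, ⟨hτ.map_mul_comm, hτ.map_one, fun a => ?_⟩, rfl⟩
  change τ (star a) = star (τ a)
  have h1 := realPart_add_I_smul_imaginaryPart a
  have h2 := hsa _ (realPart a).2
  have h3 := hsa _ (imaginaryPart a).2
  rw [← h1]
  simp only [star_add, star_smul, map_add, map_smul, smul_eq_mul, star_mul', h2, h3,
    (realPart a).2.star_eq, (imaginaryPart a).2.star_eq]

/-- `T ∘ β` is again a continuous normalized trace, and such a trace is determined on the dense
union of matrix algebras. -/
theorem IsTraceFunctional.map_automorphism {T : B →L[ℂ] ℂ} (hT : IsTraceFunctional T)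
    (Φ : UHFSystem k B) (β : B ≃⋆ₐ[ℂ] B) (a : B) : T (β a) = T a := by
  have hβ : Continuous β := (NonUnitalStarAlgHom.isometry β β.injective).continuous
  let T' : B →ₗ[ℂ] ℂ := (T : B →ₗ[ℂ] ℂ) ∘ₗ (β : B →ₗ[ℂ] B)
  have := Φ.trace_unique (T := T') (T' := (T : B →ₗ[ℂ] ℂ)) (fun a b => by simp [T', hT.comm])
    (by simp [T', hT.map_one]) hT.comm hT.map_one (T.continuous.comp hβ) T.continuous
  exact LinearMap.congr_fun this a

theorem trLog_map_automorphism {T : B →L[ℂ] ℂ} (β : B ≃⋆ₐ[ℂ] B) (hβ : ∀ a, T (β a) = T a) (a : B) :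
    trLog T (β a) = trLog T a := by
  have : ∀ n : ℕ, T ((1 - β a) ^ n) = T ((1 - a) ^ n) := fun n => by
    rw [← hβ ((1 - a) ^ n), map_pow β, map_sub β, map_one β]
  simp [trLog, this]

end TraceFunctional

/-! ### Discrete determinants along chains of small steps -/

section Increments

variable {T : B →L[ℂ] ℂ}

theorem norm_star_mul_sub_one {x : B} (hx : x ∈ unitary B) (y : B) :
    ‖star x * y - 1‖ = ‖y - x‖ := by
  rw [← Unitary.star_mul_self_of_mem hx, ← mul_sub, norm_unitary_mul (Unitary.star_mem hx)]

theorem norm_mul_star_sub_one {x : B} (hx : x ∈ unitary B) (y : B) :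
    ‖y * star x - 1‖ = ‖y - x‖ := by
  rw [← Unitary.mul_star_self_of_mem hx, ← sub_mul, norm_mul_unitary (Unitary.star_mem hx)]

theorem trLog_conj_unitary (hT : IsTraceFunctional T) {u : B} (hu : u ∈ unitary B) (a : B) :
    trLog T (u * a * star u) = trLog T a :=
  trLog_units_conj T hT.comm (Unitary.toUnits ⟨u, hu⟩) a

theorem trLog_star_unitary (hT : IsTraceFunctional T) {a : B} (ha : a ∈ unitary B)
    (h : ‖a - 1‖ ≤ 2 / 5) : trLog T (star a) = -trLog T a := by
  have h1 := trLog_mul hT.comm (a := star a) (b := a)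
    (by rwa [← star_one B, ← star_sub, norm_star]) h
  rw [Unitary.star_mul_self_of_mem ha, trLog_one] at h1
  linear_combination -h1

theorem trLog_star (hT : IsTraceFunctional T) (a : B) : trLog T (star a) = star (trLog T a) := by
  rw [trLog, trLog, star_neg, ← starRingEnd_apply, Complex.conj_tsum]
  congr 1
  refine tsum_congr fun n => ?_
  have : (1 - star a) ^ (n + 1) = star ((1 - a) ^ (n + 1)) := by rw [star_pow, star_sub, star_one]
  rw [this, hT.map_star]
  simp

theorem trLog_re_eq_zero (hT : IsTraceFunctional T) {a : B} (ha : a ∈ unitary B)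
    (h : ‖a - 1‖ ≤ 2 / 5) : (trLog T a).re = 0 := by
  have h1 := trLog_star hT a
  rw [trLog_star_unitary hT ha h] at h1
  have := congrArg Complex.re h1
  rw [← starRingEnd_apply, Complex.conj_re, Complex.neg_re] at this
  linarith

theorem trLog_increment_add (hT : IsTraceFunctional T) {x y z : B} (hx : x ∈ unitary B)
    (hy : y ∈ unitary B) (hxy : ‖y - x‖ ≤ 2 / 5) (hyz : ‖z - y‖ ≤ 2 / 5) :
    trLog T (star x * y) + trLog T (star y * z) = trLog T (star x * z) := by
  rw [← trLog_mul hT.comm (by rwa [norm_star_mul_sub_one hx]) (by rwa [norm_star_mul_sub_one hy]),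
    mul_assoc, ← mul_assoc y, Unitary.mul_star_self_of_mem hy, one_mul]

/-- `Reach T x c`: the unitary `x` is joined to `1` by a chain of small steps along which the
logarithms of the increments have total trace `c`. -/
inductive Reach (T : B →L[ℂ] ℂ) : B → ℂ → Prop
  | one : Reach T 1 0
  | step {x y : B} {c : ℂ} : Reach T x c → y ∈ unitary B → ‖y - x‖ ≤ 1 / 20 →
      Reach T y (c + trLog T (star x * y))

namespace Reach

theorem mem {x : B} {c : ℂ} (h : Reach T x c) : x ∈ unitary B := by
  cases h with
  | one => exact one_mem _
  | step _ h _ => exact h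

theorem re_eq_zero (hT : IsTraceFunctional T) {x : B} {c : ℂ} (h : Reach T x c) : c.re = 0 := by
  induction h with
  | one => rfl
  | step h hy hxy ih =>
    rw [Complex.add_re, ih, trLog_re_eq_zero hT (mul_mem (Unitary.star_mem h.mem) hy), add_zero]
    rw [norm_star_mul_sub_one h.mem]
    exact hxy.trans (by norm_num)

/-- Left translation of a chain by a unitary does not change its increments `star x * y`, so the
translated chain of `y` can be appended to the chain of `x`. -/
theorem mul {x y : B} {c d : ℂ} (hx : Reach T x c) (hy : Reach T y d) : Reach T (x * y) (c + d) := by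
  induction hy with
  | one => simpa using hx
  | @step y z d h hz hyz ih =>
    have h1 := ih.step (mul_mem hx.mem hz) (by rwa [← mul_sub, norm_unitary_mul hx.mem])
    rwa [star_mul, mul_assoc, ← mul_assoc _ x, Unitary.star_mul_self_of_mem hx.mem, one_mul,
      add_assoc] at h1

theorem map {x : B} {c : ℂ} (h : Reach T x c) (β : B ≃⋆ₐ[ℂ] B) (hβ : ∀ a, T (β a) = T a) :
    Reach T (β x) c := by
  induction h with
  | one => simpa using Reach.one
  | @step x y c h hy hxy ih =>
    have h1 := ih.step (Unitary.map_mem β hy) (by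
      rwa [← map_sub, NonUnitalStarAlgHom.norm_map β β.injective])
    rwa [← map_star, ← map_mul, trLog_map_automorphism β hβ] at h1

theorem adjoint (hT : IsTraceFunctional T) {x : B} {c : ℂ} (h : Reach T x c) :
    Reach T (star x) (-c) := by
  induction h with
  | one => simpa using Reach.one
  | @step x y c h hy hxy ih =>
    have hx := h.mem
    have h1 := ih.step (Unitary.star_mem hy) (by rwa [← star_sub, norm_star])
    have h2 : trLog T (Star.star (Star.star x) * Star.star y) = -trLog T (Star.star x * y) := by
      have h3 := trLog_conj_unitary hT hx (Star.star y * x)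
      rw [← mul_assoc, mul_assoc, Unitary.mul_star_self_of_mem hx, mul_one] at h3
      rw [star_star, h3, ← trLog_star_unitary hT (mul_mem (Unitary.star_mem hx) hy)
        (by rw [norm_star_mul_sub_one hx]; exact hxy.trans (by norm_num)), star_mul, star_star]
    rw [h2] at h1
    rwa [neg_add]

/-- The total `c` is visible in the determinant of any matrix close to `x`. The assertion covers all
large `l` because the inductive step compares approximants of `x` and `y` inside one matrix algebra.
-/
theorem det_eq (hT : IsTraceFunctional T) (Φ : UHFSystem k B) {x : B} {c : ℂ} (h : Reach T x c) :
    ∃ l0, ∀ l ≥ l0, ∀ W, Φ.φ l W ∈ unitary B → ‖Φ.φ l W - x‖ ≤ 1 / 20 →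
      W.det = Complex.exp ((k : ℂ) ^ l * (c + trLog T (Star.star x * Φ.φ l W))) := by
  induction h with
  | one =>
    refine ⟨0, fun l _ W _ hW1 => ?_⟩
    rw [star_one, one_mul, zero_add]
    exact Φ.det_eq_exp_trLog hT.comm hT.map_one (hW1.trans_lt (by norm_num))
  | @step x y c h hy hxy ih =>
    obtain ⟨l1, hl1⟩ := ih
    obtain ⟨l2, hl2⟩ := Φ.exists_unitary_near h.mem (show (0 : ℝ) < 1 / 20 by norm_num)
    refine ⟨max l1 l2, fun l hl W hW hWy => ?_⟩
    obtain ⟨X, hX, ⟨M, rfl⟩, hXx⟩ := hl2 l (le_of_max_le_right hl)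
    change Φ.φ l M ∈ unitary B at hX
    change ‖Φ.φ l M - x‖ < 1 / 20 at hXx
    have h1 := hl1 l (le_of_max_le_left hl) M hX hXx.le
    have hWx : ‖Φ.φ l W - x‖ ≤ 2 / 20 := by
      calc _ = ‖(Φ.φ l W - y) + (y - x)‖ := by rw [sub_add_sub_cancel]
        _ ≤ _ := (norm_add_le _ _).trans (by linarith)
    have hWM : ‖Φ.φ l W - Φ.φ l M‖ ≤ 3 / 20 := by
      calc _ = ‖(Φ.φ l W - x) - (Φ.φ l M - x)‖ := by rw [sub_sub_sub_cancel_right]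
        _ ≤ _ := (norm_sub_le _ _).trans (by linarith)
    have h2 : (Star.star M * W).det =
        Complex.exp ((k : ℂ) ^ l * trLog T (Star.star (Φ.φ l M) * Φ.φ l W)) := by
      have h3 : Φ.φ l (Star.star M * W) = Star.star (Φ.φ l M) * Φ.φ l W := by rw [map_mul, map_star]
      rw [← h3]
      refine Φ.det_eq_exp_trLog hT.comm hT.map_one ?_
      rw [h3, norm_star_mul_sub_one hX]
      exact hWM.trans_lt (by norm_num)
    have h4 : M * Star.star M = 1 := Φ.inj l (by
      rw [map_mul, map_star, map_one]; exact Unitary.mul_star_self_of_mem hX)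
    have h5 : W = M * (Star.star M * W) := by rw [← mul_assoc, h4, one_mul]
    -- The increment from `x` to the matrix `W` is computed twice, through the matrix near `x` and
    -- through `y`. The step size `1/20` keeps every distance at most `3/20`, well below `2/5`.
    have h6 := trLog_increment_add hT h.mem hX (hXx.le.trans (by norm_num)) (hWM.trans (by norm_num))
    have h7 := trLog_increment_add hT h.mem hy (hxy.trans (by norm_num)) (hWy.trans (by norm_num))
    rw [h5, Matrix.det_mul, h1, h2, ← h5, ← Complex.exp_add, add_assoc, h7, ← h6]
    congr 1; ring

/-- For a closed chain the identity matrix is an admissible approximant, so `exp (k^l c) = 1`. -/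
theorem of_one (hT : IsTraceFunctional T) (Φ : UHFSystem k B) {c : ℂ} (h : Reach T 1 c) :
    ∃ r ∈ kAdic k, c = 2 * Real.pi * Complex.I * r := by
  obtain ⟨l, hl⟩ := h.det_eq hT Φ
  have h1 := hl l le_rfl 1 (by rw [map_one]; exact one_mem _) (by rw [map_one]; simp)
  rw [Matrix.det_one, map_one, star_one, one_mul, trLog_one, add_zero] at h1
  obtain ⟨z, hz⟩ := Complex.exp_eq_one_iff.1 h1.symm
  have hk : ((k : ℝ) ^ l) ≠ 0 := by exact_mod_cast (Φ.pow_pos l).ne'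
  have hk' : ((k : ℂ) ^ l) ≠ 0 := by exact_mod_cast (Φ.pow_pos l).ne'
  refine ⟨z / (k : ℝ) ^ l, ⟨l, z, by field_simp⟩, ?_⟩
  push_cast
  field_simp
  linear_combination hz

theorem of_path {ζ : ℝ → B} (hζ : ∀ t, ζ t ∈ unitary B) (h0 : ζ 0 = 1) {L : ℝ}
    (hL : ∀ s t, ‖ζ s - ζ t‖ ≤ L * |s - t|) : ∃ c, Reach T (ζ 1) c := by
  obtain ⟨n, hn⟩ := exists_nat_gt (20 * L)
  have hL0 : 0 ≤ L := by
    have := (norm_nonneg _).trans (hL 0 1)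
    simpa using this
  have hn0 : (0 : ℝ) < n := by linarith
  have h1 : ∀ j : ℕ, ∃ c, Reach T (ζ (j / n)) c := by
    intro j
    induction j with
    | zero => exact ⟨0, by simpa [h0] using Reach.one⟩
    | succ j ih =>
      obtain ⟨c, hc⟩ := ih
      refine ⟨_, hc.step (hζ _) ((hL _ _).trans ?_)⟩
      have : (((j + 1 : ℕ) : ℝ) / n - j / n) = 1 / n := by push_cast; ring
      rw [this, abs_of_pos (by positivity)]
      rw [mul_one_div, div_le_iff₀ hn0]; linarith
  obtain ⟨c, hc⟩ := h1 n
  rw [div_self hn0.ne'] at hc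
  exact ⟨c, hc⟩

theorem exists_of_unitary (Φ : UHFSystem k B) {v : B} (hv : v ∈ unitary B) : ∃ c, Reach T v c := by
  obtain ⟨l, hl⟩ := Φ.exists_unitary_near hv (show (0 : ℝ) < 1 / 20 by norm_num)
  obtain ⟨w, hw, hwl, hwv⟩ := hl l le_rfl
  obtain ⟨z, hz, -, hz0, hz1, hzL⟩ := exists_unitary_path (Φ.isClosed_alg l) hw hwl
    (Φ.finite_spectrum hwl)
  obtain ⟨c, hc⟩ := of_path (T := T) hz hz0 hzL
  rw [hz1] at hc
  exact ⟨_, hc.step hv (by rw [norm_sub_rev]; exact hwv.le)⟩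

end Reach

end Increments

/-! ### From the integral determinant to chains -/

section Path

variable {T : B →L[ℂ] ℂ}

theorem hasDerivAt_of_contDiffOn {ξ : ℝ → B} {a b : ℝ} (h : ContDiffOn ℝ 1 ξ (Set.Icc a b)) {r : ℝ}
    (hr : r ∈ Set.Ioo a b) : HasDerivAt ξ (deriv ξ r) r :=
  ((h.differentiableOn (by norm_num) r ⟨hr.1.le, hr.2.le⟩).differentiableAt
    (Icc_mem_nhds hr.1 hr.2)).hasDerivAt

theorem intervalIntegrable_of_contDiffOn {ξ : ℝ → B} {a b : ℝ} (hab : a < b)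
    (h : ContDiffOn ℝ 1 ξ (Set.Icc a b)) :
    IntervalIntegrable (fun t => T (deriv ξ t * star (ξ t))) MeasureTheory.volume a b := by
  have h1 : IntervalIntegrable (fun t => T (derivWithin ξ (Set.Icc a b) t * star (ξ t)))
      MeasureTheory.volume a b := by
    refine ContinuousOn.intervalIntegrable ?_
    rw [Set.uIcc_of_le hab.le]
    exact T.continuous.comp_continuousOn
      ((h.continuousOn_derivWithin (uniqueDiffOn_Icc hab) le_rfl).mul h.continuousOn.star)
  refine h1.congr_uIoo fun t ht => ?_
  rw [Set.uIoo_of_le hab.le] at ht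
  simp only
  rw [derivWithin_of_mem_nhds (Icc_mem_nhds ht.1 ht.2)]

/-- The derivative of `trLog (ξ(s)* ξ(r))` in `r` is `T (ξ(r)* ξ(s) ξ(s)* ξ'(r))`, which equals the
integrand by traciality. -/
theorem trLog_increment_eq_integral (hT : IsTraceFunctional T) {ξ : ℝ → B} {a b s t : ℝ} (hab : a < b)
    (h : ContDiffOn ℝ 1 ξ (Set.Icc a b)) (hu : ∀ r ∈ Set.Icc a b, ξ r ∈ unitary B) (has : a ≤ s)
    (hst : s ≤ t) (htb : t ≤ b) (hnear : ∀ r ∈ Set.Icc s t, ‖ξ r - ξ s‖ < 1) :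
    ∫ r in s..t, T (deriv ξ r * star (ξ r)) = trLog T (star (ξ s) * ξ t) := by
  have hs : ξ s ∈ unitary B := hu s ⟨has, hst.trans htb⟩
  have hsub : Set.Icc s t ⊆ Set.Icc a b := Set.Icc_subset_Icc has htb
  have hnear' : ∀ r ∈ Set.Icc s t, ‖star (ξ s) * ξ r - 1‖ < 1 := fun r hr => by
    rw [norm_star_mul_sub_one hs]; exact hnear r hr
  have key := intervalIntegral.integral_eq_sub_of_hasDerivAt_of_le hst
    (f := fun r => trLog T (star (ξ s) * ξ r)) (f' := fun r => T (deriv ξ r * star (ξ r)))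
    (fun r hr => ?_) (fun r hr => ?_)
    ((intervalIntegrable_of_contDiffOn hab h).mono_set (by
      rw [Set.uIcc_of_le hst, Set.uIcc_of_le hab.le]; exact hsub))
  · rw [key, Unitary.star_mul_self_of_mem hs, trLog_one, sub_zero]
  · exact ((hasFDerivAt_trLog hT.comm (hnear' r hr)).continuousAt).comp_continuousWithinAt
      (f := fun r => star (ξ s) * ξ r)
      (continuousWithinAt_const.mul ((h.continuousOn.mono hsub) r hr))
  · have hr' : r ∈ Set.Icc s t := ⟨hr.1.le, hr.2.le⟩
    have h1 := hasDerivAt_of_contDiffOn h ⟨has.trans_lt hr.1, hr.2.trans_le htb⟩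
    have h2 := trLog_comp (s := Set.univ) hT.comm (h1.const_mul (star (ξ s))).hasDerivWithinAt
      (hnear' r hr')
    rw [hasDerivWithinAt_univ] at h2
    refine h2.congr_deriv ?_
    have hur := hu r (hsub hr')
    have h3 : Ring.inverse (star (ξ s) * ξ r) = star (ξ r) * ξ s := by
      have := Ring.inverse_unit (Unitary.toUnits ⟨star (ξ s) * ξ r, mul_mem (Unitary.star_mem hs) hur⟩)
      refine this.trans ?_
      change star (star (ξ s) * ξ r) = _
      rw [star_mul, star_star]
    rw [h3, hT.comm (deriv ξ r), mul_assoc, ← mul_assoc (ξ s), Unitary.mul_star_self_of_mem hs, one_mul]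

theorem Reach.of_contDiffOn (hT : IsTraceFunctional T) {ξ : ℝ → B} {a b : ℝ} (hab : a < b)
    (h : ContDiffOn ℝ 1 ξ (Set.Icc a b)) (hu : ∀ r ∈ Set.Icc a b, ξ r ∈ unitary B) {c : ℂ}
    (hc : Reach T (ξ a) c) :
    Reach T (ξ b) (c + ∫ r in a..b, T (deriv ξ r * star (ξ r))) := by
  have huc := isCompact_Icc.uniformContinuousOn_of_continuous h.continuousOn
  obtain ⟨δ, hδ, hδ'⟩ := Metric.uniformContinuousOn_iff.1 huc (1 / 20) (by norm_num)
  obtain ⟨n, hn⟩ := exists_nat_gt ((b - a) / δ)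
  have hn0 : (0 : ℝ) < n := lt_trans (by have := sub_pos.2 hab; positivity) hn
  have hstep : (b - a) / n < δ := by rwa [div_lt_iff₀ hn0, mul_comm, ← div_lt_iff₀ hδ]
  have hstep0 : 0 < (b - a) / n := div_pos (sub_pos.2 hab) hn0
  set p : ℕ → ℝ := fun j => a + j * ((b - a) / n) with hp
  have hpn : p n = b := by simp only [hp]; field_simp; ring
  have hpmono : ∀ i j : ℕ, i ≤ j → p i ≤ p j := fun i j hij => by
    simp only [hp]
    have : (i : ℝ) ≤ j := by exact_mod_cast hij
    gcongr
  have hp0 : p 0 = a := by simp [hp]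
  have hint := intervalIntegrable_of_contDiffOn (T := T) hab h
  have key : ∀ j ≤ n, Reach T (ξ (p j)) (c + ∫ r in a..p j, T (deriv ξ r * star (ξ r))) := by
    intro j
    induction j with
    | zero => intro _; simpa [hp0] using hc
    | succ j ih =>
      intro hj
      have h1 := ih (by omega)
      have hpa : a ≤ p j := hp0 ▸ hpmono 0 j (Nat.zero_le _)
      have hpb : p (j + 1) ≤ b := hpn ▸ hpmono _ _ hj
      have hpp : p j ≤ p (j + 1) := hpmono _ _ (Nat.le_succ _)
      have hdist : p (j + 1) - p j < δ := by
        have : p (j + 1) - p j = (b - a) / n := by simp only [hp]; push_cast; ring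
        rwa [this]
      have hclose : ∀ r ∈ Set.Icc (p j) (p (j + 1)), ‖ξ r - ξ (p j)‖ < 1 / 20 := fun r hr => by
        rw [← dist_eq_norm]
        refine hδ' r ⟨hpa.trans hr.1, hr.2.trans hpb⟩ _ ⟨hpa, hpp.trans hpb⟩ ?_
        rw [Real.dist_eq, abs_of_nonneg (by linarith [hr.1])]
        linarith [hr.2]
      have h2 := h1.step (hu (p (j + 1)) ⟨hpa.trans hpp, hpb⟩) (hclose _ ⟨hpp, le_rfl⟩).le
      rw [← trLog_increment_eq_integral hT hab h hu hpa hpp hpb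
        (fun r hr => (hclose r hr).trans (by norm_num)), add_assoc,
        intervalIntegral.integral_add_adjacent_intervals] at h2
      · exact h2
      · exact hint.mono_set (by
          rw [Set.uIcc_of_le hpa, Set.uIcc_of_le hab.le]
          exact Set.Icc_subset_Icc le_rfl (hpp.trans hpb))
      · exact hint.mono_set (by
          rw [Set.uIcc_of_le hpp, Set.uIcc_of_le hab.le]
          exact Set.Icc_subset_Icc hpa hpb)
  have := key n le_rfl
  rwa [hpn] at this

/-- Vanishing of the class places `pathDet` in `ℤ[1/k]`. The total along the chain is purely
imaginary, so the real part taken in `pathDet` determines the whole integral. -/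
theorem Reach.of_hasDeterminant (hT : IsTraceFunctional T) (Φ : UHFSystem k B) {u : unitary B}
    (hu : HasDeterminant (T : B →ₗ[ℂ] ℂ) u 0) :
    ∃ r ∈ kAdic k, Reach T (u : B) (2 * Real.pi * Complex.I * r) := by
  obtain ⟨ξ, ⟨hξu, N, s, hs0, hsN, hs⟩, h0, h1, hd⟩ := hu
  have hr : pathDet (T : B →ₗ[ℂ] ℂ) ξ ∈ kAdic k := by
    refine Φ.traceK0_le hT.comm hT.map_one ?_
    exact (QuotientAddGroup.eq_zero_iff _).1 hd.symm
  have hmono : ∀ i j, i ≤ j → j ≤ N → s i ≤ s j := by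
    intro i j hij
    induction j, hij using Nat.le_induction with
    | base => intro _; exact le_rfl
    | succ j _ ih => intro hj; exact (ih (by omega)).trans (hs j (by omega)).1.le
  have key : ∀ j ≤ N, IntervalIntegrable (fun t => T (deriv ξ t * star (ξ t)))
      MeasureTheory.volume 0 (s j) ∧
      Reach T (ξ (s j)) (∫ t in (0 : ℝ)..s j, T (deriv ξ t * star (ξ t))) := by
    intro j
    induction j with
    | zero => intro _; rw [hs0, h0]; simpa using Reach.one
    | succ j ih =>
      intro hj
      obtain ⟨hint, hreach⟩ := ih (by omega)
      obtain ⟨hlt, hC⟩ := hs j (by omega)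
      have hint' := intervalIntegrable_of_contDiffOn (T := T) hlt hC
      refine ⟨hint.trans hint', ?_⟩
      rw [← intervalIntegral.integral_add_adjacent_intervals hint hint']
      refine hreach.of_contDiffOn hT hlt hC fun r hr => hξu r ⟨?_, ?_⟩
      · exact (hs0 ▸ hmono 0 j (Nat.zero_le _) (by omega)).trans hr.1
      · exact hr.2.trans (hsN ▸ hmono (j + 1) N hj le_rfl)
  have h2 := (key N le_rfl).2
  rw [hsN, h1] at h2
  refine ⟨_, hr, ?_⟩
  convert h2 using 1
  set c := ∫ t in (0 : ℝ)..1, T (deriv ξ t * star (ξ t)) with hc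
  have hre := h2.re_eq_zero hT
  have hpd : pathDet (T : B →ₗ[ℂ] ℂ) ξ = ((2 * Real.pi * Complex.I)⁻¹ * c).re := rfl
  have hc' : c = c.im * Complex.I := by
    apply Complex.ext <;> simp [hre]
  have h3 : (2 * Real.pi * Complex.I)⁻¹ * c = ((c.im / (2 * Real.pi) : ℝ) : ℂ) := by
    have := Complex.I_ne_zero
    have hpi : (Real.pi : ℂ) ≠ 0 := by exact_mod_cast Real.pi_ne_zero
    conv_lhs => rw [hc']
    push_cast
    field_simp
  rw [hpd, h3, Complex.ofReal_re]
  conv_rhs => rw [hc']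
  have hpi : (Real.pi : ℂ) ≠ 0 := by exact_mod_cast Real.pi_ne_zero
  push_cast
  field_simp

end Path

/-! ### Iterates of the automorphism -/

section Iterate

/-- The iterates of an automorphism. -/
def iter (β : B ≃⋆ₐ[ℂ] B) : ℕ → B ≃⋆ₐ[ℂ] B
  | 0 => StarAlgEquiv.refl ℂ B
  | n + 1 => (iter β n).trans β

variable (β : B ≃⋆ₐ[ℂ] B)

@[simp] theorem iter_zero (x : B) : iter β 0 x = x := rfl

theorem iter_succ (n : ℕ) (x : B) : iter β (n + 1) x = β (iter β n x) := rfl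

theorem iter_add (m n : ℕ) (x : B) : iter β (m + n) x = iter β m (iter β n x) := by
  induction m with
  | zero => simp
  | succ m ih => rw [Nat.succ_add, iter_succ, ih, iter_succ]

theorem norm_map_aut (γ : B ≃⋆ₐ[ℂ] B) (x : B) : ‖γ x‖ = ‖x‖ :=
  NonUnitalStarAlgHom.norm_map γ γ.injective x

theorem trace_iter {T : B →L[ℂ] ℂ} (hβ : ∀ a, T (β a) = T a) (n : ℕ) (a : B) :
    T (iter β n a) = T a := by
  induction n with
  | zero => rfl
  | succ n ih => rw [iter_succ, hβ, ih]

theorem map_expI (γ : B ≃⋆ₐ[ℂ] B) (a : B) (t : ℝ) : γ (expI a t) = expI (γ a) t := by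
  have hγ : Continuous γ := (NonUnitalStarAlgHom.isometry γ γ.injective).continuous
  have : γ (t • (Complex.I • a)) = t • (Complex.I • γ a) := by
    rw [← map_smul γ Complex.I a]
    exact map_smul γ (t : ℂ) (Complex.I • a)
  let _ : NormedAlgebra ℚ B := .restrictScalars ℚ ℂ B
  rw [expI, expI, ← this]
  exact NormedSpace.map_exp γ hγ _

end Iterate

/-! ### A unitary built from an almost orthogonal orbit of a projection -/

section Correction

variable {T : B →L[ℂ] ℂ}

theorem norm_commutator_sum_le {n : ℕ} {q : ℕ → B} {κ C : ℝ} (hC : 0 ≤ C) {f : B}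
    (h : ∀ j < n, ‖q j * f - f * q j‖ ≤ κ) (α : ℕ → ℝ) (hα : ∀ j < n, |α j| ≤ C) :
    ‖(∑ j ∈ Finset.range n, α j • q j) * f - f * ∑ j ∈ Finset.range n, α j • q j‖ ≤ n * (C * κ) := by
  rw [Finset.sum_mul, Finset.mul_sum, ← Finset.sum_sub_distrib]
  refine (norm_sum_le_of_le (n := fun _ => C * κ) _ fun j hj => ?_).trans (by simp)
  have hj' := Finset.mem_range.1 hj
  rw [smul_mul_assoc, mul_smul_comm, ← smul_sub, norm_smul, Real.norm_eq_abs]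
  exact mul_le_mul (hα j hj') (h j hj') (norm_nonneg _) hC

theorem norm_commutator_sum_sum_le {n : ℕ} {q : ℕ → B} {κ C : ℝ} (hC : 0 ≤ C)
    (h : ∀ i < n, ∀ j < n, ‖q i * q j - q j * q i‖ ≤ κ) (α α' : ℕ → ℝ) (hα : ∀ j < n, |α j| ≤ C)
    (hα' : ∀ j < n, |α' j| ≤ C) :
    ‖(∑ j ∈ Finset.range n, α j • q j) * (∑ j ∈ Finset.range n, α' j • q j) -
      (∑ j ∈ Finset.range n, α' j • q j) * ∑ j ∈ Finset.range n, α j • q j‖ ≤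
      n * (C * (n * (C * κ))) := by
  refine norm_commutator_sum_le hC (fun i hi => ?_) α hα
  rw [norm_sub_rev]
  exact norm_commutator_sum_le hC (fun j hj => h j hj i hi) α' hα'

/-- The sum `x` is self-adjoint with `‖x² - x‖ ≤ 2`, so `‖x‖² ≤ ‖x‖ + 2`. A bound independent of `n`
is what makes `(2π/n) x` small. -/
theorem norm_sum_almost_orthogonal_le {n : ℕ} {q : ℕ → B} {κ : ℝ}
    (hq : ∀ j, IsStarProjection (q j)) (h : ∀ i < n, ∀ j < n, i ≠ j → ‖q i * q j‖ ≤ κ)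
    (hκ : (n : ℝ) * (n * κ) ≤ 2) (hκ0 : 0 ≤ κ) : ‖∑ j ∈ Finset.range n, q j‖ ≤ 2 := by
  set x := ∑ j ∈ Finset.range n, q j with hx
  have hsa : star x = x := by
    rw [hx, star_sum]
    exact Finset.sum_congr rfl fun j _ => (hq j).isSelfAdjoint.star_eq
  have h1 : ‖x * x - x‖ ≤ n * (n * κ) := by
    have : x * x - x = ∑ i ∈ Finset.range n, ∑ j ∈ Finset.range n, if i = j then 0 else q i * q j := by
      rw [hx, Finset.sum_mul, ← Finset.sum_sub_distrib]
      refine Finset.sum_congr rfl fun i hi => ?_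
      rw [Finset.mul_sum, ← Finset.add_sum_erase _ _ hi, (hq i).isIdempotentElem.eq,
        add_sub_cancel_left, ← Finset.add_sum_erase _ (fun j => if i = j then 0 else q i * q j) hi,
        if_pos rfl, zero_add]
      exact Finset.sum_congr rfl fun j hj => (if_neg (Finset.ne_of_mem_erase hj).symm).symm
    rw [this]
    refine (norm_sum_le_of_le (n := fun _ => n * κ) _ fun i hi => ?_).trans (by simp)
    refine (norm_sum_le_of_le (n := fun _ => κ) _ fun j hj => ?_).trans (by simp)
    split_ifs with hij
    · simpa using hκ0
    · exact h i (Finset.mem_range.1 hi) j (Finset.mem_range.1 hj) hij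
  have h2 : ‖x‖ * ‖x‖ = ‖x * x‖ := by
    rw [← CStarRing.norm_star_mul_self, hsa]
  have h3 : ‖x * x‖ ≤ ‖x‖ + n * (n * κ) := by
    calc ‖x * x‖ = ‖x + (x * x - x)‖ := by rw [add_sub_cancel]
      _ ≤ _ := (norm_add_le _ _).trans (by linarith)
  nlinarith [norm_nonneg x]

theorem expI_neg_eq_star {a : B} (ha : IsSelfAdjoint a) : expI (-a) 1 = star (expI a 1) := by
  rw [star_expI ha, expI, expI]; simp

theorem isSelfAdjoint_sum_smul {q : ℕ → B} (hq : ∀ j, IsStarProjection (q j)) (α : ℕ → ℝ) (n : ℕ) :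
    IsSelfAdjoint (∑ j ∈ Finset.range n, α j • q j) := by
  rw [isSelfAdjoint_iff, star_sum]
  exact Finset.sum_congr rfl fun j _ => by rw [star_smul, (hq j).isSelfAdjoint.star_eq, star_trivial]

/-- A projection which is almost orthogonal to its first `n` translates gives a unitary `y` for which
`y β(y)*` is close to `1` and has a logarithm of prescribed trace. -/
theorem exists_unitary_of_almost_orthogonal (hT : IsTraceFunctional T) (β : B ≃⋆ₐ[ℂ] B)
    (hβ : ∀ a, T (β a) = T a) {n : ℕ} (hn : 1 ≤ n) {ε κ : ℝ} (hε : ε ≤ 1 / 10)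
    (hnε : 4 * Real.pi / n ≤ ε / 2) (hκ0 : 0 ≤ κ) (hκ : 600 * (n + 1 : ℝ) ^ 2 * κ ≤ ε / 2) {p : B}
    (hp : IsStarProjection p) (horth : ∀ d, 1 ≤ d → d ≤ n → ‖p * iter β d p‖ ≤ κ) :
    ∃ y ∈ unitary B, ‖y * star (β y) - 1‖ ≤ ε ∧
      trLog T (y * star (β y)) = 2 * Real.pi * Complex.I * T p ∧
      ∀ (f : B) (δ : ℝ), (∀ j < n, ‖p * (iter β j).symm f - (iter β j).symm f * p‖ ≤ δ) →
        ‖y * f - f * y‖ ≤ n * (7 * δ) := by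
  have hn0 : (0 : ℝ) < n := by exact_mod_cast hn
  have hpi : 2 * Real.pi ≤ 7 := by linarith [Real.pi_lt_d2]
  have hpi0 := Real.pi_pos
  set q : ℕ → B := fun j => iter β j p with hqdef
  have hq : ∀ j, IsStarProjection (q j) := fun j => hp.map _
  have hβq : ∀ j, β (q j) = q (j + 1) := fun j => rfl
  have horth' : ∀ i ≤ n, ∀ j ≤ n, i < j → ‖q i * q j‖ ≤ κ := by
    intro i _ j hj hij
    have h1 : q j = iter β i (iter β (j - i) p) := by
      rw [← iter_add, Nat.add_sub_cancel' hij.le]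
    rw [h1, hqdef]
    simp only
    rw [← map_mul, norm_map_aut]
    exact horth _ (by omega) (by omega)
  have horth2 : ∀ i ≤ n, ∀ j ≤ n, i ≠ j → ‖q i * q j‖ ≤ κ := by
    intro i hi j hj hij
    rcases lt_or_gt_of_ne hij with h | h
    · exact horth' i hi j hj h
    · rw [← norm_star, star_mul, (hq i).isSelfAdjoint.star_eq, (hq j).isSelfAdjoint.star_eq]
      exact horth' j hj i hi h
  have hcomm : ∀ i < n + 1, ∀ j < n + 1, ‖q i * q j - q j * q i‖ ≤ 2 * κ := by
    intro i hi j hj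
    by_cases hij : i = j
    · subst hij; simpa using hκ0
    · refine (norm_sub_le _ _).trans ?_
      linarith [horth2 i (by omega) j (by omega) hij, horth2 j (by omega) i (by omega) (Ne.symm hij)]
  -- The weights climb from `0` to `2π` in steps of `2π/n`; the constant `7` bounds `2π`.
  let d : ℕ → ℝ := fun j => 2 * Real.pi * j / n
  have hd0 : d 0 = 0 := by simp [d]
  have hdn : d n = 2 * Real.pi := by simp only [d]; field_simp
  have hdle : ∀ j ≤ n, |d j| ≤ 7 := by
    intro j hj
    have h1 : (j : ℝ) ≤ n := by exact_mod_cast hj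
    rw [abs_of_nonneg (by positivity)]
    refine le_trans ?_ hpi
    rw [div_le_iff₀ hn0]
    gcongr
  -- With `q j = β^j(p)` and `S = (2π/n) ∑_{j<n} q j`, the four generators are `a 0`, `-β(a 0)`,
  -- `-S` and `2π q n`. Their coefficients cancel at each `q j`, and the last one exponentiates to
  -- `1`, so the product of the four exponentials is `y β(y)* exp(-iS)`.
  let α : Fin 4 → ℕ → ℝ := ![fun j => if j < n then d (j + 1) else 0, fun j => -d j,
    fun j => if j < n then -(2 * Real.pi / n) else 0, fun j => if j < n then 0 else 2 * Real.pi]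
  have hα : ∀ i, ∀ j < n + 1, |α i j| ≤ 7 := by
    intro i j hj
    fin_cases i
    · change |if j < n then d (j + 1) else 0| ≤ 7
      split_ifs with h
      · exact hdle _ h
      · norm_num
    · change |-d j| ≤ 7
      rw [abs_neg]; exact hdle _ (by omega)
    · change |if j < n then -(2 * Real.pi / n) else 0| ≤ 7
      split_ifs with h
      · rw [abs_neg, abs_of_nonneg (by positivity)]
        refine le_trans ?_ hpi
        refine div_le_self (by positivity) (by exact_mod_cast hn)
      · norm_num
    · change |if j < n then 0 else 2 * Real.pi| ≤ 7
      split_ifs with h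
      · norm_num
      · rwa [abs_of_nonneg (by positivity)]
  let a : Fin 4 → B := fun i => ∑ j ∈ Finset.range (n + 1), α i j • q j
  have ha : ∀ i, IsSelfAdjoint (a i) := fun i => isSelfAdjoint_sum_smul hq _ _
  have ha0 : a 0 = ∑ j ∈ Finset.range n, d (j + 1) • q j := by
    change ∑ j ∈ Finset.range (n + 1), (if j < n then d (j + 1) else 0) • q j = _
    rw [Finset.sum_range_succ, if_neg (lt_irrefl n), zero_smul, add_zero]
    exact Finset.sum_congr rfl fun j hj => by rw [if_pos (Finset.mem_range.1 hj)]
  have ha1 : a 1 = -β (a 0) := by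
    have h1 : a 1 = -∑ j ∈ Finset.range (n + 1), d j • q j := by
      change ∑ j ∈ Finset.range (n + 1), (-d j) • q j = _
      simp only [neg_smul, Finset.sum_neg_distrib]
    rw [h1, Finset.sum_range_succ', hd0, zero_smul, add_zero, ha0, map_sum]
    congr 1
    refine Finset.sum_congr rfl fun j _ => ?_
    rw [← hβq]
    exact (map_smul β (d (j + 1) : ℂ) (q j)).symm
  set S : B := (2 * Real.pi / n) • ∑ j ∈ Finset.range n, q j with hS
  have ha2 : a 2 = -S := by
    change ∑ j ∈ Finset.range (n + 1), (if j < n then -(2 * Real.pi / n) else 0) • q j = _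
    rw [Finset.sum_range_succ, if_neg (lt_irrefl n), zero_smul, add_zero, hS, Finset.smul_sum,
      ← Finset.sum_neg_distrib]
    exact Finset.sum_congr rfl fun j hj => by rw [if_pos (Finset.mem_range.1 hj), neg_smul]
  have ha3 : a 3 = (2 * Real.pi) • q n := by
    change ∑ j ∈ Finset.range (n + 1), (if j < n then 0 else 2 * Real.pi) • q j = _
    rw [Finset.sum_range_succ, if_neg (lt_irrefl n)]
    simp only [add_eq_right]
    exact Finset.sum_eq_zero fun j hj => by rw [if_pos (Finset.mem_range.1 hj), zero_smul]
  have hsum : ∑ i, a i = 0 := by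
    have h1 : ∀ j ∈ Finset.range (n + 1), ∑ i, α i j • q j = d j • q j - d j • q j := by
      intro j hj
      rw [sub_self, ← Finset.sum_smul, Fin.sum_univ_four]
      change ((if j < n then d (j + 1) else 0) + -d j + (if j < n then -(2 * Real.pi / n) else 0) +
        (if j < n then 0 else 2 * Real.pi)) • q j = 0
      split_ifs with h
      · have : d (j + 1) + -d j + -(2 * Real.pi / n) + 0 = 0 := by
          simp only [d]; push_cast; ring
        rw [this, zero_smul]
      · have : j = n := by have := Finset.mem_range.1 hj; omega
        rw [this, hdn]; simp
    rw [Finset.sum_comm, Finset.sum_congr rfl h1]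
    simp
  have hcomm_a : ∀ i j, ‖a i * a j - a j * a i‖ ≤ 98 * (n + 1 : ℝ) ^ 2 * κ := fun i j => by
    refine (norm_commutator_sum_sum_le (by norm_num) hcomm (α i) (α j) (hα i) (hα j)).trans
      (le_of_eq ?_)
    push_cast; ring
  have hε0 : 0 ≤ ε := by
    have : 0 ≤ 600 * (n + 1 : ℝ) ^ 2 * κ := by positivity
    linarith
  have hnn : (0 : ℝ) ≤ (n + 1 : ℝ) ^ 2 * κ := by positivity
  -- Here `98 = 2 · 7²`, from commutators bounded by `2κ` and coefficients bounded by `7`. Then `6 ·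
  -- 98 = 588 ≤ 600` puts the product within `ε/2` of `1`.
  obtain ⟨hG1, hG2⟩ := trLog_expI_mul_expI hT.comm ha hsum (η := 98 * (n + 1 : ℝ) ^ 2 * κ)
    (by linarith) hcomm_a
  have hβsa : IsSelfAdjoint (β (a 0)) := (ha 0).map β
  have hSsa : IsSelfAdjoint S := by
    have := (ha 2).neg
    rwa [ha2, neg_neg] at this
  set y := expI (a 0) 1 with hy
  have hyu : y ∈ unitary B := expI_mem (ha 0) 1
  set E := expI S 1 with hE
  have hEu : E ∈ unitary B := expI_mem hSsa 1
  rw [ha1, ha2, ha3, expI_eq_one_of_projection (hq n), mul_one, expI_neg_eq_star hβsa,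
    expI_neg_eq_star hSsa, ← map_expI, ← hy, ← hE] at hG1 hG2
  have hSnorm : ‖S‖ ≤ ε / 2 := by
    have h1 : ‖∑ j ∈ Finset.range n, q j‖ ≤ 2 := by
      refine norm_sum_almost_orthogonal_le hq (fun i hi j hj => horth2 i hi.le j hj.le) ?_ hκ0
      nlinarith
    rw [hS, norm_smul, Real.norm_of_nonneg (by positivity)]
    calc _ ≤ 2 * Real.pi / n * 2 := by gcongr
      _ = 4 * Real.pi / n := by ring
      _ ≤ _ := hnε
  have hE1 : ‖E - 1‖ ≤ ε / 2 := (norm_expI_sub_one_le hSsa (by simp)).trans hSnorm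
  have hg : y * star (β y) = y * star (β y) * star E * E := by
    rw [mul_assoc _ (star E), Unitary.star_mul_self_of_mem hEu, mul_one]
  refine ⟨y, hyu, ?_, ?_, fun f δ hf => ?_⟩
  · have h1 : y * star (β y) - 1 = (y * star (β y) * star E - 1) * E + (E - 1) := by
      rw [sub_mul, one_mul, ← hg]; abel
    rw [h1]
    refine (norm_add_le _ _).trans ?_
    rw [norm_mul_unitary hEu]
    linarith
  · rw [hg, trLog_mul hT.comm (by linarith) (by linarith), hG2, zero_add, hE,
      trLog_expI hT.comm hSsa (by linarith), hS]
    have h1 : T ((2 * Real.pi / n) • ∑ j ∈ Finset.range n, q j) = 2 * Real.pi * T p := by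
      have h2 : (2 * Real.pi / n) • ∑ j ∈ Finset.range n, q j =
          ((2 * Real.pi / n : ℝ) : ℂ) • ∑ j ∈ Finset.range n, q j := rfl
      rw [h2, map_smul, map_sum, Finset.sum_congr rfl fun j _ => trace_iter β hβ j p]
      simp only [Finset.sum_const, Finset.card_range, nsmul_eq_mul, smul_eq_mul]
      have : (n : ℂ) ≠ 0 := by exact_mod_cast hn0.ne'
      push_cast
      field_simp
    rw [h1]; ring
  · refine (norm_expI_commutator_le (ha 0) f 1 (by simp)).trans ?_
    rw [ha0]
    refine norm_commutator_sum_le (by norm_num) (fun j hj => ?_) _ (fun j hj => hdle _ hj)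
    have h1 : f = iter β j ((iter β j).symm f) := ((iter β j).apply_symm_apply f).symm
    have h2 : q j * f - f * q j = iter β j (p * (iter β j).symm f - (iter β j).symm f * p) := by
      rw [map_sub, map_mul, map_mul, ← h1]
    rw [h2, norm_map_aut]
    exact hf j hj

end Correction

/-! ### Subprojections of prescribed trace in a commutant -/

namespace UHFSystem

variable (Φ : UHFSystem k B)

/-- Cut `e` by a minimal projection `f` of the `m`-th algebra: the trace of `e f` is that of `e`
divided by `k^m`. A subprojection of `e f` of trace `r / k^m`, spread over the diagonal matrix
units, commutes with the `m`-th algebra and has trace `r`. -/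
theorem exists_subprojection_mem_comm {T : B →ₗ[ℂ] ℂ} (hT : ∀ a b, T (a * b) = T (b * a))
    (h1 : T 1 = 1) {l m : ℕ} {e : B} (he : IsStarProjection e) (hel : e ∈ Φ.alg l)
    (hem : e ∈ Φ.comm m) {r : ℝ} (hr : r ∈ kAdic k) (hr0 : 0 ≤ r) (hre : r ≤ (T e).re) :
    ∃ p ∈ Φ.comm m, IsStarProjection p ∧ p * e = p ∧ T p = r := by
  set f := Φ.unit m (Φ.zero m) (Φ.zero m) with hf
  have hfp : IsStarProjection f := Φ.isStarProjection_unit m _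
  have hcomm : ∀ i j, Φ.unit m i j * e = e * Φ.unit m i j := fun i j =>
    Φ.mem_comm.1 hem _ (Φ.map_mem_alg m _)
  have hef : IsStarProjection (e * f) := by
    refine ⟨?_, ?_⟩
    · change e * f * (e * f) = e * f
      rw [mul_assoc, ← mul_assoc f, hcomm, mul_assoc e f f, hfp.isIdempotentElem.eq, ← mul_assoc,
        he.isIdempotentElem.eq]
    · rw [isSelfAdjoint_iff, star_mul, he.isSelfAdjoint.star_eq, hfp.isSelfAdjoint.star_eq, hcomm]
  have hkm : (0 : ℝ) < (k : ℝ) ^ m := by exact_mod_cast Φ.pow_pos m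
  have hTe : T e = (k : ℂ) ^ m * T (e * f) := by
    have h2 : ∀ i, T (Φ.unit m i i * e) = T (e * f) := fun i => by
      rw [← Φ.unit_mul_unit m i (Φ.zero m) i, mul_assoc, hT, hcomm, mul_assoc, Φ.unit_mul_unit]
    calc T e = T ((∑ i, Φ.unit m i i) * e) := by rw [Φ.sum_unit, one_mul]
      _ = _ := by rw [Finset.sum_mul, map_sum, Finset.sum_congr rfl fun i _ => h2 i]; simp
  obtain ⟨l', z, hz⟩ := hr
  have hk' : ∀ n, (0 : ℝ) < (k : ℝ) ^ n := fun n => by exact_mod_cast Φ.pow_pos n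
  have hz0 : 0 ≤ z := by
    have : (0 : ℝ) ≤ z := by rw [← hz]; exact mul_nonneg hr0 (hk' _).le
    exact_mod_cast this
  lift z to ℕ using hz0 with j
  have hz' : r * (k : ℝ) ^ l' = j := by simpa using hz
  -- Level `l + l' + m` contains `e` and `f`, and its size is divisible by the denominator of `r /
  -- k^m`.
  have hj : ((j * k ^ l : ℕ) : ℝ) / (k : ℝ) ^ (l + l' + m) = r / (k : ℝ) ^ m := by
    push_cast
    rw [← hz', pow_add, pow_add]
    have := (hk' l).ne'; have := (hk' l').ne'; have := (hk' m).ne'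
    field_simp
  have hTre : (T e).re = (k : ℝ) ^ m * (T (e * f)).re := by
    rw [hTe, show ((k : ℂ) ^ m) = (((k : ℝ) ^ m : ℝ) : ℂ) by push_cast; rfl, Complex.re_ofReal_mul]
  obtain ⟨q, hql, hq, hqe, hTq⟩ := Φ.exists_subprojection hT h1 hef
    (Φ.alg_mono (show l ≤ l + l' + m by omega) hel |> fun h =>
      mul_mem h (Φ.unit_mem_alg (show m ≤ l + l' + m by omega) _ _)) (j := j * k ^ l) (by
      rw [hj, div_le_iff₀ hkm, mul_comm, ← hTre]; exact hre)
  have hqf : q * f = q := by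
    rw [← hqe, mul_assoc, mul_assoc, hfp.isIdempotentElem.eq]
  have hqe' : q * e = q := by
    have : q * e = q * (e * f) * e := by rw [hqe]
    rw [this, mul_assoc q, mul_assoc e, hcomm, ← mul_assoc e, he.isIdempotentElem.eq, hqe]
  refine ⟨Φ.spread m q, Φ.spread_mem_comm m q, ⟨?_, ?_⟩, ?_, ?_⟩
  · change Φ.spread m q * Φ.spread m q = _
    rw [spread_apply, Finset.sum_mul]
    refine Finset.sum_congr rfl fun i _ => ?_
    rw [Finset.mul_sum, Finset.sum_eq_single i]
    · calc _ = Φ.unit m i (Φ.zero m) * (q * (Φ.unit m (Φ.zero m) i * Φ.unit m i (Φ.zero m)) * q) *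
            Φ.unit m (Φ.zero m) i := by simp only [mul_assoc]
        _ = _ := by rw [Φ.unit_mul_unit, hqf, hq.isIdempotentElem.eq]
    · intro a _ ha
      calc _ = Φ.unit m i (Φ.zero m) * (q * (Φ.unit m (Φ.zero m) i * Φ.unit m a (Φ.zero m)) * q) *
            Φ.unit m (Φ.zero m) a := by simp only [mul_assoc]
        _ = _ := by rw [Φ.unit_mul_unit_of_ne m ha.symm]; simp
    · simp
  · rw [isSelfAdjoint_iff, spread_apply, star_sum]
    refine Finset.sum_congr rfl fun i _ => ?_
    rw [star_mul, star_mul, hq.isSelfAdjoint.star_eq, star_unit, star_unit, mul_assoc]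
  · rw [spread_apply, Finset.sum_mul]
    refine Finset.sum_congr rfl fun i _ => ?_
    rw [mul_assoc _ _ e, hcomm, ← mul_assoc, mul_assoc _ q, hqe']
  · have h2 : ∀ i, T (Φ.unit m i (Φ.zero m) * q * Φ.unit m (Φ.zero m) i) = T q := fun i => by
      rw [hT, ← mul_assoc, Φ.unit_mul_unit, hT, hqf]
    rw [spread_apply, map_sum, Finset.sum_congr rfl fun i _ => h2 i, hTq]
    have h3 : ((j * k ^ l : ℕ) : ℂ) / (k : ℂ) ^ (l + l' + m) = r / (k : ℂ) ^ m := by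
      have := congrArg (fun x : ℝ => (x : ℂ)) hj
      push_cast at this ⊢
      exact this
    rw [h3]
    have : ((k : ℂ) ^ m) ≠ 0 := by exact_mod_cast (Φ.pow_pos m).ne'
    simp
    field_simp

theorem exists_level (G : Finset B) {δ : ℝ} (hδ : 0 < δ) :
    ∃ μ, ∀ x ∈ G, ∃ y ∈ Φ.alg μ, ‖y - x‖ ≤ δ := by
  choose l hl using fun x => Φ.exists_near x hδ
  refine ⟨G.sup l, fun x hx => ?_⟩
  obtain ⟨y, hy, hyx⟩ := hl x
  exact ⟨y, Φ.alg_mono (Finset.le_sup hx) hy, hyx.le⟩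

theorem norm_commutator_le {m : ℕ} {p f y : B} (hp : p ∈ Φ.comm m) (hp1 : ‖p‖ ≤ 1) (hy : y ∈ Φ.alg m)
    {δ : ℝ} (h : ‖y - f‖ ≤ δ) : ‖p * f - f * p‖ ≤ 2 * δ := by
  have h1 : p * f - f * p = (y - f) * p - p * (y - f) := by
    rw [sub_mul, mul_sub, Φ.mem_comm.1 hp y hy]; abel
  rw [h1]
  refine (norm_sub_le _ _).trans ?_
  have h2 := norm_mul_le (y - f) p
  have h3 := norm_mul_le p (y - f)
  nlinarith [norm_nonneg (y - f), norm_nonneg p]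

end UHFSystem

/-! ### Rohlin towers indexed by their levels -/

section Towers

/-- The cyclic shift on the index set of a family of towers. -/
def shift {m : ℕ} (h : Fin m → ℕ) : Equiv.Perm (Σ i, Fin (h i)) :=
  Equiv.sigmaCongrRight fun i => finRotate (h i)

theorem shift_apply {m : ℕ} (h : Fin m → ℕ) (i : Fin m) (j : Fin (h i)) :
    shift h ⟨i, j⟩ = ⟨i, ⟨(j + 1) % h i, Nat.mod_lt _ j.pos⟩⟩ := by
  change (⟨i, finRotate (h i) j⟩ : Σ i, Fin (h i)) = _
  congr 1
  generalize h i = n at j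
  cases n with
  | zero => exact j.elim0
  | succ n =>
    rw [finRotate_apply]
    ext
    simp [Fin.val_add]

theorem HasRohlinProperty.exists_towers {β : B ≃⋆ₐ[ℂ] B} (hβ : HasRohlinProperty β) (N : ℕ) :
    ∃ (m : ℕ) (h : Fin m → ℕ), (∀ i, N ≤ h i) ∧ ∀ (F : Finset B) (ε : ℝ), 0 < ε →
      ∃ e : (Σ i, Fin (h i)) → B, (∀ a, IsStarProjection (e a)) ∧ ∑ a, e a = 1 ∧
        (∀ a, ‖β (e a) - e (shift h a)‖ ≤ ε) ∧ ∀ a, ∀ x ∈ F, ‖x * e a - e a * x‖ ≤ ε := by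
  obtain ⟨m, h, hN, H⟩ := hβ N
  refine ⟨m, h, hN, fun F ε hε => ?_⟩
  obtain ⟨e, h1, h2, h3, h4⟩ := H F ε hε
  refine ⟨fun a => e a.1 a.2, fun a => h1 _ _ a.2.2, ?_, fun ⟨i, j⟩ => ?_,
    fun a x hx => (h4 _ _ a.2.2 x hx).le⟩
  · rw [Fintype.sum_sigma, ← h2]
    exact Finset.sum_congr rfl fun i _ => (Finset.sum_range (e i)).symm
  · rw [shift_apply]
    exact (h3 i j j.2).le

theorem norm_iter_sub_le {β : B ≃⋆ₐ[ℂ] B} {m : ℕ} {h : Fin m → ℕ} {e : (Σ i, Fin (h i)) → B} {ε : ℝ}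
    (he : ∀ a, ‖β (e a) - e (shift h a)‖ ≤ ε) (i : Fin m) (j : ℕ) (hj : j < h i) :
    ‖iter β j (e ⟨i, ⟨0, by omega⟩⟩) - e ⟨i, ⟨j, hj⟩⟩‖ ≤ j * ε := by
  induction j with
  | zero => simp
  | succ j ih =>
    have h1 := ih (by omega)
    have h2 := he ⟨i, ⟨j, by omega⟩⟩
    rw [shift_apply] at h2
    simp only [Nat.mod_eq_of_lt hj] at h2
    have h3 : iter β (j + 1) (e ⟨i, ⟨0, by omega⟩⟩) - e ⟨i, ⟨j + 1, hj⟩⟩ =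
        β (iter β j (e ⟨i, ⟨0, by omega⟩⟩) - e ⟨i, ⟨j, by omega⟩⟩) +
          (β (e ⟨i, ⟨j, by omega⟩⟩) - e ⟨i, ⟨j + 1, hj⟩⟩) := by
      rw [map_sub, iter_succ]; abel
    rw [h3]
    refine (norm_add_le _ _).trans ?_
    rw [norm_map_aut]
    push_cast
    linarith

end Towers

/-! ### Realizing small `k`-adic numbers as defects -/

section Correction

variable {T : B →L[ℂ] ℂ}

/-- The threshold `ρ` depends only on the shape of the towers, which the Rohlin property fixes
before `F` and `η`. Some level has trace at least `ρ`, hence so has the bottom of its tower. A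
subprojection near the bottom level has almost orthogonal translates, since the tower has height at
least `n + 1`. -/
theorem exists_unitary_of_trace_small_nonneg (hT : IsTraceFunctional T) (Φ : UHFSystem k B)
    {β : B ≃⋆ₐ[ℂ] B} (hR : HasRohlinProperty β) (hβ : ∀ a, T (β a) = T a) {ε : ℝ} (hε : 0 < ε)
    (hε1 : ε ≤ 1 / 10) :
    ∃ ρ > 0, ∀ r ∈ kAdic k, 0 ≤ r → r ≤ ρ → ∀ (F : Finset B) (η : ℝ), 0 < η →
      ∃ y ∈ unitary B, (∀ f ∈ F, ‖y * f - f * y‖ ≤ η) ∧ ‖y * star (β y) - 1‖ ≤ ε ∧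
        trLog T (y * star (β y)) = 2 * Real.pi * Complex.I * r := by
  classical
  obtain ⟨n0, hn0⟩ := exists_nat_gt (4 * Real.pi / (ε / 2))
  set n := n0 + 1 with hn
  have hnpos : (0 : ℝ) < n := by positivity
  have hnε : 4 * Real.pi / n ≤ ε / 2 := by
    rw [div_le_iff₀ hnpos, ← div_le_iff₀' (by positivity)]
    refine hn0.le.trans ?_
    rw [hn]; push_cast; linarith
  obtain ⟨m, h, hh, H⟩ := hR.exists_towers (n + 1)
  set c : ℕ := Fintype.card (Σ i, Fin (h i)) with hc
  have hhc : ∀ i, h i ≤ c := fun i => by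
    rw [hc, Fintype.card_sigma]
    simp only [Fintype.card_fin]
    exact Finset.single_le_sum (f := h) (fun _ _ => Nat.zero_le _) (Finset.mem_univ i)
  have hc1 : (0 : ℝ) < (c : ℝ) + 1 := by positivity
  refine ⟨1 / (c + 1), by positivity, fun r hr hr0 hrρ F η hη => ?_⟩
  set κ : ℝ := ε / 2 / (600 * (n + 1 : ℝ) ^ 2) with hκ
  have hκ0 : 0 < κ := by positivity
  set δ : ℝ := η / (n * 7) with hδ
  have hδ0 : 0 < δ := by positivity
  let G : Finset B := (Finset.range n ×ˢ F).image fun x => (iter β x.1).symm x.2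
  obtain ⟨μ, hμ⟩ := Φ.exists_level G (half_pos hδ0)
  set η₁ : ℝ := min (1 / 32) (κ / 36) with hη₁
  have hη₁0 : 0 < η₁ := by positivity
  have hη₁a : η₁ ≤ 1 / 32 := min_le_left _ _
  have hη₁b : η₁ ≤ κ / 36 := min_le_right _ _
  have hkμ : (0 : ℝ) < (k : ℝ) ^ μ := by exact_mod_cast Φ.pow_pos μ
  -- The three bounds serve, in order, to approximate a level in the commutant, to keep `β^d` of the
  -- bottom level within `κ/2` of level `d`, and to identify the traces of the levels of one tower.
  set εR : ℝ := min (η₁ / 2 / (k : ℝ) ^ μ) (min (κ / (2 * n)) (1 / (4 * (c + 1)))) with hεR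
  have hεR0 : 0 < εR := by positivity
  have hεRa : εR ≤ η₁ / 2 / (k : ℝ) ^ μ := min_le_left _ _
  have hεRb : εR ≤ κ / (2 * n) := (min_le_right _ _).trans (min_le_left _ _)
  have hεRc : εR ≤ 1 / (4 * (c + 1)) := (min_le_right _ _).trans (min_le_right _ _)
  obtain ⟨e, he, hes, heβ, heF⟩ := H (Finset.univ.image fun i => Φ.unit μ (Φ.zero μ) i) εR hεR0
  obtain ⟨⟨i, j⟩, hij⟩ : ∃ a, 1 / ((c : ℝ) + 1) ≤ (T (e a)).re := by
    by_contra! hcon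
    have h1 : ∑ a, (T (e a)).re = 1 := by
      rw [← Complex.re_sum, ← map_sum, hes, hT.map_one, Complex.one_re]
    have h2 : ∑ a, (T (e a)).re ≤ ∑ _a : (Σ i, Fin (h i)), 1 / ((c : ℝ) + 1) :=
      Finset.sum_le_sum fun a _ => (hcon a).le
    rw [h1, Finset.sum_const, Finset.card_univ, ← hc, nsmul_eq_mul, mul_one_div, le_div_iff₀ hc1] at h2
    linarith
  set e0 := e ⟨i, ⟨0, j.pos⟩⟩ with he0
  have hTe0 : T e0 = T (e ⟨i, j⟩) := by
    rw [← trace_iter β hβ j e0]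
    refine map_eq_of_projection_near hT.comm ((he _).map _) (he _) ?_
    refine (norm_iter_sub_le heβ i j j.2).trans_lt ?_
    have h1 : ((j : ℕ) : ℝ) ≤ c := by exact_mod_cast j.2.le.trans (hhc i)
    calc ((j : ℕ) : ℝ) * εR ≤ (c + 1) * (1 / (4 * (c + 1))) := by
          refine mul_le_mul (by linarith) hεRc hεR0.le hc1.le
      _ = 1 / 4 := by field_simp
      _ < 1 / 2 := by norm_num
  obtain ⟨l, -, x, ⟨hxl, hxμ⟩, hxe⟩ := Φ.exists_near_mem_comm μ e0 hη₁0 fun s => by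
    rw [norm_sub_rev]
    exact (heF _ _ (Finset.mem_image_of_mem _ (Finset.mem_univ s))).trans hεRa
  obtain ⟨e', ⟨he'l, he'μ⟩, he', he'e⟩ := exists_projection_mem_near (Φ.isClosed_alg_inf_comm l μ)
    ⟨hxl, hxμ⟩ (he _) hη₁a hxe
  have hTe' : T e' = T e0 := map_eq_of_projection_near hT.comm he' (he _) (by linarith)
  obtain ⟨p, hpμ, hp, hpe, hTp⟩ := Φ.exists_subprojection_mem_comm (T := (T : B →ₗ[ℂ] ℂ)) hT.comm
    hT.map_one he' he'l he'μ hr hr0 (by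
      change r ≤ (T e').re
      rw [hTe', hTe0]; exact hrρ.trans hij)
  have hpe2 : e' * p = p := by
    have := congrArg star hpe
    rwa [star_mul, hp.isSelfAdjoint.star_eq, he'.isSelfAdjoint.star_eq] at this
  have horth : ∀ d, 1 ≤ d → d ≤ n → ‖p * iter β d p‖ ≤ κ := by
    intro d hd hdn
    have hdi : d < h i := lt_of_lt_of_le (by omega) (hh i)
    have h1 : ‖e' * iter β d e'‖ ≤ κ := by
      have hz : e0 * e ⟨i, ⟨d, hdi⟩⟩ = 0 := mul_eq_zero_of_sum_eq_one he hes (by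
        intro hcon
        simp only [Sigma.mk.injEq, heq_eq_eq, Fin.mk.injEq, true_and] at hcon
        omega)
      have h2 : e' * iter β d e' = (e' - e0) * iter β d e' + e0 * iter β d (e' - e0) +
          e0 * (iter β d e0 - e ⟨i, ⟨d, hdi⟩⟩) := by
        rw [map_sub, mul_sub, mul_sub, hz, sub_mul]; abel
      have h3 : ‖iter β d e0 - e ⟨i, ⟨d, hdi⟩⟩‖ ≤ κ / 2 := by
        refine (norm_iter_sub_le heβ i d hdi).trans ?_
        have : (d : ℝ) ≤ n := by exact_mod_cast hdn
        calc (d : ℝ) * εR ≤ n * (κ / (2 * n)) := mul_le_mul this hεRb hεR0.le hnpos.le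
          _ = κ / 2 := by field_simp
      have h4 : ‖e0‖ ≤ 1 := (he _).norm_le
      have h5 : ‖iter β d e'‖ ≤ 1 := (he'.map _).norm_le
      have h6 : ‖iter β d (e' - e0)‖ ≤ 9 * η₁ := by rw [norm_map_aut]; exact he'e
      rw [h2]
      have h7 := norm_mul_le_of_le he'e h5
      have h8 := norm_mul_le_of_le h4 h6
      have h9 := norm_mul_le_of_le h4 h3
      refine (norm_add_le _ _).trans ?_
      have := norm_add_le ((e' - e0) * iter β d e') (e0 * iter β d (e' - e0))
      linarith
    have h2 : p * iter β d p = p * (e' * iter β d e') * iter β d p := by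
      rw [mul_assoc, mul_assoc, ← map_mul, hpe2, ← mul_assoc, hpe]
    rw [h2]
    have h3 := norm_mul_le_of_le (norm_mul_le_of_le hp.norm_le h1) (hp.map (iter β d)).norm_le
    linarith
  obtain ⟨y, hy, hy1, hy2, hy3⟩ := exists_unitary_of_almost_orthogonal hT β hβ (n := n) (by omega) hε1 hnε
    hκ0.le (by rw [hκ]; field_simp; exact le_rfl) hp horth
  have hTp' : T p = r := hTp
  refine ⟨y, hy, fun f hf => ?_, hy1, by rw [hy2, hTp']⟩
  refine (hy3 f δ fun s hs => ?_).trans (le_of_eq (by rw [hδ]; field_simp))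
  obtain ⟨a, ha, haf⟩ := hμ ((iter β s).symm f)
    (Finset.mem_image.2 ⟨(s, f), Finset.mem_product.2 ⟨Finset.mem_range.2 hs, hf⟩, rfl⟩)
  have := Φ.norm_commutator_le hpμ hp.norm_le ha haf
  linarith

/-- Small elements of the range of the trace on `K₀` are the determinants of approximately inner
cocycle perturbations. -/
theorem exists_unitary_of_trace_small (hT : IsTraceFunctional T) (Φ : UHFSystem k B)
    {β : B ≃⋆ₐ[ℂ] B} (hR : HasRohlinProperty β) (hβ : ∀ a, T (β a) = T a) {ε : ℝ} (hε : 0 < ε) :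
    ∃ ρ > 0, ∀ r ∈ kAdic k, |r| ≤ ρ → ∀ (F : Finset B) (η : ℝ), 0 < η →
      ∃ y ∈ unitary B, (∀ f ∈ F, ‖y * f - f * y‖ ≤ η) ∧ ‖y * star (β y) - 1‖ ≤ ε ∧
        trLog T (y * star (β y)) = 2 * Real.pi * Complex.I * r := by
  obtain ⟨ρ, hρ, H⟩ := exists_unitary_of_trace_small_nonneg hT Φ hR hβ
    (show 0 < min ε (1 / 10) by positivity) (min_le_right _ _)
  refine ⟨ρ, hρ, fun r hr hrρ F η hη => ?_⟩
  rcases le_total 0 r with h0 | h0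
  · obtain ⟨y, hy, h1, h2, h3⟩ := H r hr h0 (by rwa [abs_of_nonneg h0] at hrρ) F η hη
    exact ⟨y, hy, h1, h2.trans (min_le_left _ _), h3⟩
  · obtain ⟨y, hy, h1, h2, h3⟩ := H (-r) (neg_mem hr) (by linarith) (by rwa [abs_of_nonpos h0] at hrρ)
      F η hη
    have hβy : β y ∈ unitary B := Unitary.map_mem β hy
    -- For negative `r` the unitary is `y*`: `y* β(y)` is conjugate to the adjoint of `y β(y)*`, so
    -- its logarithm has the opposite trace.
    have hconj : star y * β y = star y * star (y * star (β y)) * star (star y) := by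
      rw [star_mul, star_star, star_star, ← mul_assoc (star y), mul_assoc _ (star y) y,
        Unitary.star_mul_self_of_mem hy, mul_one]
    refine ⟨star y, Unitary.star_mem hy, fun f hf => ?_, ?_, ?_⟩
    · have h4 : star y * f - f * star y = -(star y * (y * f - f * y) * star y) := by
        rw [mul_sub, sub_mul, ← mul_assoc, Unitary.star_mul_self_of_mem hy, one_mul, ← mul_assoc,
          mul_assoc _ y, Unitary.mul_star_self_of_mem hy, mul_one, neg_sub]
      rw [h4, norm_neg, norm_mul_unitary (Unitary.star_mem hy),
        norm_unitary_mul (Unitary.star_mem hy)]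
      exact h1 f hf
    · rw [map_star, star_star, norm_star_mul_sub_one hy, norm_sub_rev,
        ← norm_mul_star_sub_one hβy]
      exact h2.trans (min_le_left _ _)
    · rw [map_star, star_star, hconj, trLog_conj_unitary hT (Unitary.star_mem hy),
        trLog_star_unitary hT (mul_mem hy (Unitary.star_mem hβy))
          (h2.trans ((min_le_right _ _).trans (by norm_num))), h3]
      push_cast; ring

end Correction

/-! ### Gluing unitaries along a partition of unity -/

section Blocks

variable {ι : Type*} [Fintype ι] [DecidableEq ι] {e : ι → B}

theorem sum_conj_mul_sum_conj (he : ∀ i, IsStarProjection (e i)) (hs : ∑ i, e i = 1) (x y : ι → B) :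
    (∑ a, e a * x a * e a) * ∑ a, e a * y a * e a = ∑ a, e a * (x a * e a * y a) * e a := by
  rw [Finset.sum_mul]
  refine Finset.sum_congr rfl fun a _ => ?_
  rw [Finset.mul_sum, Finset.sum_eq_single a]
  · calc _ = e a * x a * (e a * e a) * y a * e a := by simp only [mul_assoc]
      _ = _ := by rw [(he a).isIdempotentElem.eq]; simp only [mul_assoc]
  · intro b _ hb
    calc _ = e a * x a * (e a * e b) * y b * e b := by simp only [mul_assoc]
      _ = 0 := by rw [mul_eq_zero_of_sum_eq_one he hs hb]; simp
  · simp

theorem norm_sum_conj_mul_sub_one_le (he : ∀ i, IsStarProjection (e i)) (hs : ∑ i, e i = 1)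
    {x y : ι → B} (hx : ∀ a, x a ∈ unitary B) (hxy : ∀ a, x a * y a = 1) {κ : ℝ} (hκ : 0 ≤ κ)
    (hc : ∀ a, ‖y a * e a - e a * y a‖ ≤ κ) :
    ‖(∑ a, e a * x a * e a) * (∑ a, e a * y a * e a) - 1‖ ≤ κ := by
  have h1 : (∑ a, e a * x a * e a) * (∑ a, e a * y a * e a) - 1 =
      ∑ a, e a * (x a * (e a * y a - y a * e a)) * e a := by
    rw [sum_conj_mul_sum_conj he hs]
    nth_rewrite 1 [← hs]
    rw [← Finset.sum_sub_distrib]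
    refine Finset.sum_congr rfl fun a _ => ?_
    have h2 : e a * (x a * (y a * e a)) * e a = e a := by
      rw [← mul_assoc (x a), hxy, one_mul, (he a).isIdempotentElem.eq, (he a).isIdempotentElem.eq]
    rw [mul_sub, mul_sub, sub_mul, h2, mul_assoc (x a)]
  rw [h1]
  refine norm_sum_conj_le he hs _ hκ fun a => ?_
  rw [norm_unitary_mul (hx a), norm_sub_rev]
  exact hc a

theorem norm_star_commutator (a f : B) : ‖star a * f - f * star a‖ = ‖a * star f - star f * a‖ := by
  rw [← norm_star, star_sub, star_mul, star_mul, star_star, norm_sub_rev]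

/-- A block sum of unitaries which almost commute with the blocks is close to a unitary. -/
theorem exists_unitary_near_sum_conj (he : ∀ i, IsStarProjection (e i)) (hs : ∑ i, e i = 1)
    {x : ι → B} (hx : ∀ a, x a ∈ unitary B) {κ : ℝ} (hκ : 0 ≤ κ) (hκ1 : κ ≤ 1 / 8)
    (hc : ∀ a, ‖x a * e a - e a * x a‖ ≤ κ) :
    ∃ v ∈ unitary B, ‖v - ∑ a, e a * x a * e a‖ ≤ κ := by
  set v₀ := ∑ a, e a * x a * e a with hv₀
  have hstar : star v₀ = ∑ a, e a * star (x a) * e a := by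
    rw [hv₀, star_sum]
    refine Finset.sum_congr rfl fun a _ => ?_
    rw [star_mul, star_mul, (he a).isSelfAdjoint.star_eq, mul_assoc]
  have hc' : ∀ a, ‖star (x a) * e a - e a * star (x a)‖ ≤ κ := fun a => by
    rw [norm_star_commutator, (he a).isSelfAdjoint.star_eq]; exact hc a
  have h1 : ‖star v₀ * v₀ - 1‖ ≤ κ := by
    rw [hstar]
    exact norm_sum_conj_mul_sub_one_le he hs (fun a => Unitary.star_mem (hx a))
      (fun a => Unitary.star_mul_self_of_mem (hx a)) hκ hc
  have h2 : ‖v₀ * star v₀ - 1‖ ≤ κ := by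
    rw [hstar]
    exact norm_sum_conj_mul_sub_one_le he hs hx (fun a => Unitary.mul_star_self_of_mem (hx a)) hκ hc'
  have h3 : ‖v₀‖ ≤ 1 := norm_sum_conj_le he hs x zero_le_one fun a =>
    (CStarRing.norm_of_mem_unitary (hx a)).le
  have hunit : IsUnit v₀ := by
    obtain ⟨a, ha⟩ := isUnit_of_norm_sub_one_lt (h1.trans_lt (by linarith))
    obtain ⟨b, hb⟩ := isUnit_of_norm_sub_one_lt (h2.trans_lt (by linarith))
    refine isUnit_iff_exists_and_exists.2 ⟨⟨star v₀ * ↑b⁻¹, ?_⟩, ⟨↑a⁻¹ * star v₀, ?_⟩⟩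
    · rw [← mul_assoc, ← hb, Units.mul_inv]
    · rw [mul_assoc, ← ha, Units.inv_mul]
  obtain ⟨v, hv, -, hvv⟩ := exists_unitary_mem_near_of_isUnit (S := (⊤ : StarSubalgebra ℂ B))
    (by simp) (StarSubalgebra.mem_top) hunit (by linarith) h1
  exact ⟨v, hv, hvv.trans (mul_le_of_le_one_left hκ h3)⟩

/-- The commutators of the `x a` with `f` form a block sum and cost `η` only once. The number of
blocks multiplies only `κ`, which can be chosen after that number is known. -/
theorem norm_sum_conj_commutator_le (he : ∀ i, IsStarProjection (e i)) (hs : ∑ i, e i = 1)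
    {x : ι → B} (hx : ∀ a, x a ∈ unitary B) {κ η : ℝ} (hη : 0 ≤ η) {f : B}
    (hf : ∀ a, ‖f * e a - e a * f‖ ≤ κ) (hxf : ∀ a, ‖x a * f - f * x a‖ ≤ η) :
    ‖(∑ a, e a * x a * e a) * f - f * ∑ a, e a * x a * e a‖ ≤ η + Fintype.card ι * (2 * κ) := by
  have h1 : (∑ a, e a * x a * e a) * f - f * ∑ a, e a * x a * e a =
      ∑ a, e a * (x a * f - f * x a) * e a +
        ∑ a, (e a * x a * (e a * f - f * e a) + (e a * f - f * e a) * (x a * e a)) := by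
    rw [Finset.sum_mul, Finset.mul_sum, ← Finset.sum_sub_distrib, ← Finset.sum_add_distrib]
    refine Finset.sum_congr rfl fun a _ => ?_
    noncomm_ring
  have hx1 : ∀ a, ‖x a‖ ≤ 1 := fun a => (CStarRing.norm_of_mem_unitary (hx a)).le
  rw [h1]
  refine (norm_add_le _ _).trans (add_le_add (norm_sum_conj_le he hs _ hη hxf) ?_)
  refine (norm_sum_le_of_le (n := fun _ => 2 * κ) _ fun a _ => ?_).trans (by simp)
  have h2 : ‖e a * f - f * e a‖ ≤ κ := by rw [norm_sub_rev]; exact hf a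
  have h3 := norm_mul_le_of_le (norm_mul_le_of_le (he a).norm_le (hx1 a)) h2
  have h4 := norm_mul_le_of_le h2 (norm_mul_le_of_le (hx1 a) (he a).norm_le)
  refine (norm_add_le _ _).trans ?_
  linarith

theorem norm_mul_conj_sub_le {p q x u : B} (hp : ‖p‖ ≤ 1) (hq : ‖q‖ ≤ 1) (hx : ‖x‖ ≤ 1) (hu : ‖u‖ ≤ 1)
    {κ : ℝ} (hpq : ‖p - q‖ ≤ κ) (huq : ‖u * q - q * u‖ ≤ κ) :
    ‖u * (p * x * p) - q * (u * x) * q‖ ≤ 3 * κ := by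
  have h1 : u * (p * x * p) - q * (u * x) * q = u * (p - q) * x * p + (u * q - q * u) * x * p +
      q * (u * x) * (p - q) := by noncomm_ring
  rw [h1]
  have h2 := norm_mul_le_of_le (norm_mul_le_of_le (norm_mul_le_of_le hu hpq) hx) hp
  have h3 := norm_mul_le_of_le (norm_mul_le_of_le huq hx) hp
  have h4 := norm_mul_le_of_le (norm_mul_le_of_le hq (norm_mul_le_of_le hu hx)) hpq
  refine (norm_add_le _ _).trans ?_
  have := norm_add_le (u * (p - q) * x * p) ((u * q - q * u) * x * p)
  linarith

/-- Gluing along Rohlin projections: unitaries `x a`, indexed by the levels of the towers, for which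
`u * β (x a)` is close to the `x` of the next level give an approximate solution of
`v * star (β v) = u`. -/
theorem exists_unitary_glue {β : B ≃⋆ₐ[ℂ] B} {σ : Equiv.Perm ι}
    (H : ∀ (F : Finset B) (ε : ℝ), 0 < ε →
      ∃ e : ι → B, (∀ a, IsStarProjection (e a)) ∧ ∑ a, e a = 1 ∧
        (∀ a, ‖β (e a) - e (σ a)‖ ≤ ε) ∧ ∀ a, ∀ x ∈ F, ‖x * e a - e a * x‖ ≤ ε)
    {u : B} (hu : u ∈ unitary B) {x : ι → B} (hx : ∀ a, x a ∈ unitary B) {η θ : ℝ} (hη : 0 ≤ η)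
    (hθ : 0 ≤ θ) (hθx : ∀ a, ‖u * β (x a) - x (σ a)‖ ≤ θ) {F : Finset B}
    (hF : ∀ a, ∀ f ∈ F, ‖x a * f - f * x a‖ ≤ η) {κ : ℝ} (hκ : 0 < κ) :
    ∃ v ∈ unitary B, (∀ f ∈ F, ‖v * f - f * v‖ ≤ η + κ) ∧
      ‖v * star (β v) * star u - 1‖ ≤ θ + κ := by
  classical
  set c : ℝ := ((Fintype.card ι : ℕ) : ℝ) with hc
  obtain ⟨C, hC0, hC⟩ : ∃ C : ℝ, 0 ≤ C ∧ ∀ f ∈ F, ‖f‖ ≤ C :=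
    ⟨∑ f ∈ F, ‖f‖, Finset.sum_nonneg fun _ _ => norm_nonneg _, fun f hf =>
      Finset.single_le_sum (f := fun f : B => ‖f‖) (fun _ _ => norm_nonneg _) hf⟩
  have hc0 : 0 ≤ c := Nat.cast_nonneg _
  set δ : ℝ := min (1 / 8) (κ / (3 * c + 2 * C + 2)) with hδ
  have hδ0 : 0 < δ := by positivity
  have hδκ : (3 * c + 2 * C + 2) * δ ≤ κ := by
    calc _ ≤ (3 * c + 2 * C + 2) * (κ / (3 * c + 2 * C + 2)) := by gcongr; exact min_le_right _ _
      _ = κ := by field_simp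
  obtain ⟨e, he, hs, heβ, heF⟩ := H (insert u (F ∪ Finset.univ.image x)) δ hδ0
  have heu : ∀ a, ‖u * e a - e a * u‖ ≤ δ := fun a => heF a u (Finset.mem_insert_self _ _)
  have hef : ∀ a, ∀ f ∈ F, ‖f * e a - e a * f‖ ≤ δ := fun a f hf =>
    heF a f (Finset.mem_insert_of_mem (Finset.mem_union_left _ hf))
  have hex : ∀ a, ‖x a * e a - e a * x a‖ ≤ δ := fun a => heF a _ (Finset.mem_insert_of_mem
    (Finset.mem_union_right _ (Finset.mem_image_of_mem _ (Finset.mem_univ a))))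
  obtain ⟨v, hv, hvv⟩ := exists_unitary_near_sum_conj he hs hx hδ0.le (min_le_left _ _) hex
  set v₀ := ∑ a, e a * x a * e a with hv₀
  have hv1 : ∀ (z : B), z ∈ unitary B → ‖z‖ ≤ 1 := fun z hz => (CStarRing.norm_of_mem_unitary hz).le
  refine ⟨v, hv, fun f hf => ?_, ?_⟩
  · have h1 : v * f - f * v = (v₀ * f - f * v₀) + ((v - v₀) * f - f * (v - v₀)) := by noncomm_ring
    have h2 := norm_sum_conj_commutator_le he hs hx hη (fun a => hef a f hf) fun a => hF a f hf
    have h3 := norm_mul_le_of_le hvv (hC f hf)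
    have h4 := norm_mul_le_of_le (hC f hf) hvv
    rw [h1]
    refine (norm_add_le _ _).trans ?_
    have h5 := norm_sub_le ((v - v₀) * f) (f * (v - v₀))
    rw [← hc, ← hv₀] at h2
    nlinarith
  · have h1 : v * star (β v) * star u - 1 = (v - u * β v) * star (u * β v) := by
      rw [sub_mul, Unitary.mul_star_self_of_mem (mul_mem hu (Unitary.map_mem β hv)), star_mul,
        mul_assoc]
    rw [h1, norm_mul_unitary (Unitary.star_mem (mul_mem hu (Unitary.map_mem β hv)))]
    have h2 : ‖u * β v₀ - v₀‖ ≤ c * (3 * δ) + θ := by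
      -- The first sum replaces `β (e a)` by `e (σ a)` and moves `u` past it, with a small error per
      -- level. The second, reindexed by `σ`, is block-diagonal and costs `θ` only once.
      have h3 : u * β v₀ - v₀ = ∑ a, (u * (β (e a) * β (x a) * β (e a)) -
            e (σ a) * (u * β (x a)) * e (σ a)) +
          ∑ a, e a * (u * β (x (σ.symm a)) - x a) * e a := by
        have h4 : ∑ a, e a * (u * β (x (σ.symm a)) - x a) * e a =
            ∑ a, e (σ a) * (u * β (x a)) * e (σ a) - v₀ := by
          rw [← Equiv.sum_comp σ]
          simp only [mul_sub, sub_mul, Equiv.symm_apply_apply, Finset.sum_sub_distrib]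
          rw [hv₀, Equiv.sum_comp σ fun a => e a * x a * e a]
        rw [h4, Finset.sum_sub_distrib, ← Finset.mul_sum, hv₀, map_sum]
        simp only [map_mul]
        abel
      rw [h3]
      refine (norm_add_le _ _).trans (add_le_add ?_ ?_)
      · refine (norm_sum_le_of_le (n := fun _ => 3 * δ) _ fun a _ => ?_).trans (by simp [hc])
        exact norm_mul_conj_sub_le ((he a).map β).norm_le (he _).norm_le
          (hv1 _ (Unitary.map_mem β (hx a))) (hv1 u hu) (heβ a) (heu _)
      · refine norm_sum_conj_le he hs _ hθ fun a => ?_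
        have := hθx (σ.symm a)
        rwa [Equiv.apply_symm_apply] at this
    have h3 : v - u * β v = (v - v₀) - (u * β v₀ - v₀) - u * β (v - v₀) := by
      rw [map_sub]; noncomm_ring
    have h4 : ‖u * β (v - v₀)‖ ≤ δ := by rw [norm_unitary_mul hu, norm_map_aut]; exact hvv
    rw [h3]
    refine (norm_sub_le _ _).trans ?_
    have := norm_sub_le (v - v₀) (u * β v₀ - v₀)
    have : 0 ≤ C * δ := by positivity
    nlinarith

end Blocks

/-! ### Almost central coboundaries from Rohlin towers -/

section Cocycle

variable (β : B ≃⋆ₐ[ℂ] B)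

/-- The products `u * β u * ⋯ * β^(n-1) u`. -/
def cocycle (u : B) : ℕ → B
  | 0 => 1
  | n + 1 => u * β (cocycle u n)

theorem cocycle_mem {u : B} (hu : u ∈ unitary B) (n : ℕ) : cocycle β u n ∈ unitary B := by
  induction n with
  | zero => exact one_mem _
  | succ n ih => exact mul_mem hu (Unitary.map_mem β ih)

theorem iter_symm_succ (n : ℕ) (f : B) :
    (iter β (n + 1)).symm f = (iter β n).symm (β.symm f) := rfl

theorem norm_aut_commutator (γ : B ≃⋆ₐ[ℂ] B) (x f : B) :
    ‖γ x * f - f * γ x‖ = ‖x * γ.symm f - γ.symm f * x‖ := by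
  rw [← norm_map_aut γ (x * _ - _), map_sub, map_mul, map_mul, γ.apply_symm_apply]

/-- The commutator of `β x` with `f` has the norm of that of `x` with `β⁻¹ f`; hence the inverse
translates of `f`. -/
theorem norm_cocycle_commutator_le {u : B} (hu : u ∈ unitary B) {δ : ℝ} (n : ℕ) :
    ∀ f, (∀ s < n, ‖u * (iter β s).symm f - (iter β s).symm f * u‖ ≤ δ) →
      ‖cocycle β u n * f - f * cocycle β u n‖ ≤ n * δ := by
  induction n with
  | zero => intro f _; simp [cocycle]
  | succ n ih =>
    intro f hf
    refine (norm_mul_commutator_le hu (Unitary.map_mem β (cocycle_mem β hu n)) f).trans ?_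
    rw [norm_aut_commutator]
    have h1 := ih (β.symm f) fun s hs => by rw [← iter_symm_succ]; exact hf _ (by omega)
    have h2 := hf 0 (by omega)
    push_cast
    have h3 : (iter β 0).symm f = f := rfl
    rw [h3] at h2
    linarith

/-- An approximate solution of `v * star (β v) = u`, from short paths joining `1` to the inverses of
the products of the translates of `u` over the towers. -/
theorem exists_approx_cobounding_of_paths {m : ℕ} {h : Fin m → ℕ}
    (H : ∀ (F : Finset B) (ε : ℝ), 0 < ε →
      ∃ e : (Σ i, Fin (h i)) → B, (∀ a, IsStarProjection (e a)) ∧ ∑ a, e a = 1 ∧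
        (∀ a, ‖β (e a) - e (shift h a)‖ ≤ ε) ∧ ∀ a, ∀ x ∈ F, ‖x * e a - e a * x‖ ≤ ε)
    {ε : ℝ} (hε : 0 < ε) (hπ : ∀ i, Real.pi ≤ ε / 4 * h i) {u : B} (hu : u ∈ unitary B) {F : Finset B}
    {z : Fin m → ℝ → B} (hz : ∀ i t, z i t ∈ unitary B) (hz0 : ∀ i, z i 0 = 1)
    (hz1 : ∀ i, ‖z i 1 - (iter β (h i)).symm (star (cocycle β u (h i)))‖ ≤ ε / 4)
    (hzL : ∀ i s t, ‖z i s - z i t‖ ≤ Real.pi * |s - t|)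
    (hzF : ∀ i, ∀ j < h i, ∀ f ∈ F, ∀ t,
      ‖z i t * (iter β j).symm f - (iter β j).symm f * z i t‖ ≤ ε / 4)
    (hU : ∀ i, ∀ j < h i, ∀ f ∈ F, ‖cocycle β u j * f - f * cocycle β u j‖ ≤ ε / 4) :
    ∃ v ∈ unitary B, (∀ f ∈ F, ‖v * f - f * v‖ ≤ ε) ∧ ‖v * star (β v) * star u - 1‖ ≤ ε := by
  let x : (Σ i, Fin (h i)) → B := fun a =>
    cocycle β u a.2 * iter β a.2 (z a.1 ((a.2 : ℕ) / (h a.1 : ℝ)))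
  have hx : ∀ a, x a ∈ unitary B := fun a =>
    mul_mem (cocycle_mem β hu _) (Unitary.map_mem _ (hz _ _))
  have hstep : ∀ (i : Fin m) (j : ℕ), 0 < h i → ‖z i (j / (h i : ℝ)) - z i ((j + 1) / (h i : ℝ))‖ ≤ ε / 4 := by
    intro i j hi
    have hi' : (0 : ℝ) < h i := by exact_mod_cast hi
    refine (hzL i _ _).trans ?_
    have : (j : ℝ) / h i - (j + 1) / h i = -(1 / h i) := by ring
    rw [this, abs_neg, abs_of_pos (by positivity), mul_one_div, div_le_iff₀ hi']
    exact hπ i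
  have hθ : ∀ a, ‖u * β (x a) - x (shift h a)‖ ≤ ε / 2 := by
    rintro ⟨i, j⟩
    have hi' : (0 : ℝ) < h i := by exact_mod_cast j.pos
    have h1 : u * β (x ⟨i, j⟩) = cocycle β u (j + 1) * iter β (j + 1) (z i ((j : ℕ) / (h i : ℝ))) := by
      simp only [x]
      rw [map_mul, ← mul_assoc]; rfl
    have h2 : ‖u * β (x ⟨i, j⟩) - cocycle β u (j + 1) *
        iter β (j + 1) (z i (((j : ℕ) + 1) / (h i : ℝ)))‖ ≤ ε / 4 := by
      rw [h1, ← mul_sub, norm_unitary_mul (cocycle_mem β hu _), ← map_sub, norm_map_aut]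
      exact hstep i j j.pos
    rw [shift_apply]
    rcases Nat.lt_or_ge ((j : ℕ) + 1) (h i) with hj | hj
    · have h3 : x ⟨i, ⟨((j : ℕ) + 1) % h i, Nat.mod_lt _ j.pos⟩⟩ = cocycle β u (j + 1) *
          iter β (j + 1) (z i (((j : ℕ) + 1) / (h i : ℝ))) := by
        simp only [x, Nat.mod_eq_of_lt hj]
        push_cast
        rfl
      rw [h3]
      linarith
    -- At the top of a tower the successor is level `0`, where `x = 1`. The end point of the path
    -- was chosen so that the full product over the tower returns approximately there.
    · have hj' : (j : ℕ) + 1 = h i := le_antisymm j.2 hj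
      have h3 : x ⟨i, ⟨((j : ℕ) + 1) % h i, Nat.mod_lt _ j.pos⟩⟩ = 1 := by
        simp only [x, hj', Nat.mod_self]
        simp [hz0, cocycle]
      have h4 : ((j : ℕ) : ℝ) + 1 = h i := by exact_mod_cast hj'
      rw [h4, div_self hi'.ne', hj'] at h2
      have h5 : ‖cocycle β u (h i) * iter β (h i) (z i 1) - 1‖ ≤ ε / 4 := by
        rw [← Unitary.mul_star_self_of_mem (cocycle_mem β hu (h i)), ← mul_sub,
          norm_unitary_mul (cocycle_mem β hu _),
          ← (iter β (h i)).apply_symm_apply (star (cocycle β u (h i))), ← map_sub, norm_map_aut]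
        exact hz1 i
      rw [h3]
      have := norm_add_le (u * β (x ⟨i, j⟩) - cocycle β u (h i) * iter β (h i) (z i 1))
        (cocycle β u (h i) * iter β (h i) (z i 1) - 1)
      rw [sub_add_sub_cancel] at this
      linarith
  have hF : ∀ a, ∀ f ∈ F, ‖x a * f - f * x a‖ ≤ ε / 2 := by
    rintro ⟨i, j⟩ f hf
    refine (norm_mul_commutator_le (cocycle_mem β hu _) (Unitary.map_mem _ (hz _ _)) f).trans ?_
    rw [norm_aut_commutator]
    linarith [hU i j j.2 f hf, hzF i j j.2 f hf ((j : ℕ) / (h i : ℝ))]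
  obtain ⟨v, hv, h1, h2⟩ := exists_unitary_glue H hu hx (half_pos hε).le (half_pos hε).le hθ hF
    (half_pos hε)
  exact ⟨v, hv, fun f hf => (h1 f hf).trans (by linarith), h2.trans (by linarith)⟩

variable {β}

theorem HasRohlinProperty.exists_long_towers (hR : HasRohlinProperty β) {ε : ℝ} (hε : 0 < ε) :
    ∃ (m : ℕ) (h : Fin m → ℕ), (∀ i, Real.pi ≤ ε / 4 * h i) ∧ ∀ (F : Finset B) (ε : ℝ), 0 < ε →
      ∃ e : (Σ i, Fin (h i)) → B, (∀ a, IsStarProjection (e a)) ∧ ∑ a, e a = 1 ∧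
        (∀ a, ‖β (e a) - e (shift h a)‖ ≤ ε) ∧ ∀ a, ∀ x ∈ F, ‖x * e a - e a * x‖ ≤ ε := by
  obtain ⟨N, hN⟩ := exists_nat_gt (Real.pi / (ε / 4))
  obtain ⟨m, h, hh, H⟩ := hR.exists_towers N
  refine ⟨m, h, fun i => ?_, H⟩
  rw [← div_le_iff₀' (by positivity)]
  exact hN.le.trans (by exact_mod_cast hh i)

/-- Without any commutation requirement; this covers the indices at which centrality of the sequence
has not yet taken effect. -/
theorem exists_approx_cobounding_of_mem (Φ : UHFSystem k B) (hR : HasRohlinProperty β) {ε : ℝ}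
    (hε : 0 < ε) {u : B} (hu : u ∈ unitary B) :
    ∃ v ∈ unitary B, ‖v * star (β v) * star u - 1‖ ≤ ε := by
  obtain ⟨m, h, hπ, H⟩ := hR.exists_long_towers hε
  obtain ⟨δ, hδ, hpath⟩ := Φ.exists_path 0 (show 0 < ε / 4 by positivity)
  choose z hz _ hz0 hz1 hzL using fun i => hpath ((iter β (h i)).symm (star (cocycle β u (h i))))
    (Unitary.map_mem _ (Unitary.star_mem (cocycle_mem β hu _))) fun s => by
      rw [Φ.unit_zero_eq_one, mul_one, one_mul, sub_self, norm_zero]; exact hδ.le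
  obtain ⟨v, hv, -, h1⟩ := exists_approx_cobounding_of_paths β H hε hπ hu (F := ∅) hz hz0 hz1 hzL
    (by simp) (by simp)
  exact ⟨v, hv, h1⟩

/-- Stability: almost central unitaries are approximate coboundaries of almost central unitaries. -/
theorem exists_approx_cobounding (Φ : UHFSystem k B) (hR : HasRohlinProperty β) (F : Finset B) {ε : ℝ}
    (hε : 0 < ε) : ∃ (F' : Finset B) (δ : ℝ), 0 < δ ∧ ∀ u ∈ unitary B,
      (∀ x ∈ F', ‖u * x - x * u‖ ≤ δ) →
      ∃ v ∈ unitary B, (∀ f ∈ F, ‖v * f - f * v‖ ≤ ε) ∧ ‖v * star (β v) * star u - 1‖ ≤ ε := by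
  classical
  obtain ⟨m, h, hπ, H⟩ := hR.exists_long_towers hε
  set M := ∑ i, h i with hM
  have hhM : ∀ i, h i ≤ M := fun i =>
    Finset.single_le_sum (f := h) (fun _ _ => Nat.zero_le _) (Finset.mem_univ i)
  obtain ⟨μ, hμ⟩ := Φ.exists_level ((Finset.range M ×ˢ F).image fun x => (iter β x.1).symm x.2)
    (show 0 < ε / 8 by positivity)
  obtain ⟨δ, hδ, hpath⟩ := Φ.exists_path μ (show 0 < ε / 4 by positivity)
  -- The path starts from `β^(-h)(U_h*)`, so its commutation with the matrix units amounts to that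
  -- of `U_h` with their images under `β^h`.
  let G : Finset B := F ∪ Finset.univ.image fun x : Fin m × Fin (k ^ μ) =>
    iter β (h x.1) (Φ.unit μ x.2 (Φ.zero μ))
  have hM1 : (0 : ℝ) < M + 1 := by positivity
  have hδ' : 0 < min δ (ε / 4) := by positivity
  refine ⟨(Finset.range M ×ˢ G).image fun x => (iter β x.1).symm x.2, min δ (ε / 4) / (M + 1),
    by positivity, fun u hu huF => ?_⟩
  have hU : ∀ j ≤ M, ∀ g ∈ G, ‖cocycle β u j * g - g * cocycle β u j‖ ≤ min δ (ε / 4) := by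
    intro j hj g hg
    refine (norm_cocycle_commutator_le β hu j g fun s hs => huF _ (Finset.mem_image.2 ⟨(s, g),
      Finset.mem_product.2 ⟨Finset.mem_range.2 (by omega), hg⟩, rfl⟩)).trans ?_
    have : (j : ℝ) ≤ M + 1 := by
      have : (j : ℝ) ≤ M := by exact_mod_cast hj
      linarith
    calc (j : ℝ) * (min δ (ε / 4) / (M + 1)) ≤ (M + 1) * (min δ (ε / 4) / (M + 1)) := by gcongr
      _ = _ := by field_simp
  choose z hz hzμ hz0 hz1 hzL using fun i => hpath ((iter β (h i)).symm (star (cocycle β u (h i))))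
    (Unitary.map_mem _ (Unitary.star_mem (cocycle_mem β hu _))) fun s => by
      have h1 := norm_aut_commutator (iter β (h i)).symm (star (cocycle β u (h i)))
        (Φ.unit μ (Φ.zero μ) s)
      rw [h1, norm_star_commutator, StarAlgEquiv.symm_symm, ← map_star, Φ.star_unit]
      exact (hU _ (hhM i) _ (Finset.mem_union_right _
        (Finset.mem_image_of_mem _ (Finset.mem_univ (i, s))))).trans (min_le_left _ _)
  refine exists_approx_cobounding_of_paths β H hε hπ hu hz hz0 hz1 hzL (fun i j hj f hf t => ?_)
    fun i j hj f hf => (hU j (hj.le.trans (hhM i)) f (Finset.mem_union_left _ hf)).trans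
      (min_le_right _ _)
  obtain ⟨y, hy, hyf⟩ := hμ ((iter β j).symm f) (Finset.mem_image.2 ⟨(j, f),
    Finset.mem_product.2 ⟨Finset.mem_range.2 (hj.trans_le (hhM i)), hf⟩, rfl⟩)
  refine (Φ.norm_commutator_le (hzμ i t) (CStarRing.norm_of_mem_unitary (hz i t)).le hy hyf).trans ?_
  linarith

end Cocycle

/-! ### Comparison with the functional-calculus logarithm -/

section Logarithm

theorem inLogDomain_of_mem_unitary {g : B} (hg : g ∈ unitary B) (h : ‖g - 1‖ < 1) : InLogDomain g :=
  ⟨⟨by rw [commute_iff_eq, Unitary.star_mul_self_of_mem hg, Unitary.mul_star_self_of_mem hg]⟩,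
    (Unitary.spectrum_subset_slitPlane_iff_norm_lt_two hg).2 (by linarith)⟩

theorem clog_eq_smul_arg {g : B} (hg : g ∈ unitary B) (h : ‖g - 1‖ < 1) :
    clog g = Complex.I • (Unitary.argSelfAdjoint ⟨g, hg⟩ : B) := by
  have hsp := (Unitary.spectrum_subset_slitPlane_iff_norm_lt_two hg).2 (by linarith)
  have hc : ContinuousOn (fun z : ℂ => (z.arg : ℂ)) (spectrum ℂ g) :=
    Complex.continuous_ofReal.comp_continuousOn (Complex.continuousOn_arg.mono hsp)
  rw [Unitary.argSelfAdjoint_coe, ← cfc_smul Complex.I (fun z : ℂ => (z.arg : ℂ)) g hc, clog]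
  refine cfc_congr fun z hz => ?_
  have hz1 : ‖z‖ = 1 := spectrum.norm_eq_one_of_unitary hg hz
  exact Complex.ext (by simp [Complex.log_re, hz1]) (by simp [Complex.log_im])

/-- Both sides are evaluated through `g = exp (i a)` with `a` the argument of `g`; the segment `exp
(i t a)` stays as close to `1` as `g` itself. -/
theorem map_clog {T : B →L[ℂ] ℂ} (hT : IsTraceFunctional T) {g : B} (hg : g ∈ unitary B)
    (h : ‖g - 1‖ < 1) : T (clog g) = trLog T g := by
  have h2 : ‖((⟨g, hg⟩ : unitary B) : B) - 1‖ < 2 := by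
    change ‖g - 1‖ < 2
    linarith
  have h3 := congrArg (fun x : unitary B => (x : B)) (expUnitary_argSelfAdjoint h2)
  simp only [selfAdjoint.expUnitary_coe] at h3
  rw [clog_eq_smul_arg hg h]
  conv_rhs => rw [← h3]
  refine (trLog_exp hT.comm fun t ht => ?_).symm
  have h4 := Unitary.norm_expUnitary_smul_argSelfAdjoint_sub_one_le ⟨g, hg⟩ ht h2
  rw [selfAdjoint.expUnitary_coe, selfAdjoint.val_smul, smul_comm] at h4
  exact h4.trans_lt h

end Logarithm

/-! ### Removing the trace of the logarithm -/

section Cobounding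

variable {T : B →L[ℂ] ℂ} {β : B ≃⋆ₐ[ℂ] B}

/-- Chains for `v`, `β(v)*` and `u*` combine to one for `v β(v)* u*`, in which the totals of `v` and
`β(v)*` cancel. A last step back to `1` subtracts the defect and closes the chain, whose total is
then integral. -/
theorem trLog_defect (hT : IsTraceFunctional T) (Φ : UHFSystem k B) (hβ : ∀ a, T (β a) = T a)
    {u : unitary B} (hu : HasDeterminant (T : B →ₗ[ℂ] ℂ) u 0) {v : B} (hv : v ∈ unitary B)
    (h : ‖v * star (β v) * star (u : B) - 1‖ ≤ 1 / 20) :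
    ∃ r ∈ kAdic k, trLog T (v * star (β v) * star (u : B)) = 2 * Real.pi * Complex.I * r := by
  obtain ⟨r, hr, hru⟩ := Reach.of_hasDeterminant hT Φ hu
  obtain ⟨c, hc⟩ := Reach.exists_of_unitary (T := T) Φ hv
  have h1 := (hc.mul ((hc.map β hβ).adjoint hT)).mul (hru.adjoint hT)
  have h2 := h1.step (one_mem _) (by rwa [norm_sub_rev])
  obtain ⟨s, hs, hcs⟩ := h2.of_one hT Φ
  rw [mul_one, trLog_star_unitary hT h1.mem (h.trans (by norm_num))] at hcs
  refine ⟨-(r + s), neg_mem (add_mem hr hs), ?_⟩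
  push_cast
  linear_combination -hcs

/-- An approximate solution of `v * star (β v) = u` can be corrected to one for which the logarithm
of the error has trace zero, provided that `u` has trivial determinant. -/
theorem exists_traceless_cobounding (hT : IsTraceFunctional T) (Φ : UHFSystem k B)
    (hR : HasRohlinProperty β) (hβ : ∀ a, T (β a) = T a) {ε : ℝ} (hε : 0 < ε) :
    ∃ θ > 0, ∀ u : unitary B, HasDeterminant (T : B →ₗ[ℂ] ℂ) u 0 → ∀ v ∈ unitary B,
      ‖v * star (β v) * star (u : B) - 1‖ ≤ θ → ∀ (F : Finset B) (η : ℝ), 0 < η →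
      ∃ w ∈ unitary B, (∀ f ∈ F, ‖w * f - f * w‖ ≤ ‖v * f - f * v‖ + η) ∧
        ‖w * star (β w) * star (u : B) - 1‖ ≤ ε ∧ trLog T (w * star (β w) * star (u : B)) = 0 := by
  obtain ⟨ρ, hρ, H⟩ := exists_unitary_of_trace_small hT Φ hR hβ
    (show 0 < min (ε / 2) (2 / 5) by positivity)
  -- The bound `ε/2` is half of the final error, `1/20` is the step size of `Reach`, and `ρ / (‖T‖ +
  -- 1)` forces `2π|r| ≤ 2ρ`.
  refine ⟨min (min (ε / 2) (1 / 20)) (ρ / (‖T‖ + 1)), by positivity,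
    fun u hu v hv hvu F η hη => ?_⟩
  have h1 := hvu.trans ((min_le_left _ _).trans (min_le_left _ _))
  have h2 := hvu.trans ((min_le_left _ _).trans (min_le_right _ _))
  have h3 := hvu.trans (min_le_right _ _)
  obtain ⟨r, hr, hrv⟩ := trLog_defect hT Φ hβ hu hv h2
  have hrρ : |(-r)| ≤ ρ := by
    have h4 := norm_trLog_le (T := T) (h2.trans (by norm_num))
    rw [hrv] at h4
    simp only [norm_mul, Complex.norm_ofNat, Complex.norm_real, Complex.norm_I, mul_one,
      Real.norm_eq_abs, abs_of_pos Real.pi_pos] at h4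
    have h5 : 2 * ‖T‖ * ‖v * star (β v) * star (u : B) - 1‖ ≤ 2 * ρ := by
      calc _ ≤ 2 * ‖T‖ * (ρ / (‖T‖ + 1)) := by gcongr
        _ ≤ 2 * (‖T‖ + 1) * (ρ / (‖T‖ + 1)) := by gcongr; linarith
        _ = 2 * ρ := by field_simp
    rw [abs_neg]
    nlinarith [Real.pi_gt_three, abs_nonneg r]
  obtain ⟨y, hy, hyF, hy1, hyT⟩ := H (-r) (neg_mem hr) hrρ F η hη
  have hg : v * y * star (β (v * y)) * star (u : B) =
      v * (y * star (β y)) * star v * (v * star (β v) * star (u : B)) := by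
    rw [map_mul, star_mul]
    calc _ = v * (y * star (β y)) * (star v * v) * (star (β v) * star (u : B)) := by
          rw [Unitary.star_mul_self_of_mem hv, mul_one]; simp only [mul_assoc]
      _ = _ := by simp only [mul_assoc]
  have hconj : ‖v * (y * star (β y)) * star v - 1‖ = ‖y * star (β y) - 1‖ := by
    have : v * (y * star (β y)) * star v - 1 = v * (y * star (β y) - 1) * star v := by
      rw [mul_sub, sub_mul, mul_one, Unitary.mul_star_self_of_mem hv]
    rw [this, norm_mul_unitary (Unitary.star_mem hv), norm_unitary_mul hv]
  have hg0 : v * star (β v) * star (u : B) ∈ unitary B :=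
    mul_mem (mul_mem hv (Unitary.star_mem (Unitary.map_mem β hv))) (Unitary.star_mem u.2)
  refine ⟨v * y, mul_mem hv hy, fun f hf => ?_, ?_, ?_⟩
  · exact (norm_mul_commutator_le hv hy f).trans (add_le_add le_rfl (hyF f hf))
  · rw [hg]
    have h4 : v * (y * star (β y)) * star v * (v * star (β v) * star (u : B)) - 1 =
        (v * (y * star (β y)) * star v - 1) * (v * star (β v) * star (u : B)) +
          (v * star (β v) * star (u : B) - 1) := by noncomm_ring
    rw [h4]
    refine (norm_add_le _ _).trans ?_
    rw [norm_mul_unitary hg0, hconj]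
    linarith [hy1.trans (min_le_left _ _)]
  · rw [hg, trLog_mul hT.comm (by rw [hconj]; exact hy1.trans (min_le_right _ _))
      (h2.trans (by norm_num)), trLog_conj_unitary hT hv, hyT, hrv]
    push_cast; ring

end Cobounding

/-! ### Diagonal choice and central sequences -/

section Sequences

/-- For each `n` take the largest `N ≤ n` with `P N n`. The cap is needed because `P N n` may hold
for every `N`; it does not prevent `N` from tending to infinity. -/
theorem exists_diagonal {α : Type*} {P : ℕ → ℕ → Prop} {R : ℕ → ℕ → α → Prop} (h0 : ∀ n, P 0 n)
    (hP : ∀ N, ∀ᶠ n in Filter.atTop, P N n) (hR : ∀ N n, P N n → ∃ v, R N n v) :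
    ∃ (v : ℕ → α) (N : ℕ → ℕ), Filter.Tendsto N Filter.atTop Filter.atTop ∧
      ∀ n, R (N n) n (v n) := by
  classical
  have hspec : ∀ n, P (Nat.findGreatest (fun N => P N n) n) n := fun n =>
    Nat.findGreatest_spec (P := fun N => P N n) (Nat.zero_le n) (h0 n)
  choose v hv using fun n => hR _ _ (hspec n)
  refine ⟨v, fun n => Nat.findGreatest (fun N => P N n) n, Filter.tendsto_atTop.2 fun N => ?_, hv⟩
  filter_upwards [hP N, Filter.eventually_ge_atTop N] with n h1 h2
  exact Nat.le_findGreatest h2 h1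

theorem tendsto_zero_of_mul_le_one {N : ℕ → ℕ} (hN : Filter.Tendsto N Filter.atTop Filter.atTop)
    {a : ℕ → ℝ} (h0 : ∀ n, 0 ≤ a n) {M : ℕ} (h : ∀ n, M < N n → N n * a n ≤ 1) :
    Filter.Tendsto a Filter.atTop (nhds 0) := by
  have h1 : Filter.Tendsto (fun n => ((N n : ℝ))⁻¹) Filter.atTop (nhds 0) :=
    tendsto_inv_atTop_zero.comp (tendsto_natCast_atTop_atTop.comp hN)
  refine squeeze_zero' (Filter.Eventually.of_forall h0) ?_ h1
  filter_upwards [hN.eventually_gt_atTop M] with n hn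
  have : (0 : ℝ) < N n := by exact_mod_cast (Nat.zero_le M).trans_lt hn
  rw [← one_div, le_div_iff₀' this]
  exact h n hn

theorem UHFSystem.isCentralSequence (Φ : UHFSystem k B) {v : ℕ → B} (hv : ∀ n, v n ∈ unitary B)
    (h : ∀ m i j, Filter.Tendsto (fun n => ‖v n * Φ.unit m i j - Φ.unit m i j * v n‖) Filter.atTop
      (nhds 0)) : IsCentralSequence v := by
  have hv1 : ∀ n, ‖v n‖ ≤ 1 := fun n => (CStarRing.norm_of_mem_unitary (hv n)).le
  refine ⟨⟨1, hv1⟩, fun b => ?_⟩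
  refine Metric.tendsto_atTop.2 fun ε hε => ?_
  obtain ⟨m, y, ⟨M, rfl⟩, hy⟩ := Φ.exists_near b (show 0 < ε / 4 by positivity)
  change ‖Φ.φ m M - b‖ < ε / 4 at hy
  have h1 : Filter.Tendsto (fun n => v n * Φ.φ m M - Φ.φ m M * v n) Filter.atTop (nhds 0) := by
    have h2 : (fun n => v n * Φ.φ m M - Φ.φ m M * v n) = fun n =>
        ∑ i, ∑ j, M i j • (v n * Φ.unit m i j - Φ.unit m i j * v n) := by
      funext n
      simp only [Φ.map_eq_sum, Finset.mul_sum, Finset.sum_mul, mul_smul_comm, smul_mul_assoc,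
        ← Finset.sum_sub_distrib, ← smul_sub]
    rw [h2, show (0 : B) = ∑ i : Fin (k ^ m), ∑ j : Fin (k ^ m), M i j • (0 : B) by simp]
    exact tendsto_finsetSum _ fun i _ => tendsto_finsetSum _ fun j _ =>
      (tendsto_zero_iff_norm_tendsto_zero.2 (h m i j)).const_smul _
  obtain ⟨n₀, hn₀⟩ := Metric.tendsto_atTop.1 h1 (ε / 4) (by positivity)
  refine ⟨n₀, fun n hn => ?_⟩
  have h2 := hn₀ n hn
  rw [dist_zero_right] at h2
  rw [Real.dist_eq, sub_zero, abs_of_nonneg (norm_nonneg _)]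
  have h3 : v n * b - b * v n = (v n * Φ.φ m M - Φ.φ m M * v n) -
      (v n * (Φ.φ m M - b) - (Φ.φ m M - b) * v n) := by noncomm_ring
  have h4 := norm_mul_le_of_le (hv1 n) hy.le
  have h5 := norm_mul_le_of_le hy.le (hv1 n)
  rw [h3]
  refine (norm_sub_le _ _).trans_lt ?_
  have := norm_sub_le (v n * (Φ.φ m M - b)) ((Φ.φ m M - b) * v n)
  linarith

theorem IsCentralSequence.eventually_le {x : ℕ → B} (hx : IsCentralSequence x) (F : Finset B) {δ : ℝ}
    (hδ : 0 < δ) : ∀ᶠ n in Filter.atTop, ∀ f ∈ F, ‖x n * f - f * x n‖ ≤ δ := by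
  rw [Filter.eventually_all_finset]
  intro f _
  filter_upwards [(hx.2 f).eventually (gt_mem_nhds hδ)] with n hn using hn.le

end Sequences

end RohlinUHF

theorem mainTheorem8 (k : ℕ) (hk : 2 ≤ k) {B : Type*} [CStarAlgebra B]
    (hB : RohlinUHF.IsUHFPow k B)
    (τ : B →ₗ[ℂ] ℂ) (hτ : RohlinUHF.IsTracialState τ)
    (β : B ≃⋆ₐ[ℂ] B) (hβ : RohlinUHF.HasRohlinProperty β)
    (u : ℕ → unitary B)
    (hu : RohlinUHF.IsCentralSequence (fun n => (u n : B)))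
    (hdet : ∀ n, RohlinUHF.HasDeterminant τ (u n) 0) :
    ∃ v : ℕ → unitary B,
      RohlinUHF.IsCentralSequence (fun n => (v n : B)) ∧
      RohlinUHF.SeqEq (fun n => (v n : B) * star (β (v n : B))) (fun n => (u n : B)) ∧
      ∀ n, RohlinUHF.InLogDomain ((v n : B) * star (β (v n : B)) * star (u n : B)) ∧
        τ (RohlinUHF.clog ((v n : B) * star (β (v n : B)) * star (u n : B))) = 0 := by
  classical
  have : Nontrivial B := ⟨1, 0, fun h => by
    have := hτ.map_one
    rw [h, map_zero] at this
    exact zero_ne_one this⟩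
  obtain ⟨φ, hinj, hmono, hdense⟩ := hB
  let Φ : RohlinUHF.UHFSystem k B := ⟨φ, hk, hinj, hmono, hdense⟩
  obtain ⟨T, hT, rfl⟩ := hτ.exists_traceFunctional
  have hTβ : ∀ a, T (β a) = T a := hT.map_automorphism Φ β
  let F : ℕ → Finset B := fun N => Finset.univ.image fun x : Σ m : Fin N, Fin (k ^ (m : ℕ)) × Fin (k ^ (m : ℕ)) =>
    Φ.unit x.1 x.2.1 x.2.2
  -- The bound `1/2` keeps the error in the domain of the logarithm at every index, not only
  -- eventually.
  let ε : ℕ → ℝ := fun N => min (1 / 2) (1 / (N + 1))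
  have hε : ∀ N, 0 < ε N := fun N => by positivity
  choose θ hθ hcorr using fun N => RohlinUHF.exists_traceless_cobounding hT Φ hβ hTβ (hε N)
  choose F' δ hδ happrox using fun N => RohlinUHF.exists_approx_cobounding Φ hβ (F N)
    (show 0 < min (θ N) (ε N / 2) from lt_min (hθ N) (half_pos (hε N)))
  let g : ℕ → B → B := fun n v => v * star (β v) * star (u n : B)
  -- At `N = 0` nothing is required of `u n`, so every index has a stage. In `R` the estimates are
  -- multiplied by `N` rather than compared with `1/N`, which makes those that express convergence
  -- void at that stage.
  let P : ℕ → ℕ → Prop := fun N n => N = 0 ∨ ∀ x ∈ F' N, ‖(u n : B) * x - x * (u n : B)‖ ≤ δ N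
  let R : ℕ → ℕ → B → Prop := fun N n v => v ∈ unitary B ∧
    (∀ f ∈ F N, N * ‖v * f - f * v‖ ≤ 1) ∧ N * ‖g n v - 1‖ ≤ 1 ∧ ‖g n v - 1‖ ≤ 1 / 2 ∧
      RohlinUHF.trLog T (g n v) = 0
  have hN : ∀ (N : ℕ) {t : ℝ}, t ≤ ε N → N * t ≤ 1 := fun N t ht => by
    have h1 : (0 : ℝ) < N + 1 := by positivity
    calc (N : ℝ) * t ≤ N * (1 / (N + 1)) := by gcongr; exact ht.trans (min_le_right _ _)
      _ ≤ 1 := by rw [mul_one_div, div_le_one h1]; linarith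
  obtain ⟨v, N, hNtop, hv⟩ := RohlinUHF.exists_diagonal (P := P) (R := R) (fun n => Or.inl rfl)
    (fun N => (hu.eventually_le (F' N) (hδ N)).mono fun n hn => Or.inr hn) fun N n hP => by
      have key : ∃ w ∈ unitary B, (∀ f ∈ F N, N = 0 ∨ ‖w * f - f * w‖ ≤ ε N) ∧
          ‖g n w - 1‖ ≤ ε N ∧ RohlinUHF.trLog T (g n w) = 0 := by
        rcases hP with hN0 | hP
        · obtain ⟨v₀, hv₀, h1⟩ := RohlinUHF.exists_approx_cobounding_of_mem Φ hβ (hθ N) (u n).2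
          obtain ⟨w, hw, -, h2, h3⟩ := hcorr N (u n) (hdet n) v₀ hv₀ h1 ∅ 1 one_pos
          exact ⟨w, hw, fun f _ => Or.inl hN0, h2, h3⟩
        · obtain ⟨v₀, hv₀, h0, h1⟩ := happrox N (u n) (u n).2 hP
          obtain ⟨w, hw, hwF, h2, h3⟩ := hcorr N (u n) (hdet n) v₀ hv₀ (h1.trans (min_le_left _ _))
            (F N) (ε N / 2) (half_pos (hε N))
          refine ⟨w, hw, fun f hf => Or.inr ?_, h2, h3⟩
          linarith [hwF f hf, (h0 f hf).trans (min_le_right _ _)]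
      obtain ⟨w, hw, h1, h2, h3⟩ := key
      refine ⟨w, hw, fun f hf => ?_, hN N h2, h2.trans (min_le_left _ _), h3⟩
      rcases h1 f hf with h | h
      · simp [h]
      · exact hN N h
  have hgu : ∀ n, g n (v n) ∈ unitary B := fun n => mul_mem (mul_mem (hv n).1
    (Unitary.star_mem (Unitary.map_mem β (hv n).1))) (Unitary.star_mem (u n).2)
  refine ⟨fun n => ⟨v n, (hv n).1⟩, Φ.isCentralSequence (fun n => (hv n).1) fun m i j => ?_, ?_,
    fun n => ?_⟩
  · refine RohlinUHF.tendsto_zero_of_mul_le_one hNtop (fun n => norm_nonneg _) (M := m)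
      fun n hn => (hv n).2.1 _ ?_
    exact Finset.mem_image.2 ⟨⟨⟨m, hn⟩, i, j⟩, Finset.mem_univ _, rfl⟩
  · refine RohlinUHF.tendsto_zero_of_mul_le_one hNtop (fun n => norm_nonneg _) (M := 0)
      fun n _ => ?_
    have h1 := RohlinUHF.norm_mul_star_sub_one (u n).2 (v n * star (β (v n)))
    rw [← h1]
    exact (hv n).2.2.1
  · have h1 : ‖g n (v n) - 1‖ < 1 := (hv n).2.2.2.1.trans_lt (by norm_num)
    exact ⟨RohlinUHF.inLogDomain_of_mem_unitary (hgu n) h1,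
      (RohlinUHF.map_clog hT (hgu n) h1).trans (hv n).2.2.2.2⟩
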